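/- **Theorem (Convergence).** Let $\alpha\in(0,1)$, $\theta=\alpha/2$, $\sigma\in(0,1)\cup(1,2)$, $\gamma,C_\gamma>0$, $a>0$, $b\in\mathbb R$, $c\ge 0$, $x_l<x_r$, $T>0$, $K\in\mathbb R$; write $\Omega=(x_l,x_r)$ and $\omega_\beta(t)=t^{\beta-1}/\Gamma(\beta)$. *Problem.* Let $u$, continuous on $\bar\Omega\times[0,T]$, solve $$\mathcal D_t^\alpha u:=\int_0^t\omega_{1-\alpha}(t-s)\,\partial_su(x,s)\,ds=a\,u_{xx}+b\,u_x-c\,u+f\ \text{ in }\Omega\times(0,T],\quad u(x,0)=\varphi(x)\ (x\in\Omega),\quad u=0\ \text{ on }\partial\Omega\times(0,T],$$ where $f(\cdot,t)$ is continuous on $\bar\Omega$ for every $t\in(0,T]$. Suppose that $u$ is $C^6$ in $x$ on $\Omega$ for each $t\in(0,T]$, that $t\mapsto\partial_x^lu(x,t)$ is $C^3$ on $(0,T]$ for each $x\in\Omega$ and $l\le2$, and that on $\Omega\times(0,T]$ $$|\partial_t^k\partial_x^lu|\le K(1+t^{\sigma-k})\quad(k=0,1,2,3,\ l=0,1,2),\qquad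 |\partial_x^mu|\le K\quad(m=3,4,5,6).$$ *Meshes.* Let $N,M\ge1$, $h=(x_r-x_l)/M$, $x_i=x_l+ih$, $0=t_0<t_1<\dots<t_N=T$, $\tau_k=t_k-t_{k-1}$, $\tau=\max_{1\le k\le N}\tau_k$, $\rho_k=\tau_k/\tau_{k+1}$, $t_{n-\theta}=\theta t_{n-1}+(1-\theta)t_n$, $t_{k-1/2}=(t_{k-1}+t_k)/2$. Assume * **M1.** $\rho_k\le 7/4$ for $1\le k\le N-1$. * **M2.** $\tau_k\le C_\gamma\tau\min\{1,t_k^{1-1/\gamma}\}$ for $1\le k\le N$, and $t_k\le C_\gamma t_{k-1}$, $\tau_k/t_k\le C_\gamma\tau_{k-1}/t_{k-1}$ for $2\le k\le N$. *Sum of exponentials (SOE).* Let $s^l,\varpi^l>0$ ($1\le l\le N_q$) satisfy $|\omega_{1-\alpha}(t)-\sum_l\varpi^le^{-s^lt}|\le\epsilon$ for $t\in[\Delta t,T]$, where $0<\Delta t\le(1-\theta)\tau_k$ for $2\le k\le N$ and $0<\epsilon\le\min\{\frac7{11},\frac{\theta}{1-\alpha}\}\,\omega_{1-\alpha}(T)$.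 *Scheme.* For a sequence $(v^k)_{k=0}^N$ put $\nabla_\tau v^k=v^k-v^{k-1}$, $v^{n-\theta}=\theta v^{n-1}+(1-\theta)v^n$, and define the fast Alikhanov formula $$(\mathcal D_\tau^\alpha v)^{n-\theta}=\frac{\nabla_\tau v^n}{\tau_n}\int_{t_{n-1}}^{t_{n-\theta}}\omega_{1-\alpha}(t_{n-\theta}-r)\,dr+\sum_{l}\varpi^l\mathcal Q^l(t_{n-1}),$$ $$\mathcal Q^l(t_0)=0,\qquad \mathcal Q^l(t_k)=e^{-s^l(\theta\tau_k+(1-\theta)\tau_{k+1})}\mathcal Q^l(t_{k-1})+a^{(k,l)}\nabla_\tau v^k+b^{(k,l)}(\rho_k\nabla_\tau v^{k+1}-\nabla_\tau v^k),$$ $$a^{(k,l)}=\frac1{\tau_k}\int_{t_{k-1}}^{t_k}e^{-s^l(t_{k+1-\theta}-r)}dr,\qquad b^{(k,l)}=\int_{t_{k-1}}^{t_k}e^{-s^l(t_{k+1-\theta}-r)}\frac{2(r-t_{k-1/2})}{\tau_k(\tau_k+\tau_{k+1})}dr.$$ With $\delta_x^2v_i=(v_{i+1}-2v_i+v_{i-1})/h^2$,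 $\delta_{\hat x}v_i=(v_{i+1}-v_{i-1})/(2h)$ and $\mathcal H=\frac{h^2}{12}(\delta_x^2+\frac ba\delta_{\hat x})+1$, let $u_i^n$ ($0\le i\le M$, $0\le n\le N$) satisfy, for $1\le i\le M-1$ and $1\le n\le N$, $$\mathcal H\big((\mathcal D_\tau^\alpha u_i)^{n-\theta}+cu_i^{n-\theta}-f(x_i,t_{n-\theta})\big)=\Big(a+\frac{h^2b^2}{12a}\Big)\delta_x^2u_i^{n-\theta}+b\,\delta_{\hat x}u_i^{n-\theta},$$ with $u_i^0=\varphi(x_i)$ for $1\le i\le M-1$ and $u_0^n=u_M^n=0$ for $0\le n\le N$. *Conclusion.* There is a constant $C>0$, depending only on $\alpha,\sigma,\gamma,C_\gamma,K,a,b,c,x_l,x_r,T$, such that $e_i^n=u(x_i,t_n)-u_i^n$ and $\|v\|=(h\sum_{i=1}^{M-1}v_i^2)^{1/2}$ satisfy $$\|e^n\|\le C\big(\tau^{\min\{\gamma\sigma,2\}}+h^4+\epsilon\big),\qquad 1\le n\le N,$$ and $$\|e^n\|\le C\big(\tau^{\min\{\gamma\sigma,2\}}+h^4\big),\qquad 1\le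 n\le N,$$ whenever the SOE tolerance satisfies $\epsilon\le\tau^{\min\{\gamma\sigma,2\}}+h^4$. -/

import Mathlib

namespace TFBS

noncomputable section

/-! ### The continuous problem -/

/-- The kernel `ω_β(t) = t^(β-1) / Γ(β)`, used for `t > 0`. -/
def fracKernel (β t : ℝ) : ℝ := t ^ (β - 1) / Real.Gamma β

/-- The Caputo derivative of order `α ∈ (0,1)`:
`(𝒟_t^α v)(t) = ∫_0^t ω_{1-α}(t-s) v'(s) ds`. -/
def caputo (α : ℝ) (v : ℝ → ℝ) (t : ℝ) : ℝ :=
  ∫ s in (0 : ℝ)..t, fracKernel (1 - α) (t - s) * deriv v s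

/-- `u` (a function of `x` and then `t`) is a classical solution on `[xl,xr] × [0,T]` of
`𝒟_t^α u = a u_xx + b u_x - c u + f` in `(xl,xr) × (0,T]`, with initial value `φ` and
homogeneous Dirichlet boundary values. -/
structure IsSolution (α a b c xl xr T : ℝ) (f : ℝ → ℝ → ℝ) (φ : ℝ → ℝ) (u : ℝ → ℝ → ℝ) :
    Prop where
  continuousOn : ContinuousOn (Function.uncurry u) (Set.Icc xl xr ×ˢ Set.Icc 0 T)
  equation : ∀ x ∈ Set.Ioo xl xr, ∀ t ∈ Set.Ioc 0 T,
    caputo α (fun s => u x s) t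
      = a * iteratedDeriv 2 (fun y => u y t) x + b * deriv (fun y => u y t) x
        - c * u x t + f x t
  initial : ∀ x ∈ Set.Ioo xl xr, u x 0 = φ x
  boundary : ∀ t ∈ Set.Ioc 0 T, u xl t = 0 ∧ u xr t = 0

/-- The partial derivative `∂_t^k ∂_x^l u (x,t)`, for `x` in an open interval and `t ∈ (0,T]`
(one-sided in time at `t = T`). -/
def mixedDeriv (T : ℝ) (u : ℝ → ℝ → ℝ) (k l : ℕ) (x t : ℝ) : ℝ :=
  iteratedDerivWithin k (fun s => iteratedDeriv l (fun y => u y s) x) (Set.Ioc 0 T) t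

/-- The regularity assumptions on the solution, with regularity parameter `σ` and constant `K`:
the derivatives below exist and are continuous in the variable of the last differentiation, and
`|∂_t^k ∂_x^l u| ≤ K (1 + t^(σ-k))` for `k ≤ 3`, `l ≤ 2`, `|∂_x^m u| ≤ K` for `3 ≤ m ≤ 6`,
everywhere in `(xl,xr) × (0,T]`. -/
structure HasRegularity (σ K xl xr T : ℝ) (u : ℝ → ℝ → ℝ) : Prop where
  smooth_space : ∀ t ∈ Set.Ioc 0 T, ContDiffOn ℝ 6 (fun y => u y t) (Set.Ioo xl xr)
  smooth_time : ∀ x ∈ Set.Ioo xl xr, ∀ l : ℕ, l ≤ 2 →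
    ContDiffOn ℝ 3 (fun s => iteratedDeriv l (fun y => u y s) x) (Set.Ioc 0 T)
  bound_mixed : ∀ x ∈ Set.Ioo xl xr, ∀ t ∈ Set.Ioc 0 T, ∀ k l : ℕ, k ≤ 3 → l ≤ 2 →
    |mixedDeriv T u k l x t| ≤ K * (1 + t ^ (σ - k))
  bound_space : ∀ x ∈ Set.Ioo xl xr, ∀ t ∈ Set.Ioc 0 T, ∀ m : ℕ, 3 ≤ m → m ≤ 6 →
    |iteratedDeriv m (fun y => u y t) x| ≤ K

/-! ### Time meshes -/

/-- `0 = t_0 < t_1 < ⋯ < t_N = T` (only `t 0, …, t N` matter). -/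
structure IsTimeMesh (T : ℝ) (N : ℕ) (t : ℕ → ℝ) : Prop where
  start : t 0 = 0
  finish : t N = T
  increasing : ∀ k, 1 ≤ k → k ≤ N → t (k - 1) < t k

/-- The `k`-th time step `τ_k = t_k - t_{k-1}`, `k ≥ 1`. -/
def step (t : ℕ → ℝ) (k : ℕ) : ℝ := t k - t (k - 1)

/-- The local step ratio `ρ_k = τ_k / τ_{k+1}`. -/
def ratio (t : ℕ → ℝ) (k : ℕ) : ℝ := step t k / step t (k + 1)

/-- The maximal step `τ = max_{1 ≤ k ≤ N} τ_k` (for `N ≥ 1`). -/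
def maxStep (N : ℕ) (t : ℕ → ℝ) : ℝ := ⨆ k : Fin N, step t (k + 1)

/-- Mesh condition M1: all step ratios are at most `7/4`. -/
def MeshM1 (N : ℕ) (t : ℕ → ℝ) : Prop :=
  ∀ k, 1 ≤ k → k ≤ N - 1 → ratio t k ≤ 7 / 4

/-- Mesh condition M2 with grading parameter `γ` and constant `Cγ`. -/
structure MeshM2 (γ Cγ : ℝ) (N : ℕ) (t : ℕ → ℝ) : Prop where
  step_le : ∀ k, 1 ≤ k → k ≤ N →
    step t k ≤ Cγ * maxStep N t * min 1 ((t k) ^ (1 - 1 / γ))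
  node_le : ∀ k, 2 ≤ k → k ≤ N → t k ≤ Cγ * t (k - 1)
  relative_step_le : ∀ k, 2 ≤ k → k ≤ N →
    step t k / t k ≤ Cγ * (step t (k - 1) / t (k - 1))

/-- The off-set time level `t_{n-θ} = θ t_{n-1} + (1-θ) t_n`. -/
def offTime (θ : ℝ) (t : ℕ → ℝ) (n : ℕ) : ℝ := θ * t (n - 1) + (1 - θ) * t n

/-- The backward difference `∇_τ v^k = v^k - v^{k-1}`. -/
def nabla (v : ℕ → ℝ) (k : ℕ) : ℝ := v k - v (k - 1)

/-- The weighted value `v^{n-θ} = θ v^{n-1} + (1-θ) v^n`. -/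
def offValue (θ : ℝ) (v : ℕ → ℝ) (n : ℕ) : ℝ := θ * v (n - 1) + (1 - θ) * v n

/-! ### The sum-of-exponentials approximation and the fast Alikhanov formula -/

/-- A sum-of-exponentials approximation with positive nodes `s^l` and positive weights `w^l` of
the kernel `ω_{1-α}` on `[Δt, T]`, with absolute tolerance `ε`. -/
structure IsSOE (α ε Δt T : ℝ) {Nq : ℕ} (s w : Fin Nq → ℝ) : Prop where
  node_pos : ∀ l, 0 < s l
  weight_pos : ∀ l, 0 < w l
  approx : ∀ r ∈ Set.Icc Δt T,
    |fracKernel (1 - α) r - ∑ l, w l * Real.exp (-(s l) * r)| ≤ ε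

/-- The local coefficient
`a_0^{(n)} = (1/τ_n) ∫_{t_{n-1}}^{t_{n-θ}} ω_{1-α}(t_{n-θ} - r) dr`, with `θ = α/2`. -/
def localCoeff (α : ℝ) (t : ℕ → ℝ) (n : ℕ) : ℝ :=
  1 / step t n * ∫ r in (t (n - 1))..(offTime (α / 2) t n),
    fracKernel (1 - α) (offTime (α / 2) t n - r)

/-- The coefficient `a^{(k,l)}` for the node `s = s^l`:
`(1/τ_k) ∫_{t_{k-1}}^{t_k} exp(-s (t_{k+1-θ} - r)) dr`. -/
def histCoeffA (α : ℝ) (t : ℕ → ℝ) (s : ℝ) (k : ℕ) : ℝ :=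
  1 / step t k * ∫ r in (t (k - 1))..(t k), Real.exp (-s * (offTime (α / 2) t (k + 1) - r))

/-- The coefficient `b^{(k,l)}` for the node `s = s^l`:
`∫_{t_{k-1}}^{t_k} exp(-s (t_{k+1-θ} - r)) · 2 (r - t_{k-1/2}) / (τ_k (τ_k + τ_{k+1})) dr`.
With `a^{(k,l)}` it integrates the exponential against the derivative
`∇v^k/τ_k + 2 (r - t_{k-1/2}) / (τ_k (τ_k + τ_{k+1})) · (ρ_k ∇v^{k+1} - ∇v^k)` of the
quadratic interpolant at `t_{k-1}, t_k, t_{k+1}`. -/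
def histCoeffB (α : ℝ) (t : ℕ → ℝ) (s : ℝ) (k : ℕ) : ℝ :=
  ∫ r in (t (k - 1))..(t k), Real.exp (-s * (offTime (α / 2) t (k + 1) - r)) *
    (2 * (r - (t (k - 1) + t k) / 2) / (step t k * (step t k + step t (k + 1))))

/-- The history term `Q^l(t_k)` for the node `s = s^l`, by its recursion in `k`. -/
def history (α : ℝ) (t : ℕ → ℝ) (s : ℝ) (v : ℕ → ℝ) : ℕ → ℝ
  | 0 => 0
  | k + 1 =>
      Real.exp (-s * (α / 2 * step t (k + 1) + (1 - α / 2) * step t (k + 2)))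
          * history α t s v k
        + histCoeffA α t s (k + 1) * nabla v (k + 1)
        + histCoeffB α t s (k + 1)
          * (ratio t (k + 1) * nabla v (k + 2) - nabla v (k + 1))

/-- The fast Alikhanov formula
`(𝒟_τ^α v)^{n-θ} = a_0^{(n)} ∇_τ v^n + ∑_l w^l Q^l(t_{n-1})`, `n ≥ 1`. -/
def fastAlikhanov (α : ℝ) (t : ℕ → ℝ) {Nq : ℕ} (s w : Fin Nq → ℝ) (v : ℕ → ℝ) (n : ℕ) : ℝ :=
  localCoeff α t n * nabla v n + ∑ l, w l * history α t (s l) v (n - 1)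

/-! ### The space grid and the scheme -/

/-- The space step `h = (xr - xl) / M`. -/
def spaceStep (xl xr : ℝ) (M : ℕ) : ℝ := (xr - xl) / M

/-- The grid point `x_i = xl + i h`. -/
def gridPoint (xl xr : ℝ) (M i : ℕ) : ℝ := xl + i * spaceStep xl xr M

/-- The second central difference `δ_x² v_i` (at `i ≥ 1`). -/
def secondDiff (h : ℝ) (v : ℕ → ℝ) (i : ℕ) : ℝ := (v (i + 1) - 2 * v i + v (i - 1)) / h ^ 2

/-- The first central difference `δ_x̂ v_i` (at `i ≥ 1`). -/
def centralDiff (h : ℝ) (v : ℕ → ℝ) (i : ℕ) : ℝ := (v (i + 1) - v (i - 1)) / (2 * h)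

/-- The averaging operator `ℋ = (h²/12) (δ_x² + (b/a) δ_x̂) + 1`. -/
def averageOp (a b h : ℝ) (v : ℕ → ℝ) (i : ℕ) : ℝ :=
  h ^ 2 / 12 * (secondDiff h v i + b / a * centralDiff h v i) + v i

/-- The discrete `L²` norm `(h ∑_{i=1}^{M-1} v_i²)^{1/2}`. -/
def discreteNorm (xl xr : ℝ) (M : ℕ) (v : ℕ → ℝ) : ℝ :=
  Real.sqrt (spaceStep xl xr M * ∑ i ∈ Finset.Icc 1 (M - 1), v i ^ 2)

/-- `U n i` (time index `n`, space index `i`) is a solution of the fully discrete scheme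
`ℋ((𝒟_τ^α U_i)^{n-θ} + c U_i^{n-θ} - f(x_i,t_{n-θ}))
  = (a + h²b²/(12a)) δ_x² U_i^{n-θ} + b δ_x̂ U_i^{n-θ}`, `1 ≤ i ≤ M-1`, `1 ≤ n ≤ N`, `θ = α/2`,
with `U_i^0 = φ(x_i)` at interior points and zero boundary values. -/
structure IsSchemeSolution (α a b c xl xr : ℝ) (f : ℝ → ℝ → ℝ) (φ : ℝ → ℝ)
    (N : ℕ) (t : ℕ → ℝ) {Nq : ℕ} (s w : Fin Nq → ℝ) (M : ℕ) (U : ℕ → ℕ → ℝ) : Prop where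
  scheme : ∀ n, 1 ≤ n → n ≤ N → ∀ i, 1 ≤ i → i ≤ M - 1 →
    averageOp a b (spaceStep xl xr M)
        (fun j => fastAlikhanov α t s w (fun k => U k j) n
          + c * offValue (α / 2) (fun k => U k j) n
          - f (gridPoint xl xr M j) (offTime (α / 2) t n)) i
      = (a + spaceStep xl xr M ^ 2 * b ^ 2 / (12 * a))
          * secondDiff (spaceStep xl xr M) (fun j => offValue (α / 2) (fun k => U k j) n) i
        + b * centralDiff (spaceStep xl xr M) (fun j => offValue (α / 2) (fun k => U k j) n) i
  initial : ∀ i, 1 ≤ i → i ≤ M - 1 → U 0 i = φ (gridPoint xl xr M i)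
  boundary : ∀ n, n ≤ N → U n 0 = 0 ∧ U n M = 0

end

end TFBS

open TFBS

/-! ### Energy stability of discrete convolution derivatives in a Hilbert space. -/

namespace TFBS

open Finset

/-! The error satisfies the scheme up to a residual. The proof combines a stability estimate for the
discrete fractional derivative, a residual bound in exactly the form this estimate can absorb, and a
spatial norm in which the compact scheme is dissipative.

Stability in time. Abel summation writes the fast Alikhanov formula as Σ_{k<n} d_k (v^n - v^k) with
d_k = A_{k+1} - A_k and A_0 = 0 (`fastAlikhanov_eq_weight`). The exponential sum κ is increasing
with increasing derivative. With S_k the integral of (r - t_{k-1})(t_k - r) κ'(r) over the k-th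
interval, Chebyshev's inequality and ρ_k ≤ 7/4 give d_k ≥ S_k/τ_k² ≥ 0 for k ≥ 1 (`weight_diff_ge`).
Nonnegative d_k yield an energy inequality as soon as A_n is large enough compared with A_{n-1}
(`energy_le_inner`). This can fail only in steps comparable with T, whose number is bounded in terms
of α (`exists_bad`); each of them costs a constant factor. Elsewhere the energy is compared with a
barrier Ψ whose discrete derivative dominates the residual (`norm_le_of_barrier`). Since c ≥ 0, no
Grönwall argument is needed.

Consistency in time. Integration by parts tests the quadratic interpolation error with κ'. That
error carries the factor (r - t_{k-1})(t_k - r), so S_k appears and the k-th history error is at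
most a multiple of d_k g_k, with g_k = (τ_k/t_k)³ t_k^σ. The local part is bounded by A_n g_n
because θ = α/2 annihilates a first moment, and the exponential sum costs a multiple of ε
(`exists_temporal_truncation`). The barrier const - g_k, set to 0 at k = 0, reproduces Σ d_k g_k
exactly; what remains is absorbed by const · A_1, where A_1 ≥ (16/121) ω_{1-α}(t_n)
(`exists_barrier`). Mesh grading turns powers of τ_k/t_k into the rate min{γσ, 2}.

Space. Let H be the averaging operator, L the flux operator and P = bh/a. For |P| ≤ 1, summation by
parts gives ⟨Lx, Hx⟩ ≤ 0, so H is a suitable change of norm (`isSpaceStable_of_small`). Only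
finitely many M remain. For each of them the field of values of the pencil (H, L) still satisfies a
strict sign condition; the Cayley transform (H + L)(H - L)⁻¹ then has spectral radius below 1, and a
Lyapunov norm makes the scheme dissipative (`exists_lyapunov`, `exists_uniform_isSpaceStable`).

Boundary. The equation and the bounds on derivatives hold only inside Ω, whereas the stencils reach
the end points. The Caputo derivative decays linearly towards the boundary, so the equation extends
continuously (`continuousOn_caputo`), and stencil estimates follow from slightly smaller stencils in
the limit. -/

lemma sum_smul_nabla {E : Type*} [AddCommGroup E] [Module ℝ E] (c : ℕ → ℝ) (hc : c 0 = 0)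
    (y : ℕ → E) (n : ℕ) :
    ∑ k ∈ range n, c (k + 1) • (y (k + 1) - y k)
      = ∑ k ∈ range n, (c (k + 1) - c k) • (y n - y k) := by
  induction n with
  | zero => simp
  | succ n ih =>
    have h1 : ∀ k ∈ range n, (c (k + 1) - c k) • (y (n + 1) - y k)
        = (c (k + 1) - c k) • (y n - y k) + (c (k + 1) - c k) • (y (n + 1) - y n) := by
      intro k _
      rw [← smul_add]
      congr 1
      abel
    rw [sum_range_succ, ih, sum_range_succ _ n, sum_congr rfl h1, sum_add_distrib, ← sum_smul,
      sum_range_sub, hc, add_assoc, ← add_smul]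
    congr 2
    ring

/-- The energy inequality behind Alikhanov's formula: testing a discrete convolution derivative
with nonnegative weights `d` with the off-set value dominates the derivative of the energy. -/
lemma energy_le_inner {F : Type*} [NormedAddCommGroup F] [InnerProductSpace ℝ F] (θ : ℝ) (m : ℕ)
    (d : ℕ → ℝ) (hd : ∀ k < m, 0 ≤ d k) (y : ℕ → F)
    (hθ : θ ^ 2 * ∑ k ∈ range m, d k ≤ (1 - 2 * θ) * d m) :
    ∑ k ∈ range (m + 1), d k * (‖y (m + 1)‖ ^ 2 - ‖y k‖ ^ 2)
      ≤ 2 * inner ℝ (∑ k ∈ range (m + 1), d k • (y (m + 1) - y k))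
          (θ • y m + (1 - θ) • y (m + 1)) := by
  set Z := y (m + 1) - y m with hZ
  have hx : θ • y m + (1 - θ) • y (m + 1) = y (m + 1) - θ • Z := by
    rw [hZ]; module
  have key : ∀ k, 2 * inner ℝ (y (m + 1) - y k) (y (m + 1) - θ • Z)
      = (‖y (m + 1)‖ ^ 2 - ‖y k‖ ^ 2) + (‖y (m + 1) - y k‖ ^ 2
        - 2 * θ * inner ℝ (y (m + 1) - y k) Z) := by
    intro k
    have h1 : ‖y k‖ ^ 2 = ‖y (m + 1) - (y (m + 1) - y k)‖ ^ 2 := by simp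
    rw [h1, norm_sub_sq_real (y (m + 1)), inner_sub_right, inner_smul_right,
      real_inner_comm (y (m + 1)) (y (m + 1) - y k)]
    ring
  rw [hx, sum_inner, mul_sum]
  simp only [inner_smul_left, RCLike.conj_to_real]
  -- Completing the square costs θ²‖Z‖² for each k < m, while the term k = m leaves a surplus (1 -
  -- 2θ)‖Z‖²; `hθ` says that the surplus pays for the losses.
  have h2 : ∀ k ∈ range m, d k * (‖y (m + 1)‖ ^ 2 - ‖y k‖ ^ 2) - d k * (θ ^ 2 * ‖Z‖ ^ 2)
      ≤ 2 * (d k * inner ℝ (y (m + 1) - y k) (y (m + 1) - θ • Z)) := by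
    intro k hk
    have hdk := hd k (mem_range.1 hk)
    have h3 : 0 ≤ ‖y (m + 1) - y k‖ ^ 2 - 2 * θ * inner ℝ (y (m + 1) - y k) Z
        + θ ^ 2 * ‖Z‖ ^ 2 := by
      have h4 := norm_sub_sq_real (y (m + 1) - y k) (θ • Z)
      rw [inner_smul_right, norm_smul, mul_pow, Real.norm_eq_abs, sq_abs] at h4
      nlinarith [sq_nonneg ‖y (m + 1) - y k - θ • Z‖]
    have := key k
    nlinarith [mul_nonneg hdk h3]
  have h5 := sum_le_sum h2
  rw [sum_sub_distrib, ← sum_mul] at h5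
  rw [sum_range_succ, sum_range_succ _ m]
  have h6 := key m
  rw [← hZ, real_inner_self_eq_norm_sq] at h6
  have h7 : 2 * (d m * inner ℝ Z (y (m + 1) - θ • Z))
      = d m * (‖y (m + 1)‖ ^ 2 - ‖y m‖ ^ 2) + (1 - 2 * θ) * d m * ‖Z‖ ^ 2 := by
    linear_combination d m * h6
  rw [h7]
  nlinarith [mul_le_mul_of_nonneg_right hθ (sq_nonneg ‖Z‖)]

/-- An implicit step is stable, whatever the weights. -/
lemma norm_le_of_implicit_step {F : Type*} [NormedAddCommGroup F] [InnerProductSpace ℝ F]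
    {θ : ℝ} (hθ0 : 0 ≤ θ) (hθ1 : θ ≤ 1 / 2) (m : ℕ) (d : ℕ → ℝ) (hd : ∀ k < m + 1, 0 ≤ d k)
    (hS : 0 < ∑ k ∈ range (m + 1), d k) (y : ℕ → F) {B lam : ℝ} (hB : ∀ k ≤ m, ‖y k‖ ≤ B)
    (h : inner ℝ (∑ k ∈ range (m + 1), d k • (y (m + 1) - y k))
        (θ • y m + (1 - θ) • y (m + 1))
      ≤ ((∑ k ∈ range (m + 1), d k) * lam) * ‖θ • y m + (1 - θ) • y (m + 1)‖) (hl : 0 ≤ lam) :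
    ‖y (m + 1)‖ ≤ 3 * B + 2 * lam := by
  set x := θ • y m + (1 - θ) • y (m + 1) with hx
  set S := ∑ k ∈ range (m + 1), d k with hSdef
  have hB0 : 0 ≤ B := (norm_nonneg _).trans (hB m le_rfl)
  -- This isolates the off-set value x: up to the data, S x is a d-weighted sum of convex
  -- combinations of earlier values, so no relation between the weights is needed.
  have h1 : (1 - θ) • ∑ k ∈ range (m + 1), d k • (y (m + 1) - y k)
      = S • x - ∑ k ∈ range (m + 1), d k • (θ • y m + (1 - θ) • y k) := by
    rw [hSdef, sum_smul, ← sum_sub_distrib, smul_sum]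
    refine sum_congr rfl fun k _ => ?_
    rw [hx]; module
  have h2 : ‖∑ k ∈ range (m + 1), d k • (θ • y m + (1 - θ) • y k)‖ ≤ S * B := by
    rw [hSdef, sum_mul]
    refine (norm_sum_le _ _).trans (sum_le_sum fun k hk => ?_)
    have hk' := mem_range.1 hk
    rw [norm_smul, Real.norm_of_nonneg (hd k hk')]
    refine mul_le_mul_of_nonneg_left ?_ (hd k hk')
    refine (norm_add_le _ _).trans ?_
    rw [norm_smul, norm_smul, Real.norm_of_nonneg hθ0, Real.norm_of_nonneg (by linarith)]
    have := hB m le_rfl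
    have := hB k (by omega)
    nlinarith
  have h3 : S * ‖x‖ ^ 2 ≤ (S * B + S * lam) * ‖x‖ := by
    have h4 : S * ‖x‖ ^ 2 = (1 - θ) * inner ℝ (∑ k ∈ range (m + 1), d k • (y (m + 1) - y k)) x
        + inner ℝ (∑ k ∈ range (m + 1), d k • (θ • y m + (1 - θ) • y k)) x := by
      have h5 := congrArg (fun z => inner ℝ z x) h1
      simp only [inner_sub_left, inner_smul_left, RCLike.conj_to_real,
        real_inner_self_eq_norm_sq] at h5
      linarith
    have h6 := (real_inner_le_norm (∑ k ∈ range (m + 1), d k • (θ • y m + (1 - θ) • y k)) x).trans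
      (mul_le_mul_of_nonneg_right h2 (norm_nonneg x))
    have h7 : (1 - θ) * inner ℝ (∑ k ∈ range (m + 1), d k • (y (m + 1) - y k)) x
        ≤ (1 - θ) * (S * lam * ‖x‖) := mul_le_mul_of_nonneg_left h (by linarith)
    have h8 : 0 ≤ θ * (S * lam * ‖x‖) := by positivity
    linarith
  have hxB : ‖x‖ ≤ B + lam := by
    by_contra! hcon
    have hxpos : 0 < ‖x‖ := by linarith
    have : S * ‖x‖ * (‖x‖ - (B + lam)) ≤ 0 := by linarith
    have : 0 < S * ‖x‖ * (‖x‖ - (B + lam)) := by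
      have : 0 < ‖x‖ - (B + lam) := by linarith
      positivity
    linarith
  have h9 : (1 - θ) • y (m + 1) = x - θ • y m := by rw [hx]; module
  have h10 : (1 - θ) * ‖y (m + 1)‖ ≤ B + lam + θ * B := by
    have h11 := norm_sub_le x (θ • y m)
    rw [← h9, norm_smul, norm_smul, Real.norm_of_nonneg hθ0, Real.norm_of_nonneg (by linarith)]
      at h11
    have := mul_le_mul_of_nonneg_left (hB m le_rfl) hθ0
    linarith
  -- For θ ≤ 1/2 one has (1 + θ)/(1 - θ) ≤ 3 and 1/(1 - θ) ≤ 2.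
  nlinarith [norm_nonneg (y (m + 1))]

section

variable {F : Type*} [NormedAddCommGroup F] [InnerProductSpace ℝ F] {θ : ℝ} {N : ℕ}
  {d : ℕ → ℕ → ℝ} {y : ℕ → F} {Ψ : ℕ → ℝ} {lam : ℝ}

/-- Comparison on a block of steps where the energy inequality holds. With W the largest norm up to
p, the right-hand side is at most W times the discrete derivative of Ψ, so ‖y n‖² - 2WΨ n cannot
exceed its earlier values. At the maximum W² ≤ B² + 2W lam, hence W ≤ B + 2 lam. -/
lemma norm_le_of_energy_block
    (hd : ∀ n, 1 ≤ n → n ≤ N → ∀ k < n, 0 ≤ d n k)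
    (hS : ∀ n, 1 ≤ n → n ≤ N → 0 < ∑ k ∈ range n, d n k)
    (hΨ0 : ∀ n ≤ N, 0 ≤ Ψ n) (hΨ1 : ∀ n ≤ N, Ψ n ≤ lam)
    (hθ0 : 0 ≤ θ) (hθ1 : θ ≤ 1 / 2)
    (h : ∀ n, 1 ≤ n → n ≤ N →
      inner ℝ (∑ k ∈ range n, d n k • (y n - y k)) (θ • y (n - 1) + (1 - θ) • y n)
        ≤ (∑ k ∈ range n, d n k * (Ψ n - Ψ k)) * ‖θ • y (n - 1) + (1 - θ) • y n‖)
    (hr : ∀ n, 1 ≤ n → n ≤ N → 0 ≤ ∑ k ∈ range n, d n k * (Ψ n - Ψ k))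
    {m p : ℕ} (hp : p ≤ N) {B : ℝ} (hB0 : 0 ≤ B) (hB : ∀ k ≤ m, k ≤ p → ‖y k‖ ≤ B)
    (hgood : ∀ n, 1 ≤ n → m < n → n ≤ p →
      θ ^ 2 * ∑ k ∈ range (n - 1), d n k ≤ (1 - 2 * θ) * d n (n - 1)) :
    ∀ k ≤ p, ‖y k‖ ≤ B + 2 * lam := by
  have hl : 0 ≤ lam := (hΨ0 p hp).trans (hΨ1 p hp)
  obtain ⟨k0, hk0, hmax⟩ := (range (p + 1)).exists_max_image (fun k => ‖y k‖) ⟨0, by simp⟩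
  have hk0p : k0 ≤ p := by have := mem_range.1 hk0; omega
  have hW : ∀ k ≤ p, ‖y k‖ ≤ ‖y k0‖ := fun k hk => hmax k (mem_range.2 (by omega))
  set W := ‖y k0‖
  have hW0 : 0 ≤ W := norm_nonneg _
  have claim : ∀ n, n ≤ p → ‖y n‖ ^ 2 ≤ B ^ 2 + 2 * W * Ψ n := by
    intro n
    induction n using Nat.strong_induction_on with
    | _ n ih =>
      intro hn
      by_cases hnm : n ≤ m ∨ n = 0
      · have h1 : ‖y n‖ ≤ B := hB n (by omega) hn
        have h2 : ‖y n‖ ^ 2 ≤ B ^ 2 := by gcongr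
        have := hΨ0 n (by omega)
        have : 0 ≤ 2 * W * Ψ n := by positivity
        linarith
      · obtain ⟨q, rfl⟩ : ∃ q, n = q + 1 := ⟨n - 1, by omega⟩
        have e1 := energy_le_inner θ q (d (q + 1))
          (fun k hk => hd (q + 1) (by omega) (by omega) k (by omega)) y
          (by simpa using hgood (q + 1) (by omega) (by omega) hn)
        have e2 := h (q + 1) (by omega) (by omega)
        have e3 := hr (q + 1) (by omega) (by omega)
        simp only [Nat.add_sub_cancel] at e2
        have hx : ‖θ • y q + (1 - θ) • y (q + 1)‖ ≤ W := by
          refine (norm_add_le _ _).trans ?_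
          rw [norm_smul, norm_smul, Real.norm_of_nonneg hθ0, Real.norm_of_nonneg (by linarith)]
          have := hW q (by omega)
          have := hW (q + 1) hn
          nlinarith
        have e4 := e2.trans (mul_le_mul_of_nonneg_left hx e3)
        have e5 : ∑ k ∈ range (q + 1), d (q + 1) k * (‖y (q + 1)‖ ^ 2 - 2 * W * Ψ (q + 1) - B ^ 2)
            ≤ 0 := by
          calc _ ≤ ∑ k ∈ range (q + 1), (d (q + 1) k * (‖y (q + 1)‖ ^ 2 - ‖y k‖ ^ 2)
                - 2 * W * (d (q + 1) k * (Ψ (q + 1) - Ψ k))) := by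
                refine sum_le_sum fun k hk => ?_
                have hk' := mem_range.1 hk
                have := ih k hk' (by omega)
                have := mul_le_mul_of_nonneg_left this
                  (hd (q + 1) (by omega) (by omega) k hk')
                linarith
            _ ≤ 0 := by
                rw [sum_sub_distrib, ← mul_sum]
                linarith
        rw [← sum_mul] at e5
        have := hS (q + 1) (by omega) (by omega)
        by_contra! hcon
        have : 0 < (∑ k ∈ range (q + 1), d (q + 1) k)
            * (‖y (q + 1)‖ ^ 2 - 2 * W * Ψ (q + 1) - B ^ 2) :=
          mul_pos this (by linarith)
        linarith
  have h1 := claim k0 hk0p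
  have h2 := hΨ1 k0 (by omega)
  have h3 : W ^ 2 ≤ B ^ 2 + 2 * W * lam := by
    have := mul_le_mul_of_nonneg_left h2 (by positivity : 0 ≤ 2 * W)
    linarith
  have h4 : W ≤ B + 2 * lam := by
    by_contra! hcon
    nlinarith
  exact fun k hk => (hW k hk).trans h4

/-- Stability of dissipative evolutions driven by a discrete convolution derivative with monotone
weights, in terms of a barrier `Ψ`; in the steps in `bad` the energy inequality may fail. -/
theorem norm_le_of_barrier
    (hd : ∀ n, 1 ≤ n → n ≤ N → ∀ k < n, 0 ≤ d n k)
    (hS : ∀ n, 1 ≤ n → n ≤ N → 0 < ∑ k ∈ range n, d n k)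
    (hΨ0 : ∀ n ≤ N, 0 ≤ Ψ n) (hΨ1 : ∀ n ≤ N, Ψ n ≤ lam)
    (hθ0 : 0 ≤ θ) (hθ1 : θ ≤ 1 / 2) (hy : y 0 = 0)
    (h : ∀ n, 1 ≤ n → n ≤ N →
      inner ℝ (∑ k ∈ range n, d n k • (y n - y k)) (θ • y (n - 1) + (1 - θ) • y n)
        ≤ (∑ k ∈ range n, d n k * (Ψ n - Ψ k)) * ‖θ • y (n - 1) + (1 - θ) • y n‖)
    (hr : ∀ n, 1 ≤ n → n ≤ N → 0 ≤ ∑ k ∈ range n, d n k * (Ψ n - Ψ k))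
    (bad : Finset ℕ)
    (hgood : ∀ n, 1 ≤ n → n ≤ N → n ∉ bad →
      θ ^ 2 * ∑ k ∈ range (n - 1), d n k ≤ (1 - 2 * θ) * d n (n - 1)) :
    ∀ n ≤ N, ‖y n‖ ≤ 4 * 3 ^ bad.card * lam := by
  have hl : 0 ≤ lam := (hΨ0 0 (by omega)).trans (hΨ1 0 (by omega))
  -- Induction on the number of exceptional steps up to p. Crossing the last one turns a bound B
  -- into 3B + 2 lam, and the block after it adds 2 lam; 4·3^j - 2 solves this recursion with
  -- initial value 2.
  have main : ∀ j : ℕ, ∀ p ≤ N, (bad.filter (fun n => 1 ≤ n ∧ n ≤ p)).card ≤ j →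
      ∀ k ≤ p, ‖y k‖ ≤ (4 * 3 ^ j - 2) * lam := by
    intro j
    induction j with
    | zero =>
      intro p hp hc k hk
      have hc' : bad.filter (fun n => 1 ≤ n ∧ n ≤ p) = ∅ := card_eq_zero.1 (by omega)
      have := norm_le_of_energy_block hd hS hΨ0 hΨ1 hθ0 hθ1 h hr (m := 0) hp le_rfl
        (by intro k hk _; obtain rfl : k = 0 := by omega
            simp [hy])
        (fun n h1 _ h3 => hgood n h1 (by omega) (fun hb => by
          have : n ∈ bad.filter (fun n => 1 ≤ n ∧ n ≤ p) := mem_filter.2 ⟨hb, h1, h3⟩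
          rw [hc'] at this
          simp at this)) k hk
      simpa using this.trans (by linarith)
    | succ j ih =>
      intro p hp hc
      set s := bad.filter (fun n => 1 ≤ n ∧ n ≤ p) with hs
      rcases s.eq_empty_or_nonempty with he | hne
      · intro k hk
        refine (ih p hp (by rw [← hs, he]; simp) k hk).trans ?_
        have : (3 : ℝ) ^ j ≤ 3 ^ (j + 1) := pow_le_pow_right₀ (by norm_num) (by omega)
        gcongr
      · have hmax : ∀ n ∈ s, n ≤ s.max' hne := fun n hn => s.le_max' n hn
        have hmem := s.max'_mem hne
        generalize s.max' hne = m at *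
        obtain ⟨hm1, hm2, hm3⟩ := mem_filter.1 (hs ▸ hmem)
        obtain ⟨q, rfl⟩ : ∃ q, m = q + 1 := ⟨m - 1, by omega⟩
        have hq : ∀ k ≤ q, ‖y k‖ ≤ (4 * 3 ^ j - 2) * lam := by
          refine ih q (by omega) ?_
          have hsub : bad.filter (fun n => 1 ≤ n ∧ n ≤ q) ⊆ s.erase (q + 1) := by
            intro n hn
            obtain ⟨a1, a2, a3⟩ := mem_filter.1 hn
            exact mem_erase.2 ⟨by omega, hs ▸ mem_filter.2 ⟨a1, a2, by omega⟩⟩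
          have := card_le_card hsub
          rw [card_erase_of_mem hmem] at this
          omega
        have hΛ : 0 ≤ (4 * 3 ^ j - 2 : ℝ) * lam := (norm_nonneg _).trans (hq 0 (by omega))
        have e2 := h (q + 1) (by omega) (by omega)
        simp only [Nat.add_sub_cancel] at e2
        have hstep : ‖y (q + 1)‖ ≤ 3 * ((4 * 3 ^ j - 2) * lam) + 2 * lam := by
          refine norm_le_of_implicit_step hθ0 hθ1 q (d (q + 1))
            (hd (q + 1) (by omega) (by omega)) (hS (q + 1) (by omega) (by omega)) y hq ?_ hl
          refine e2.trans (mul_le_mul_of_nonneg_right ?_ (norm_nonneg _))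
          rw [sum_mul]
          refine sum_le_sum fun k hk => ?_
          have hk' := mem_range.1 hk
          refine mul_le_mul_of_nonneg_left ?_ (hd (q + 1) (by omega) (by omega) k hk')
          have := hΨ0 k (by omega)
          have := hΨ1 (q + 1) (by omega)
          linarith
        intro k hk
        have := norm_le_of_energy_block hd hS hΨ0 hΨ1 hθ0 hθ1 h hr (m := q + 1) hp
          (B := 3 * ((4 * 3 ^ j - 2) * lam) + 2 * lam) (by linarith)
          (by
            intro k hk _
            rcases Nat.lt_or_ge k (q + 1) with h1 | h1
            · exact (hq k (by omega)).trans (by linarith)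
            · obtain rfl : k = q + 1 := by omega
              exact hstep)
          (fun n h1 h2 h3 => hgood n h1 (by omega) (fun hb => by
            have := hmax n (hs ▸ mem_filter.2 ⟨hb, h1, h3⟩)
            omega)) k hk
        refine this.trans (le_of_eq ?_)
        ring
  intro n hn
  refine (main bad.card n hn (card_filter_le _ _) n le_rfl).trans ?_
  have : 0 ≤ 2 * lam := by linarith
  linarith

end

end TFBS

namespace TFBS

open Finset intervalIntegral

/-! ### Integrals against kernels with increasing derivative -/

/-- A differentiable kernel whose derivative is continuous, nonnegative and increasing. -/
structure IsConvexKernel (κ κ' : ℝ → ℝ) : Prop where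
  hasDerivAt : ∀ r, HasDerivAt κ (κ' r) r
  cont : Continuous κ'
  mono : Monotone κ'
  nonneg : ∀ r, 0 ≤ κ' r

/-- The weighted integral `∫_a^b (r - a) (b - r) κ'(r) dr`. -/
noncomputable def bubble (κ' : ℝ → ℝ) (a b : ℝ) : ℝ := ∫ r in a..b, (r - a) * (b - r) * κ' r

lemma integral_bubble (a b m : ℝ) :
    ∫ r in a..b, (r - a) * (b - r) * m = (b - a) ^ 3 / 6 * m := by
  have hp : ∀ r, HasDerivAt (fun r : ℝ => ((r - a) ^ 2 * (b - a) / 2 - (r - a) ^ 3 / 3) * m)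
      ((r - a) * (b - r) * m) r := by
    intro r
    have h1 := ((((hasDerivAt_id' r).sub_const a).fun_pow 2).mul_const (b - a)).div_const 2
    have h2 := (((hasDerivAt_id' r).sub_const a).fun_pow 3).div_const 3
    refine ((h1.fun_sub h2).mul_const m).congr_deriv ?_
    push_cast
    ring
  rw [integral_eq_sub_of_hasDerivAt (fun r _ => hp r)
    (by apply Continuous.intervalIntegrable; fun_prop)]
  ring

namespace IsConvexKernel

variable {κ κ' : ℝ → ℝ} (h : IsConvexKernel κ κ') {a b c : ℝ}
include h

lemma continuous : Continuous κ := continuous_iff_continuousAt.2 fun r => (h.hasDerivAt r).continuousAt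

lemma monotone : Monotone κ :=
  monotone_of_deriv_nonneg (fun r => (h.hasDerivAt r).differentiableAt)
    (fun r => by rw [(h.hasDerivAt r).deriv]; exact h.nonneg r)

lemma integral_mul_deriv {p p' : ℝ → ℝ} (hp : ∀ r, HasDerivAt p (p' r) r) (hp' : Continuous p')
    (a b : ℝ) : ∫ r in a..b, p r * κ' r = p b * κ b - p a * κ a - ∫ r in a..b, p' r * κ r :=
  integral_mul_deriv_eq_deriv_mul (fun r _ => hp r) (fun r _ => h.hasDerivAt r)
    (hp'.intervalIntegrable _ _) (h.cont.intervalIntegrable _ _)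

lemma bubble_eq (a b : ℝ) : bubble κ' a b = ∫ r in a..b, κ r * (2 * (r - (a + b) / 2)) := by
  have hp : ∀ r, HasDerivAt (fun r : ℝ => (r - a) * (b - r)) (-(2 * (r - (a + b) / 2))) r := by
    intro r
    have := ((hasDerivAt_id' r).sub_const a).fun_mul ((hasDerivAt_id' r).const_sub b)
    refine this.congr_deriv ?_
    ring
  rw [bubble, h.integral_mul_deriv hp (by fun_prop)]
  simp only [neg_mul, integral_neg, sub_self, mul_zero, zero_mul, zero_sub, neg_neg]
  exact integral_congr fun r _ => by ring

lemma bubble_nonneg (hab : a ≤ b) : 0 ≤ bubble κ' a b := by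
  refine integral_nonneg hab fun r hr => ?_
  have := h.nonneg r
  have : 0 ≤ r - a := by linarith [hr.1]
  have : 0 ≤ b - r := by linarith [hr.2]
  positivity

lemma integral_left_eq (a b : ℝ) :
    ∫ r in a..b, (r - a) * κ' r = (b - a) * κ b - ∫ r in a..b, κ r := by
  rw [h.integral_mul_deriv (p' := fun _ => 1) (fun r => (hasDerivAt_id' r).sub_const a)
    continuous_const]
  simp

lemma integral_right_eq (a b : ℝ) :
    ∫ r in a..b, (b - r) * κ' r = (∫ r in a..b, κ r) - (b - a) * κ a := by
  rw [h.integral_mul_deriv (p' := fun _ => -1) (fun r => (hasDerivAt_id' r).const_sub b)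
    continuous_const]
  simp
  ring

/-- Chebyshev's inequality for an increasing `κ'` and a function with one sign change and
vanishing integral. -/
lemma integral_mul_nonneg {p q : ℝ → ℝ} (hp : ∀ r, HasDerivAt p (q r) r) (hq : Continuous q)
    (hab : a ≤ b) (hpab : p a = p b) (c : ℝ) (hle : ∀ r ∈ Set.Icc a b, r ≤ c → q r ≤ 0)
    (hge : ∀ r ∈ Set.Icc a b, c ≤ r → 0 ≤ q r) : 0 ≤ ∫ r in a..b, q r * κ' r := by
  have h0 : ∫ r in a..b, q r = 0 := by
    rw [integral_eq_sub_of_hasDerivAt (fun r _ => hp r) (hq.intervalIntegrable _ _), hpab, sub_self]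
  have h1 : ∫ r in a..b, q r * κ' r = ∫ r in a..b, q r * (κ' r - κ' c) := by
    have : ∫ r in a..b, q r * (κ' r - κ' c)
        = (∫ r in a..b, q r * κ' r) - ∫ r in a..b, q r * κ' c := by
      have := h.cont
      rw [← integral_sub (by apply Continuous.intervalIntegrable; fun_prop)
        (by apply Continuous.intervalIntegrable; fun_prop)]
      exact integral_congr fun r _ => by ring
    rw [this, integral_mul_const, h0, zero_mul, sub_zero]
  rw [h1]
  refine integral_nonneg hab fun r hr => ?_
  rcases le_total r c with hc | hc
  · exact mul_nonneg_of_nonpos_of_nonpos (hle r hr hc) (by linarith [h.mono hc])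
  · exact mul_nonneg (hge r hr hc) (by linarith [h.mono hc])

/-- Chebyshev's inequality for the derivative of (r - a)²(r - b), which vanishes at both ends. The
factor 3 is attained by constant κ'; its excess over the factor 2 in `ratio_mul_histSlope_le` makes
the weights monotone. -/
lemma three_mul_bubble_le (hab : a ≤ b) :
    3 * bubble κ' a b ≤ (b - a) * ((b - a) * κ b - ∫ r in a..b, κ r) := by
  have hp : ∀ r, HasDerivAt (fun r : ℝ => (r - a) ^ 2 * (r - b))
      ((r - a) * (3 * r - 2 * b - a)) r := by
    intro r
    have := (((hasDerivAt_id' r).sub_const a).fun_pow 2).fun_mul ((hasDerivAt_id' r).sub_const b)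
    refine this.congr_deriv ?_
    push_cast
    ring
  have h1 := h.integral_mul_nonneg hp (by fun_prop) hab (by simp) ((2 * b + a) / 3)
    (fun r hr hc => mul_nonpos_of_nonneg_of_nonpos (by linarith [hr.1]) (by linarith))
    (fun r hr hc => mul_nonneg (by linarith [hr.1]) (by linarith))
  have h2 : ∫ r in a..b, (r - a) * (3 * r - 2 * b - a) * κ' r
      = (b - a) * (∫ r in a..b, (r - a) * κ' r) - 3 * bubble κ' a b := by
    have := h.cont
    rw [bubble, ← integral_const_mul, ← integral_const_mul, ← integral_sub
      (by apply Continuous.intervalIntegrable; fun_prop)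
      (by apply Continuous.intervalIntegrable; fun_prop)]
    exact integral_congr fun r _ => by ring
  rw [h2, h.integral_left_eq] at h1
  linarith

lemma bubble_le_right (hab : a ≤ b) :
    bubble κ' a b ≤ (b - a) * ((∫ r in a..b, κ r) - (b - a) * κ a) := by
  rw [← h.integral_right_eq, ← integral_const_mul]
  have := h.cont
  refine integral_mono_on hab (by apply Continuous.intervalIntegrable; fun_prop)
      (by apply Continuous.intervalIntegrable; fun_prop) fun r hr => ?_
  have h1 := h.nonneg r
  have h2 : 0 ≤ b - r := by linarith [hr.2]
  nlinarith [mul_nonneg (mul_nonneg h2 h2) h1]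

/-- The trapezoidal rule overestimates the mean of a convex function. -/
lemma half_le_left (hab : a ≤ b) :
    (b - a) * ((κ b - κ a) / 2) ≤ (b - a) * κ b - ∫ r in a..b, κ r := by
  have hp : ∀ r, HasDerivAt (fun r : ℝ => (r - a) * (r - b)) (2 * r - a - b) r := by
    intro r
    have := ((hasDerivAt_id' r).sub_const a).fun_mul ((hasDerivAt_id' r).sub_const b)
    refine this.congr_deriv ?_
    ring
  have h1 := h.integral_mul_nonneg hp (by fun_prop) hab (by simp) ((a + b) / 2)
    (fun r hr hc => by linarith) (fun r hr hc => by linarith)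
  have h2 : ∫ r in a..b, (2 * r - a - b) * κ' r
      = (∫ r in a..b, (r - a) * κ' r) - ∫ r in a..b, (b - r) * κ' r := by
    have := h.cont
    rw [← integral_sub
      (by apply Continuous.intervalIntegrable; fun_prop)
      (by apply Continuous.intervalIntegrable; fun_prop)]
    exact integral_congr fun r _ => by ring
  rw [h2, h.integral_left_eq, h.integral_right_eq] at h1
  linarith

omit h in
lemma bubble_le_of_le (hc : Continuous κ') {m : ℝ} (hab : a ≤ b)
    (hm : ∀ r ∈ Set.Icc a b, κ' r ≤ m) : bubble κ' a b ≤ (b - a) ^ 3 / 6 * m := by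
  rw [← integral_bubble, bubble]
  refine integral_mono_on hab (by apply Continuous.intervalIntegrable; fun_prop)
      (by apply Continuous.intervalIntegrable; fun_prop) fun r hr => ?_
  exact mul_le_mul_of_nonneg_left (hm r hr)
    (mul_nonneg (by linarith [hr.1]) (by linarith [hr.2]))

/-- Comparison of the bubble integrals over two adjacent intervals. -/
lemma bubble_adjacent (hab : a ≤ b) (hbc : b < c) :
    bubble κ' a b ≤ ((b - a) / (c - b)) ^ 3 * bubble κ' b c := by
  have h1 : bubble κ' a b ≤ (b - a) ^ 3 / 6 * κ' b :=
    bubble_le_of_le h.cont hab fun r hr => h.mono hr.2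
  have h2 : (c - b) ^ 3 / 6 * κ' b ≤ bubble κ' b c := by
    rw [← integral_bubble b c, bubble]
    have := h.cont
    refine integral_mono_on hbc.le (by apply Continuous.intervalIntegrable; fun_prop)
      (by apply Continuous.intervalIntegrable; fun_prop) fun r hr => ?_
    exact mul_le_mul_of_nonneg_left (h.mono hr.1)
      (mul_nonneg (by linarith [hr.1]) (by linarith [hr.2]))
  have h3 : 0 < c - b := by linarith
  have h4 : 0 ≤ ((b - a) / (c - b)) ^ 3 := by
    have : 0 ≤ b - a := by linarith
    positivity
  calc _ ≤ _ := h1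
    _ = ((b - a) / (c - b)) ^ 3 * ((c - b) ^ 3 / 6 * κ' b) := by field_simp
    _ ≤ _ := mul_le_mul_of_nonneg_left h2 h4

end IsConvexKernel

end TFBS

namespace TFBS

open Finset intervalIntegral

/-! ### The weights of the fast Alikhanov formula -/

/-- The sum of exponentials `∑ w exp (-s (x - r))` as a function of `r`. -/
noncomputable def soeKernel {Nq : ℕ} (s w : Fin Nq → ℝ) (x r : ℝ) : ℝ :=
  ∑ l, w l * Real.exp (-s l * (x - r))

/-- The derivative of `soeKernel` in `r`. -/
noncomputable def soeKernelDeriv {Nq : ℕ} (s w : Fin Nq → ℝ) (x r : ℝ) : ℝ :=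
  ∑ l, w l * (s l * Real.exp (-s l * (x - r)))

lemma isConvexKernel_soe {Nq : ℕ} {s w : Fin Nq → ℝ} (hs : ∀ l, 0 < s l) (hw : ∀ l, 0 < w l)
    (x : ℝ) : IsConvexKernel (soeKernel s w x) (soeKernelDeriv s w x) where
  hasDerivAt r := by
    refine HasDerivAt.fun_sum fun l _ => HasDerivAt.const_mul _ ?_
    refine (((hasDerivAt_id' r).const_sub x).const_mul (-s l)).exp.congr_deriv ?_
    ring
  cont := by unfold soeKernelDeriv; fun_prop
  mono r r' h := by
    refine sum_le_sum fun l _ => ?_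
    have := hs l
    have := hw l
    gcongr ?_ * (?_ * Real.exp ?_)
    nlinarith
  nonneg r := sum_nonneg fun l _ => by
    have := hs l
    have := hw l
    positivity

/-- The mean value of `κ` over the `k`-th mesh interval. -/
noncomputable def histMean (κ : ℝ → ℝ) (t : ℕ → ℝ) (k : ℕ) : ℝ :=
  1 / step t k * ∫ r in (t (k - 1))..(t k), κ r

/-- The first moment of `κ` over the `k`-th mesh interval, as it enters quadratic interpolation. -/
noncomputable def histSlope (κ : ℝ → ℝ) (t : ℕ → ℝ) (k : ℕ) : ℝ :=
  ∫ r in (t (k - 1))..(t k), κ r *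
    (2 * (r - (t (k - 1) + t k) / 2) / (step t k * (step t k + step t (k + 1))))

/-- The coefficient of `∇_τ v^k` in the fast Alikhanov formula at level `n`. -/
noncomputable def weight (α : ℝ) (t : ℕ → ℝ) {Nq : ℕ} (s w : Fin Nq → ℝ) (n k : ℕ) : ℝ :=
  if k = 0 then 0 else
    (if k = n then localCoeff α t n else
      histMean (soeKernel s w (offTime (α / 2) t n)) t k
        - histSlope (soeKernel s w (offTime (α / 2) t n)) t k)
    + ratio t (k - 1) * histSlope (soeKernel s w (offTime (α / 2) t n)) t (k - 1)

/-- The exponent in the recursion is the distance between consecutive off-set times, so the decay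
factors telescope. -/
lemma history_eq_sum (α : ℝ) (t : ℕ → ℝ) (s : ℝ) (v : ℕ → ℝ) (m : ℕ) :
    history α t s v m = ∑ k ∈ range m,
      Real.exp (-s * (offTime (α / 2) t (m + 1) - offTime (α / 2) t (k + 2))) *
        (histCoeffA α t s (k + 1) * nabla v (k + 1)
        + histCoeffB α t s (k + 1)
          * (ratio t (k + 1) * nabla v (k + 2) - nabla v (k + 1))) := by
  induction m with
  | zero => simp [history]
  | succ m ih =>
    rw [history, ih, sum_range_succ, mul_sum]
    have : ∀ k, Real.exp (-s * (α / 2 * step t (m + 1) + (1 - α / 2) * step t (m + 2)))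
        * Real.exp (-s * (offTime (α / 2) t (m + 1) - offTime (α / 2) t (k + 2)))
        = Real.exp (-s * (offTime (α / 2) t (m + 1 + 1) - offTime (α / 2) t (k + 2))) := by
      intro k
      rw [← Real.exp_add]
      congr 1
      simp only [step, offTime, Nat.add_sub_cancel, show m + 2 - 1 = m + 1 by omega]
      ring
    simp only [← mul_assoc, this]
    simp only [sub_self, mul_zero, Real.exp_zero, one_mul]
    ring

lemma soe_histCoeffA {Nq : ℕ} (α : ℝ) (t : ℕ → ℝ) (s w : Fin Nq → ℝ) (n k : ℕ) :
    ∑ l, w l * (Real.exp (-s l * (offTime (α / 2) t n - offTime (α / 2) t (k + 1)))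
      * histCoeffA α t (s l) k) = histMean (soeKernel s w (offTime (α / 2) t n)) t k := by
  unfold histMean soeKernel histCoeffA
  rw [integral_finsetSum (fun l _ => by apply Continuous.intervalIntegrable; fun_prop), mul_sum]
  refine sum_congr rfl fun l _ => ?_
  rw [integral_const_mul]
  have : ∀ r, Real.exp (-s l * (offTime (α / 2) t n - r))
      = Real.exp (-s l * (offTime (α / 2) t n - offTime (α / 2) t (k + 1)))
        * Real.exp (-s l * (offTime (α / 2) t (k + 1) - r)) := by
    intro r
    rw [← Real.exp_add]
    ring_nf
  rw [integral_congr fun r _ => this r, integral_const_mul]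
  ring

lemma soe_histCoeffB {Nq : ℕ} (α : ℝ) (t : ℕ → ℝ) (s w : Fin Nq → ℝ) (n k : ℕ) :
    ∑ l, w l * (Real.exp (-s l * (offTime (α / 2) t n - offTime (α / 2) t (k + 1)))
      * histCoeffB α t (s l) k) = histSlope (soeKernel s w (offTime (α / 2) t n)) t k := by
  unfold histSlope soeKernel histCoeffB
  simp only [sum_mul]
  rw [integral_finsetSum (fun l _ => by apply Continuous.intervalIntegrable; fun_prop)]
  refine sum_congr rfl fun l _ => ?_
  have : ∀ r, Real.exp (-s l * (offTime (α / 2) t n - r))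
      = Real.exp (-s l * (offTime (α / 2) t n - offTime (α / 2) t (k + 1)))
        * Real.exp (-s l * (offTime (α / 2) t (k + 1) - r)) := by
    intro r
    rw [← Real.exp_add]
    ring_nf
  rw [← integral_const_mul, ← integral_const_mul]
  refine integral_congr fun r _ => ?_
  simp only [this r]
  ring

lemma fastAlikhanov_eq_hist (α : ℝ) (t : ℕ → ℝ) {Nq : ℕ} (s w : Fin Nq → ℝ) (v : ℕ → ℝ) (m : ℕ) :
    fastAlikhanov α t s w v (m + 1) = localCoeff α t (m + 1) * nabla v (m + 1)
      + ∑ k ∈ range m,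
        (histMean (soeKernel s w (offTime (α / 2) t (m + 1))) t (k + 1) * nabla v (k + 1)
        + histSlope (soeKernel s w (offTime (α / 2) t (m + 1))) t (k + 1)
          * (ratio t (k + 1) * nabla v (k + 2) - nabla v (k + 1))) := by
  rw [fastAlikhanov, Nat.add_sub_cancel]
  congr 1
  simp only [history_eq_sum, mul_sum]
  rw [sum_comm]
  refine sum_congr rfl fun k _ => ?_
  rw [← soe_histCoeffA, ← soe_histCoeffB, sum_mul, sum_mul, ← sum_add_distrib]
  refine sum_congr rfl fun l _ => ?_
  ring

lemma histSlope_zero (κ : ℝ → ℝ) (t : ℕ → ℝ) : histSlope κ t 0 = 0 := by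
  simp [histSlope]

/-- The coefficients of ∇v^k are collected, an interval contributing to two neighbouring differences
through the quadratic interpolant, and then summed by parts. -/
lemma fastAlikhanov_eq_weight (α : ℝ) (t : ℕ → ℝ) {Nq : ℕ} (s w : Fin Nq → ℝ) (v : ℕ → ℝ) {n : ℕ}
    (hn : 1 ≤ n) :
    fastAlikhanov α t s w v n
      = ∑ k ∈ range n, (weight α t s w n (k + 1) - weight α t s w n k) * (v n - v k) := by
  have h0 : weight α t s w n 0 = 0 := by simp [weight]
  have h1 := sum_smul_nabla (weight α t s w n) h0 v n
  simp only [smul_eq_mul] at h1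
  rw [← h1]
  obtain ⟨m, rfl⟩ : ∃ m, n = m + 1 := ⟨n - 1, by omega⟩
  rw [fastAlikhanov_eq_hist]
  set κ := soeKernel s w (offTime (α / 2) t (m + 1)) with hκ
  have e1 : ∀ k, weight α t s w (m + 1) (k + 1) * (v (k + 1) - v k)
      = (if k = m then localCoeff α t (m + 1) else histMean κ t (k + 1) - histSlope κ t (k + 1))
          * nabla v (k + 1) + ratio t k * histSlope κ t k * nabla v (k + 1) := by
    intro k
    simp only [weight, nabla, Nat.add_sub_cancel, Nat.add_right_cancel_iff, Nat.succ_ne_zero,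
      if_false]
    rw [← hκ]
    ring
  rw [sum_congr rfl fun k _ => e1 k, sum_add_distrib (s := range (m + 1)), sum_range_succ, sum_range_succ' (fun k => ratio t k * _ * _), histSlope_zero]
  have e2 : ∑ k ∈ range m, (if k = m then localCoeff α t (m + 1) else
      histMean κ t (k + 1) - histSlope κ t (k + 1)) * nabla v (k + 1)
      = ∑ k ∈ range m, (histMean κ t (k + 1) - histSlope κ t (k + 1)) * nabla v (k + 1) := by
    refine sum_congr rfl fun k hk => ?_
    rw [if_neg (by have := mem_range.1 hk; omega)]
  rw [e2]
  simp only [if_true, mul_zero, zero_mul, add_zero]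
  rw [add_right_comm, ← sum_add_distrib, add_comm]
  congr 1
  refine sum_congr rfl fun k _ => ?_
  ring

/-- A mesh satisfying M1 together with an admissible sum-of-exponentials approximation. -/
structure IsFastMesh (α T ε : ℝ) (N : ℕ) (t : ℕ → ℝ) {Nq : ℕ} (s w : Fin Nq → ℝ) : Prop where
  order : α ∈ Set.Ioo (0 : ℝ) 1
  horizon_pos : 0 < T
  mesh : IsTimeMesh T N t
  m1 : MeshM1 N t
  tol_pos : 0 < ε
  tol_le : ε ≤ 7 / 11 * fracKernel (1 - α) T
  tol_le' : ε ≤ α / 2 / (1 - α) * fracKernel (1 - α) T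
  node_pos : ∀ l, 0 < s l
  weight_pos : ∀ l, 0 < w l
  approx : ∀ k, 2 ≤ k → k ≤ N → ∀ r, (1 - α / 2) * step t k ≤ r → r ≤ T →
    |fracKernel (1 - α) r - ∑ l, w l * Real.exp (-(s l) * r)| ≤ ε

namespace IsTimeMesh

variable {T : ℝ} {N : ℕ} {t : ℕ → ℝ} (h : IsTimeMesh T N t)
include h

lemma step_pos {k : ℕ} (h1 : 1 ≤ k) (h2 : k ≤ N) : 0 < step t k := sub_pos.2 (h.increasing k h1 h2)

lemma mono {j k : ℕ} (hjk : j ≤ k) (hk : k ≤ N) : t j ≤ t k := by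
  induction k, hjk using Nat.le_induction with
  | base => exact le_rfl
  | succ k hjk ih => exact (ih (by omega)).trans (h.increasing (k + 1) (by omega) hk).le

lemma nonneg {k : ℕ} (hk : k ≤ N) : 0 ≤ t k := h.start ▸ h.mono (Nat.zero_le k) hk

lemma le_horizon {k : ℕ} (hk : k ≤ N) : t k ≤ T := h.finish ▸ h.mono hk le_rfl

lemma pos {k : ℕ} (h1 : 1 ≤ k) (hk : k ≤ N) : 0 < t k :=
  (h.nonneg (by omega : k - 1 ≤ N)).trans_lt (h.increasing k h1 hk)

lemma step_le {k : ℕ} (hk : k ≤ N) : step t k ≤ t k := by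
  have := h.nonneg (by omega : k - 1 ≤ N)
  rw [step]
  linarith

lemma offTime_le {θ : ℝ} (h0 : 0 ≤ θ) {n : ℕ} (h1 : 1 ≤ n) (hn : n ≤ N) :
    offTime θ t n ≤ t n := by
  have := h.increasing n h1 hn
  rw [offTime]
  nlinarith

end IsTimeMesh

lemma offTime_sub (θ : ℝ) (t : ℕ → ℝ) (n : ℕ) : offTime θ t n - t (n - 1) = (1 - θ) * step t n := by
  rw [offTime, step]
  ring

lemma fracKernel_pos {α : ℝ} (hα : α < 1) {x : ℝ} (hx : 0 < x) : 0 < fracKernel (1 - α) x :=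
  div_pos (Real.rpow_pos_of_pos hx _) (Real.Gamma_pos_of_pos (by linarith))

lemma fracKernel_eq (α x : ℝ) : fracKernel (1 - α) x = x ^ (-α) / Real.Gamma (1 - α) := by
  rw [fracKernel]
  ring_nf

lemma fracKernel_anti {α : ℝ} (hα : α ∈ Set.Ioo (0 : ℝ) 1) {x y : ℝ} (hx : 0 < x) (hxy : x ≤ y) :
    fracKernel (1 - α) y ≤ fracKernel (1 - α) x := by
  have := Real.Gamma_pos_of_pos (by linarith [hα.2] : 0 < 1 - α)
  rw [fracKernel_eq, fracKernel_eq]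
  gcongr ?_ / _
  exact Real.rpow_le_rpow_of_nonpos hx hxy (by linarith [hα.1])

lemma integral_fracKernel_sub {α : ℝ} (hα : α < 1) {x L : ℝ} (hL : 0 < L) :
    ∫ r in (x - L)..x, fracKernel (1 - α) (x - r) = L / (1 - α) * fracKernel (1 - α) L := by
  rw [integral_comp_sub_left (fun r => fracKernel (1 - α) r) x]
  simp only [fracKernel_eq, sub_self, sub_sub_cancel]
  rw [integral_div, integral_rpow (Or.inl (by linarith)), Real.zero_rpow (by linarith), sub_zero,
    Real.rpow_add hL, Real.rpow_one]
  have : 1 - α ≠ 0 := by linarith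
  rw [show -α + 1 = 1 - α by ring]
  field_simp

lemma localCoeff_eq {α : ℝ} (hα : α ∈ Set.Ioo (0 : ℝ) 1) {t : ℕ → ℝ} {n : ℕ}
    (hn : 0 < step t n) :
    localCoeff α t n
      = (1 - α / 2) / (1 - α) * fracKernel (1 - α) ((1 - α / 2) * step t n) := by
  have h1 : 0 < (1 - α / 2) * step t n := mul_pos (by linarith [hα.2]) hn
  have h2 := integral_fracKernel_sub hα.2 (x := offTime (α / 2) t n) h1
  rw [← offTime_sub, sub_sub_cancel, offTime_sub] at h2
  rw [localCoeff, h2]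
  field_simp

end TFBS

/-! ### Monotonicity and two-sided bounds of the weights. -/

namespace TFBS

open Finset intervalIntegral

namespace IsFastMesh

variable {α T ε : ℝ} {N : ℕ} {t : ℕ → ℝ} {Nq : ℕ} {s w : Fin Nq → ℝ}
  (h : IsFastMesh α T ε N t s w)
include h

lemma convexKernel (x : ℝ) : IsConvexKernel (soeKernel s w x) (soeKernelDeriv s w x) :=
  isConvexKernel_soe h.node_pos h.weight_pos x

lemma step_pos {k : ℕ} (h1 : 1 ≤ k) (h2 : k ≤ N) : 0 < step t k := h.mesh.step_pos h1 h2

lemma ratio_nonneg {k : ℕ} (h1 : 1 ≤ k) (h2 : k < N) : 0 ≤ ratio t k :=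
  div_nonneg (h.step_pos h1 (by omega)).le (h.step_pos (by omega) (by omega)).le

lemma ratio_le {k : ℕ} (h1 : 1 ≤ k) (h2 : k < N) : ratio t k ≤ 7 / 4 := h.m1 k h1 (by omega)

lemma histSlope_eq {k : ℕ} (x : ℝ) :
    histSlope (soeKernel s w x) t k
      = bubble (soeKernelDeriv s w x) (t (k - 1)) (t k)
        / (step t k * (step t k + step t (k + 1))) := by
  rw [(h.convexKernel x).bubble_eq, histSlope, ← integral_div]
  exact integral_congr fun r _ => by ring

lemma bubble_nonneg {k : ℕ} (h1 : 1 ≤ k) (h2 : k ≤ N) (x : ℝ) :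
    0 ≤ bubble (soeKernelDeriv s w x) (t (k - 1)) (t k) :=
  (h.convexKernel x).bubble_nonneg (h.mesh.increasing k h1 h2).le

lemma histSlope_nonneg {k : ℕ} (h1 : 1 ≤ k) (h2 : k < N) (x : ℝ) :
    0 ≤ histSlope (soeKernel s w x) t k := by
  rw [h.histSlope_eq]
  have := h.step_pos h1 (by omega)
  have := h.step_pos (k := k + 1) (by omega) (by omega)
  have := h.bubble_nonneg h1 h2.le x
  positivity

lemma histSlope_le_bubble {k : ℕ} (h1 : 1 ≤ k) (h2 : k < N) (x : ℝ) :
    histSlope (soeKernel s w x) t k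
      ≤ bubble (soeKernelDeriv s w x) (t (k - 1)) (t k) / step t k ^ 2 := by
  rw [h.histSlope_eq]
  have h3 := h.step_pos h1 (by omega)
  have h4 := h.step_pos (k := k + 1) (by omega) (by omega)
  have := h.bubble_nonneg h1 h2.le x
  gcongr
  nlinarith

lemma le_histMean_sub {k : ℕ} (h1 : 1 ≤ k) (h2 : k < N) (x : ℝ) :
    soeKernel s w x (t (k - 1))
      ≤ histMean (soeKernel s w x) t k - histSlope (soeKernel s w x) t k := by
  have h3 := h.step_pos h1 (by omega)
  have h4 := (h.convexKernel x).bubble_le_right (h.mesh.increasing k h1 h2.le).le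
  rw [show t k - t (k - 1) = step t k from rfl] at h4
  have h5 := h.histSlope_le_bubble h1 h2 x
  have h6 : bubble (soeKernelDeriv s w x) (t (k - 1)) (t k) / step t k ^ 2
      ≤ histMean (soeKernel s w x) t k - soeKernel s w x (t (k - 1)) := by
    rw [histMean, div_le_iff₀ (by positivity)]
    refine h4.trans (le_of_eq ?_)
    field_simp
  linarith

lemma histMean_add_le {k : ℕ} (h1 : 1 ≤ k) (h2 : k ≤ N) (x : ℝ) :
    histMean (soeKernel s w x) t k
      + 3 * (bubble (soeKernelDeriv s w x) (t (k - 1)) (t k) / step t k ^ 2)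
      ≤ soeKernel s w x (t k) := by
  have h3 := h.step_pos h1 h2
  have h4 := (h.convexKernel x).three_mul_bubble_le (h.mesh.increasing k h1 h2).le
  rw [show t k - t (k - 1) = step t k from rfl] at h4
  have h6 : 3 * bubble (soeKernelDeriv s w x) (t (k - 1)) (t k) / step t k ^ 2
      ≤ soeKernel s w x (t k) - histMean (soeKernel s w x) t k := by
    rw [histMean, div_le_iff₀ (by positivity)]
    refine h4.trans (le_of_eq ?_)
    field_simp
  rw [mul_div_assoc] at h6
  linarith

/-- The contribution of the preceding interval to a weight is controlled by the next moment. -/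
lemma ratio_mul_histSlope_le {k : ℕ} (h1 : 1 ≤ k) (h2 : k ≤ N) (x : ℝ) :
    ratio t (k - 1) * histSlope (soeKernel s w x) t (k - 1)
      ≤ 2 * (bubble (soeKernelDeriv s w x) (t (k - 1)) (t k) / step t k ^ 2) := by
  have h3 := h.step_pos h1 h2
  have hb := h.bubble_nonneg h1 h2 x
  rcases Nat.lt_or_ge 1 k with hk | hk
  · obtain ⟨j, rfl⟩ : ∃ j, k = j + 1 := ⟨k - 1, by omega⟩
    rw [h.histSlope_eq, Nat.add_sub_cancel] at *
    have h4 := h.step_pos (k := j) (by omega) (by omega)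
    have h5 := (h.convexKernel x).bubble_adjacent
      (h.mesh.increasing j (by omega) (by omega)).le (h.mesh.increasing (j + 1) (by omega) h2)
    rw [show t j - t (j - 1) = step t j from rfl,
      show t (j + 1) - t j = step t (j + 1) from rfl] at h5
    have h6 := h.ratio_le (k := j) (by omega) (by omega)
    rw [ratio, div_le_iff₀ h3] at h6
    set S := bubble (soeKernelDeriv s w x) (t j) (t (j + 1))
    set p := step t j
    set q := step t (j + 1)
    -- With z = p/q this is z³ ≤ 2(z + 1), which holds for z ≤ 7/4 (5.36 against 5.5). M1 is used
    -- here nearly to its limit.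
    have h7 : p ^ 3 ≤ 2 * (q ^ 2 * (p + q)) := by
      have : p ^ 2 ≤ (7 / 4 * q) ^ 2 := by gcongr
      nlinarith [mul_le_mul_of_nonneg_left this h4.le, mul_le_mul_of_nonneg_left h6 (sq_nonneg q),
        pow_pos h3 3, pow_pos h3 2]
    calc ratio t j * (bubble (soeKernelDeriv s w x) (t (j - 1)) (t j) / (p * (p + q)))
        ≤ p / q * ((p / q) ^ 3 * S / (p * (p + q))) := by
          rw [ratio]; gcongr
      _ = p ^ 3 / (q ^ 2 * (p + q)) * (S / q ^ 2) := by field_simp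
      _ ≤ 2 * (S / q ^ 2) := by
          gcongr
          rwa [div_le_iff₀ (by positivity)]
  · obtain rfl : k = 1 := by omega
    rw [Nat.sub_self, histSlope_zero, mul_zero]
    positivity

/-- For r ≤ t_{n-1} the distance to t_{n-θ} is at least (1 - θ)τ_n, so the history never sees the
kernel where the approximation is not available. -/
lemma kernel_le {n : ℕ} (h2 : 2 ≤ n) (hn : n ≤ N) {r : ℝ} (hr0 : 0 ≤ r) (hr : r ≤ t (n - 1)) :
    |fracKernel (1 - α) (offTime (α / 2) t n - r)
      - soeKernel s w (offTime (α / 2) t n) r| ≤ ε := by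
  have h3 := offTime_sub (α / 2) t n
  refine h.approx n h2 hn _ (by linarith) ?_
  have := h.mesh.offTime_le (θ := α / 2) (by linarith [h.order.1]) (by omega) hn
  have := h.mesh.le_horizon hn
  linarith

lemma horizon_kernel_le {x : ℝ} (h0 : 0 < x) (hx : x ≤ T) :
    fracKernel (1 - α) T ≤ fracKernel (1 - α) x := fracKernel_anti h.order h0 hx

lemma step_off_pos {n : ℕ} (h1 : 1 ≤ n) (hn : n ≤ N) : 0 < (1 - α / 2) * step t n :=
  mul_pos (by linarith [h.order.2]) (h.step_pos h1 hn)

lemma step_off_le {n : ℕ} (h1 : 1 ≤ n) (hn : n ≤ N) : (1 - α / 2) * step t n ≤ T := by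
  have := h.step_pos h1 hn
  have := h.mesh.step_le hn
  have := h.mesh.le_horizon hn
  nlinarith [h.order.1]

/-- The local coefficient is (1 - θ)/(1 - α) ω = (1 + θ/(1 - α)) ω with ω = ω_{1-α}((1 - θ)τ_n), so
the second tolerance bound is just what lets it dominate ω + ε. -/
lemma kernel_le_localCoeff {n : ℕ} (h2 : 2 ≤ n) (hn : n ≤ N) :
    soeKernel s w (offTime (α / 2) t n) (t (n - 1)) ≤ localCoeff α t n := by
  rw [localCoeff_eq h.order (h.step_pos (by omega) hn)]
  have h3 := h.kernel_le h2 hn (h.mesh.nonneg (by omega)) le_rfl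
  rw [offTime_sub] at h3
  have h4 := h.horizon_kernel_le (h.step_off_pos (by omega) hn) (h.step_off_le (by omega) hn)
  have hα := h.order.2
  have h5 : α / 2 / (1 - α) * fracKernel (1 - α) T
      ≤ α / 2 / (1 - α) * fracKernel (1 - α) ((1 - α / 2) * step t n) := by
    have : 0 < α / 2 / (1 - α) := div_pos (by linarith [h.order.1]) (by linarith)
    gcongr
  have h6 := h.tol_le'
  have h7 : (1 - α / 2) / (1 - α) = 1 + α / 2 / (1 - α) := by
    have : (1 - α) ≠ 0 := by linarith
    field_simp
    ring
  rw [h7]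
  have := (abs_le.1 h3).1
  linarith

omit h in
lemma weight_eq {n k : ℕ} (hk : 1 ≤ k) : weight α t s w n k
    = (if k = n then localCoeff α t n else
      histMean (soeKernel s w (offTime (α / 2) t n)) t k
        - histSlope (soeKernel s w (offTime (α / 2) t n)) t k)
    + ratio t (k - 1) * histSlope (soeKernel s w (offTime (α / 2) t n)) t (k - 1) := by
  rw [weight, if_neg (by omega)]

lemma weight_succ_ge {n k : ℕ} (hk : 1 ≤ k) (hkn : k < n) (hn : n ≤ N) :
    soeKernel s w (offTime (α / 2) t n) (t k)
      + ratio t k * histSlope (soeKernel s w (offTime (α / 2) t n)) t k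
        ≤ weight α t s w n (k + 1) := by
  rw [weight_eq (by omega), Nat.add_sub_cancel]
  gcongr
  split_ifs with h1
  · subst h1
    exact h.kernel_le_localCoeff (by omega) hn
  · exact h.le_histMean_sub (k := k + 1) (by omega) (by omega) _

/-- Write S for the bubble integral. The upper weight is at least κ(t_k). The lower one is at most
the mean of κ plus the preceding slope term, that is at most κ(t_k) - 3S/τ_k² + 2S/τ_k². The surplus
S/τ_k² gives monotonicity and also controls the history errors. -/
lemma weight_diff_ge {n k : ℕ} (hk : 1 ≤ k) (hkn : k < n) (hn : n ≤ N) :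
    bubble (soeKernelDeriv s w (offTime (α / 2) t n)) (t (k - 1)) (t k) / step t k ^ 2
      ≤ weight α t s w n (k + 1) - weight α t s w n k := by
  have h1 := h.weight_succ_ge hk hkn hn
  rw [weight_eq (k := k) hk, if_neg (by omega)]
  have h2 := h.histMean_add_le hk (by omega) (offTime (α / 2) t n)
  have h3 := h.ratio_mul_histSlope_le hk (by omega) (offTime (α / 2) t n)
  have h4 := h.histSlope_nonneg hk (by omega) (offTime (α / 2) t n)
  have h5 := mul_nonneg (h.ratio_nonneg hk (by omega)) h4
  linarith

/-- Near t = 0 the interpolation error is only bounded in the supremum norm and does not carry the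
factor (r - t_0)(t_1 - r). There the whole increment of κ is needed, not merely the bubble integral.
-/
lemma weight_diff_one_ge {n : ℕ} (hn2 : 2 ≤ n) (hn : n ≤ N) :
    (soeKernel s w (offTime (α / 2) t n) (t 1) - soeKernel s w (offTime (α / 2) t n) (t 0)) / 2
      ≤ weight α t s w n 2 - weight α t s w n 1 := by
  have h1 := h.weight_succ_ge (k := 1) le_rfl hn2 hn
  rw [weight_eq (k := 1) le_rfl, if_neg (by omega), Nat.sub_self, histSlope_zero, mul_zero]
  have h4 := h.histSlope_nonneg (k := 1) le_rfl (by omega) (offTime (α / 2) t n)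
  have h5 := mul_nonneg (h.ratio_nonneg (k := 1) le_rfl (by omega)) h4
  have h6 := (h.convexKernel (offTime (α / 2) t n)).half_le_left
    (h.mesh.increasing 1 le_rfl (by omega)).le
  have h3 := h.step_pos (k := 1) le_rfl (by omega)
  rw [show t 1 - t (1 - 1) = step t 1 from rfl] at h6
  have h7 : histMean (soeKernel s w (offTime (α / 2) t n)) t 1
      + (soeKernel s w (offTime (α / 2) t n) (t 1) - soeKernel s w (offTime (α / 2) t n) (t 0)) / 2
      ≤ soeKernel s w (offTime (α / 2) t n) (t 1) := by
    rw [histMean]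
    have : 0 < 1 / step t 1 := by positivity
    have h8 := mul_le_mul_of_nonneg_left h6 this.le
    rw [mul_sub, ← mul_assoc, ← mul_assoc, one_div_mul_cancel h3.ne'] at h8
    rw [Nat.sub_self] at h8 ⊢
    linarith
  linarith

/-- For n ≥ 2 the factor 4/11 enters twice: ε ≤ (7/11) ω_{1-α}(T) leaves κ(t_0) ≥ (4/11)
ω_{1-α}(t_n), and τ_1/(τ_1 + τ_2) ≤ (7/4)/(11/4) = 7/11 leaves that fraction of the mean after
subtracting the slope. -/
lemma weight_one_ge {n : ℕ} (hn1 : 1 ≤ n) (hn : n ≤ N) :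
    16 / 121 * fracKernel (1 - α) (t n) ≤ weight α t s w n 1 := by
  rw [weight_eq (k := 1) le_rfl, Nat.sub_self, histSlope_zero, mul_zero, add_zero]
  have hω := fracKernel_pos h.order.2 (h.mesh.pos hn1 hn)
  have hα := h.order
  split_ifs with h1
  · subst h1
    rw [localCoeff_eq h.order (h.step_pos le_rfl hn)]
    have h2 : step t 1 = t 1 := by rw [step, Nat.sub_self, h.mesh.start, sub_zero]
    have h3 := fracKernel_anti h.order (h.step_off_pos le_rfl hn)
      (show (1 - α / 2) * step t 1 ≤ t 1 by
        rw [h2]; nlinarith [h.mesh.pos le_rfl hn, h.order.1])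
    have h4 : 1 ≤ (1 - α / 2) / (1 - α) := by
      rw [le_div_iff₀ (by linarith [hα.2])]
      linarith [hα.1]
    nlinarith
  · set κ := soeKernel s w (offTime (α / 2) t n) with hκ
    have hK := h.convexKernel (offTime (α / 2) t n)
    have h3 := h.step_pos (k := 1) le_rfl (by omega)
    have h4 := h.step_pos (k := 2) (by omega) (by omega)
    have h01 := h.mesh.increasing 1 le_rfl (by omega)
    rw [Nat.sub_self] at h01
    have hoff := h.mesh.offTime_le (θ := α / 2) (by linarith [hα.1]) hn1 hn
    have hoff' : 0 < offTime (α / 2) t n := by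
      have := offTime_sub (α / 2) t n
      have := h.step_off_pos hn1 hn
      have := h.mesh.nonneg (k := n - 1) (by omega)
      linarith
    have k0 : 4 / 11 * fracKernel (1 - α) (t n) ≤ κ (t 0) := by
      have e1 := h.kernel_le (n := n) (by omega) hn (r := t 0) (h.mesh.nonneg (by omega))
        (h.mesh.mono (by omega) (by omega))
      rw [h.mesh.start, sub_zero] at e1
      have e2 := fracKernel_anti h.order hoff' hoff
      have e3 := h.horizon_kernel_le (h.mesh.pos hn1 hn) (h.mesh.le_horizon hn)
      have e4 := h.tol_le
      rw [h.mesh.start, hκ]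
      have := (abs_le.1 e1).2
      linarith
    have k1 : κ (t 0) ≤ histMean κ t 1 := by
      have e1 := (h.convexKernel (offTime (α / 2) t n)).integral_right_eq (t 0) (t 1)
      have e2 : 0 ≤ ∫ r in (t 0)..(t 1), (t 1 - r) * soeKernelDeriv s w (offTime (α / 2) t n) r :=
        integral_nonneg h01.le fun r hr => mul_nonneg (by linarith [hr.2]) (hK.nonneg r)
      rw [e1] at e2
      rw [histMean, Nat.sub_self, one_div, inv_mul_eq_div, le_div_iff₀ h3]
      rw [step, Nat.sub_self]
      linarith
    have hρ := h.ratio_le (k := 1) le_rfl (by omega)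
    rw [ratio, div_le_iff₀ h4] at hρ
    have k2 : histSlope κ t 1 ≤ 7 / 11 * histMean κ t 1 := by
      rw [histMean, histSlope, ← integral_const_mul, ← integral_const_mul, Nat.sub_self]
      have := hK.continuous
      refine integral_mono_on h01.le (by apply Continuous.intervalIntegrable; fun_prop)
        (by apply Continuous.intervalIntegrable; fun_prop) fun r hr => ?_
      have e1 : 0 ≤ κ r := by
        have := hK.monotone hr.1
        have : 0 ≤ κ (t 0) := by linarith
        linarith
      have e2 : 2 * (r - (t 0 + t 1) / 2) ≤ step t 1 := by
        rw [step, Nat.sub_self]; linarith [hr.2]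
      have e3 : 2 * (r - (t 0 + t 1) / 2) / (step t 1 * (step t 1 + step t (1 + 1)))
          ≤ 7 / 11 * (1 / step t 1) := by
        rw [div_le_iff₀ (by positivity)]
        have : 7 / 11 * (1 / step t 1) * (step t 1 * (step t 1 + step t (1 + 1)))
          = 7 / 11 * (step t 1 + step t (1 + 1)) := by field_simp
        rw [this]
        norm_num at *
        linarith
      calc _ ≤ κ r * (7 / 11 * (1 / step t 1)) := mul_le_mul_of_nonneg_left e3 e1
        _ = _ := by ring
    linarith

omit h in
lemma weight_zero (n : ℕ) : weight α t s w n 0 = 0 := by simp [weight]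

/-- The weights are nonnegative and increasing in `k`. -/
lemma weight_mono {n k : ℕ} (hkn : k < n) (hn : n ≤ N) :
    0 ≤ weight α t s w n (k + 1) - weight α t s w n k := by
  rcases Nat.eq_zero_or_pos k with rfl | hk
  · rw [weight_zero, sub_zero]
    have := fracKernel_pos h.order.2 (h.mesh.pos hkn hn)
    have := h.weight_one_ge hkn hn
    simp only [zero_add]
    linarith
  · refine le_trans ?_ (h.weight_diff_ge hk hkn hn)
    have := h.bubble_nonneg hk (by omega) (offTime (α / 2) t n)
    positivity

lemma weight_sub_le {n k : ℕ} (hk : 1 ≤ k) (hkn : k < n) (hn : n ≤ N) :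
    weight α t s w n k ≤ soeKernel s w (offTime (α / 2) t n) (t k) := by
  rw [weight_eq (k := k) hk, if_neg (by omega)]
  have h2 := h.histMean_add_le hk (by omega) (offTime (α / 2) t n)
  have h3 := h.ratio_mul_histSlope_le hk (by omega) (offTime (α / 2) t n)
  have h4 := h.histSlope_nonneg hk (by omega) (offTime (α / 2) t n)
  have h5 := h.bubble_nonneg hk (by omega) (offTime (α / 2) t n)
  have : 0 ≤ bubble (soeKernelDeriv s w (offTime (α / 2) t n)) (t (k - 1)) (t k) / step t k ^ 2 := by
    positivity
  linarith

lemma kernel_le_two {n : ℕ} (h2 : 2 ≤ n) (hn : n ≤ N) :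
    soeKernel s w (offTime (α / 2) t n) (t (n - 1))
      ≤ fracKernel (1 - α) ((1 - α / 2) * step t n) + ε := by
  have h3 := h.kernel_le h2 hn (h.mesh.nonneg (by omega)) le_rfl
  rw [offTime_sub] at h3
  have := (abs_le.1 h3).1
  linarith

lemma localCoeff_le_weight {n : ℕ} (h1 : 1 ≤ n) (hn : n ≤ N) :
    localCoeff α t n ≤ weight α t s w n n := by
  rw [weight_eq h1, if_pos rfl]
  rcases Nat.lt_or_ge 1 n with hk | hk
  · have := mul_nonneg (h.ratio_nonneg (k := n - 1) (by omega) (by omega))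
      (h.histSlope_nonneg (k := n - 1) (by omega) (by omega) (offTime (α / 2) t n))
    linarith
  · obtain rfl : n = 1 := by omega
    rw [Nat.sub_self, histSlope_zero, mul_zero, add_zero]

/-- The slope on the preceding interval is at most its mean and at most the normalized bubble, so
four slopes are at most mean + 3 bubbles ≤ κ(t_{n-1}) ≤ ω + ε. The constant 4 is generous. -/
lemma weight_self_le {n : ℕ} (h1 : 1 ≤ n) (hn : n ≤ N) :
    weight α t s w n n
      ≤ (1 / (1 - α) + 4) * fracKernel (1 - α) ((1 - α / 2) * step t n) := by
  have hω := fracKernel_pos h.order.2 (h.step_off_pos h1 hn)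
  have hα := h.order
  have e1 : localCoeff α t n ≤ 1 / (1 - α) * fracKernel (1 - α) ((1 - α / 2) * step t n) := by
    rw [localCoeff_eq h.order (h.step_pos h1 hn)]
    have : 0 < 1 - α := by linarith [hα.2]
    gcongr
    linarith [hα.1]
  rw [weight_eq h1, if_pos rfl]
  rcases Nat.lt_or_ge 1 n with hk | hk
  · obtain ⟨j, rfl⟩ : ∃ j, n = j + 1 := ⟨n - 1, by omega⟩
    rw [Nat.add_sub_cancel]
    have b0 := h.bubble_nonneg (k := j) (by omega) (by omega) (offTime (α / 2) t (j + 1))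
    have b1 := h.histSlope_le_bubble (k := j) (by omega) (by omega) (offTime (α / 2) t (j + 1))
    have b2 := h.histSlope_nonneg (k := j) (by omega) (by omega) (offTime (α / 2) t (j + 1))
    have b3 := h.histMean_add_le (k := j) (by omega) (by omega) (offTime (α / 2) t (j + 1))
    have b4 := h.le_histMean_sub (k := j) (by omega) (by omega) (offTime (α / 2) t (j + 1))
    have b5 := h.kernel_le_two hk hn
    have b6 : 0 ≤ soeKernel s w (offTime (α / 2) t (j + 1)) (t (j - 1)) :=
      sum_nonneg fun l _ => by have := h.weight_pos l; positivity
    have b7 := h.ratio_le (k := j) (by omega) (by omega)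
    have b8 := h.tol_le
    have b9 := h.horizon_kernel_le (h.step_off_pos h1 hn) (h.step_off_le h1 hn)
    rw [Nat.add_sub_cancel] at b5
    have : ratio t j * histSlope (soeKernel s w (offTime (α / 2) t (j + 1))) t j
        ≤ 7 / 4 * histSlope (soeKernel s w (offTime (α / 2) t (j + 1))) t j := by gcongr
    linarith
  · obtain rfl : n = 1 := by omega
    rw [Nat.sub_self, histSlope_zero, mul_zero, add_zero]
    linarith

/-- The condition for the energy inequality holds unless the step is comparable with `T`. -/
lemma energy_condition {n : ℕ} (h1 : 1 ≤ n) (hn : n ≤ N)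
    (hgood : (1 - α / 2) / (1 - α) * fracKernel (1 - α) T
      ≤ fracKernel (1 - α) ((1 - α / 2) * step t n)) :
    (α / 2) ^ 2 * weight α t s w n (n - 1)
      ≤ (1 - 2 * (α / 2)) * (weight α t s w n (n - 1 + 1) - weight α t s w n (n - 1)) := by
  have hα := h.order
  rw [show n - 1 + 1 = n by omega]
  have e1 := h.localCoeff_le_weight h1 hn
  rw [localCoeff_eq h.order (h.step_pos h1 hn)] at e1
  have h1α : 0 < 1 - α := by linarith [hα.2]
  set ω := fracKernel (1 - α) ((1 - α / 2) * step t n) with hω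
  have hω0 : 0 < ω := fracKernel_pos h.order.2 (h.step_off_pos h1 hn)
  have e2 : (1 - α / 2) * ω ≤ (1 - α) * weight α t s w n n := by
    calc _ = (1 - α) * ((1 - α / 2) / (1 - α) * ω) := by field_simp
      _ ≤ _ := by gcongr
  rcases Nat.lt_or_ge 1 n with hk | hk
  · have e3 := h.weight_sub_le (n := n) (k := n - 1) (by omega) (by omega) hn
    have e4 := h.kernel_le_two hk hn
    -- This turns the weight bound ω + ε at n - 1 into (1 - θ) times that weight ≤ ω. The claim is
    -- equivalent to (1 - θ)² A_{n-1} ≤ (1 - 2θ) A_n, and (1 - 2θ) A_n ≥ (1 - θ) ω.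
    have e5 : (1 - α / 2) * ε ≤ α / 2 * ω := by
      calc (1 - α / 2) * ε ≤ (1 - α / 2) * (α / 2 / (1 - α) * fracKernel (1 - α) T) := by
            have := h.tol_le'
            have : 0 < 1 - α / 2 := by linarith
            gcongr
        _ = α / 2 * ((1 - α / 2) / (1 - α) * fracKernel (1 - α) T) := by ring
        _ ≤ _ := by
            have : 0 < α / 2 := by linarith [hα.1]
            gcongr
    have e6 : weight α t s w n (n - 1) ≤ ω + ε := e3.trans e4
    have e7 : 0 < (1 - α / 2) := by linarith
    have e8 : (1 - α / 2) ^ 2 * weight α t s w n (n - 1) ≤ (1 - α / 2) * ω := by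
      have := mul_le_mul_of_nonneg_left e6 (sq_nonneg (1 - α / 2))
      nlinarith
    nlinarith
  · obtain rfl : n = 1 := by omega
    rw [Nat.sub_self, weight_zero]
    nlinarith

open Classical in
/-- The number of steps in which the energy condition may fail is bounded. -/
lemma exists_bad : ∃ bad : Finset ℕ, (bad.card : ℝ) ≤ (1 - α) ^ (-(1 / α)) ∧
    ∀ n, 1 ≤ n → n ≤ N → n ∉ bad →
      (1 - α / 2) / (1 - α) * fracKernel (1 - α) T
        ≤ fracKernel (1 - α) ((1 - α / 2) * step t n) := by
  have hα := h.order
  have hT := h.horizon_pos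
  have h1α : 0 < 1 - α := by linarith [hα.2]
  have h2α : 0 < 1 - α / 2 := by linarith [hα.2]
  set bad := (Icc 1 N).filter fun n => ¬ ((1 - α / 2) / (1 - α) * fracKernel (1 - α) T
      ≤ fracKernel (1 - α) ((1 - α / 2) * step t n)) with hbad
  refine ⟨bad, ?_, ?_⟩
  · have hG : 0 < Real.Gamma (1 - α) := Real.Gamma_pos_of_pos h1α
    -- The factor (1 - α)^(1/α) has (-α)-th power 1/(1 - α), which dominates (1 - θ)/(1 - α). Steps
    -- that long number at most (1 - α)^(-1/α), since they add up to at most T.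
    have e1 : ∀ n ∈ bad, (1 - α) ^ (1 / α) * T ≤ step t n := by
      intro n hn
      obtain ⟨m1, m2⟩ := mem_filter.1 hn
      obtain ⟨m3, m4⟩ := mem_Icc.1 m1
      have hs := h.step_pos m3 m4
      by_contra! hc
      refine m2 ?_
      have e2 : fracKernel (1 - α) ((1 - α) ^ (1 / α) * T) ≤ fracKernel (1 - α) (step t n) :=
        fracKernel_anti hα hs hc.le
      have e3 : fracKernel (1 - α) (step t n)
          ≤ fracKernel (1 - α) ((1 - α / 2) * step t n) :=
        fracKernel_anti hα (h.step_off_pos m3 m4) (by nlinarith [hα.1])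
      refine le_trans ?_ (e2.trans e3)
      rw [fracKernel_eq, fracKernel_eq, Real.mul_rpow (by positivity) hT.le, ← Real.rpow_mul h1α.le,
        show 1 / α * -α = -1 by have := hα.1.ne'; field_simp, Real.rpow_neg_one, mul_div_assoc]
      have : 0 ≤ T ^ (-α) / Real.Gamma (1 - α) := by positivity
      refine mul_le_mul_of_nonneg_right ?_ this
      rw [div_eq_mul_inv]
      have : 0 < (1 - α)⁻¹ := by positivity
      nlinarith [hα.1]
    have e4 : ∑ n ∈ bad, step t n ≤ T := by
      calc ∑ n ∈ bad, step t n ≤ ∑ n ∈ Icc 1 N, step t n := by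
            refine sum_le_sum_of_subset_of_nonneg (filter_subset _ _) fun n hn _ => ?_
            obtain ⟨m3, m4⟩ := mem_Icc.1 hn
            exact (h.step_pos m3 m4).le
        _ = T := by
            have : ∀ n, ∑ k ∈ Icc 1 n, step t k = t n - t 0 := by
              intro n
              induction n with
              | zero => simp
              | succ n ih =>
                rw [sum_Icc_succ_top (by omega), ih, step, Nat.add_sub_cancel]
                ring
            rw [this, h.mesh.start, h.mesh.finish, sub_zero]
    have e5 := (card_nsmul_le_sum bad _ _ e1).trans e4
    rw [nsmul_eq_mul] at e5
    have e6 : (bad.card : ℝ) * (1 - α) ^ (1 / α) ≤ 1 := by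
      by_contra! hc
      nlinarith
    rw [Real.rpow_neg h1α.le, ← one_div, le_div_iff₀ (by positivity)]
    exact e6
  · intro n h1 hn hb
    by_contra hc
    exact hb (mem_filter.2 ⟨mem_Icc.2 ⟨h1, hn⟩, hc⟩)

end IsFastMesh

end TFBS

namespace TFBS

open Finset intervalIntegral MeasureTheory

/-! ### One-variable calculus -/

/-- The derivative bound is only required within distance |x - c| of c, so M may depend on that
distance; this lets Taylor estimates be obtained by iteration. -/
lemma abs_sub_le_of_hasDerivAt {f f' : ℝ → ℝ} {l u M : ℝ} (hf : ContinuousOn f (Set.Icc l u))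
    (hd : ∀ y ∈ Set.Ioo l u, HasDerivAt f (f' y) y) {x c : ℝ} (hx : x ∈ Set.Icc l u)
    (hc : c ∈ Set.Icc l u)
    (hM : ∀ y ∈ Set.Ioo l u, |y - c| ≤ |x - c| → |f' y| ≤ M) : |f x - f c| ≤ M * |x - c| := by
  rcases lt_trichotomy x c with h | h | h
  · obtain ⟨ξ, hξ, e⟩ := exists_hasDerivAt_eq_slope f f' h
      (hf.mono (Set.Icc_subset_Icc hx.1 hc.2))
      (fun y hy => hd y ⟨hx.1.trans_lt hy.1, hy.2.trans_le hc.2⟩)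
    have hcx : 0 < c - x := by linarith
    rw [eq_div_iff hcx.ne'] at e
    have h1 := hM ξ ⟨hx.1.trans_lt hξ.1, hξ.2.trans_le hc.2⟩
      (by rw [abs_of_neg (by linarith [hξ.2]), abs_of_neg (by linarith)]; linarith [hξ.1])
    rw [abs_sub_comm, ← e, abs_mul, abs_sub_comm x c]
    gcongr
  · simp [h]
  · obtain ⟨ξ, hξ, e⟩ := exists_hasDerivAt_eq_slope f f' h
      (hf.mono (Set.Icc_subset_Icc hc.1 hx.2))
      (fun y hy => hd y ⟨hc.1.trans_lt hy.1, hy.2.trans_le hx.2⟩)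
    have hcx : 0 < x - c := by linarith
    rw [eq_div_iff hcx.ne'] at e
    have h1 := hM ξ ⟨hc.1.trans_lt hξ.1, hξ.2.trans_le hx.2⟩
      (by rw [abs_of_pos (by linarith [hξ.1]), abs_of_pos (by linarith)]; linarith [hξ.2])
    rw [← e, abs_mul]
    gcongr

/-- One step of a Taylor estimate. -/
lemma abs_sub_le_pow_succ {f f' : ℝ → ℝ} {l u c M : ℝ} (hf : ContinuousOn f (Set.Icc l u))
    (hd : ∀ y ∈ Set.Ioo l u, HasDerivAt f (f' y) y) (hM0 : 0 ≤ M) (hc : c ∈ Set.Icc l u) {k : ℕ}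
    (hM : ∀ y ∈ Set.Ioo l u, |f' y| ≤ M * |y - c| ^ k) {x : ℝ} (hx : x ∈ Set.Icc l u) :
    |f x - f c| ≤ M * |x - c| ^ (k + 1) := by
  have := abs_sub_le_of_hasDerivAt hf hd hx hc (M := M * |x - c| ^ k)
    (fun y hy hle => (hM y hy).trans (by gcongr))
  rwa [mul_assoc, ← pow_succ] at this

/-- Comparison with a primitive B of the bound: both B - f and B + f increase. It integrates
singular bounds such as t^(σ-1) without integrability of f'. -/
lemma abs_sub_le_of_hasDerivAt_le {f f' B B' : ℝ → ℝ} {a b : ℝ} (hab : a ≤ b)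
    (hf : ContinuousOn f (Set.Icc a b)) (hd : ∀ y ∈ Set.Ioo a b, HasDerivAt f (f' y) y)
    (hB : ContinuousOn B (Set.Icc a b)) (hBd : ∀ y ∈ Set.Ioo a b, HasDerivAt B (B' y) y)
    (hle : ∀ y ∈ Set.Ioo a b, |f' y| ≤ B' y) : |f b - f a| ≤ B b - B a := by
  have m1 : MonotoneOn (fun x => B x - f x) (Set.Icc a b) := by
    refine monotoneOn_of_deriv_nonneg (convex_Icc a b) (hB.sub hf) ?_ ?_
    · rw [interior_Icc]
      exact fun y hy => ((hBd y hy).sub (hd y hy)).differentiableAt.differentiableWithinAt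
    · rw [interior_Icc]
      intro y hy
      rw [((hBd y hy).fun_sub (hd y hy)).deriv]
      linarith [le_abs_self (f' y), hle y hy]
  have m2 : MonotoneOn (fun x => B x + f x) (Set.Icc a b) := by
    refine monotoneOn_of_deriv_nonneg (convex_Icc a b) (hB.add hf) ?_ ?_
    · rw [interior_Icc]
      exact fun y hy => ((hBd y hy).add (hd y hy)).differentiableAt.differentiableWithinAt
    · rw [interior_Icc]
      intro y hy
      rw [((hBd y hy).fun_add (hd y hy)).deriv]
      linarith [neg_abs_le (f' y), hle y hy]
  have e1 := m1 (Set.left_mem_Icc.2 hab) (Set.right_mem_Icc.2 hab) hab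
  have e2 := m2 (Set.left_mem_Icc.2 hab) (Set.right_mem_Icc.2 hab) hab
  simp only at e1 e2
  rw [abs_le]
  constructor <;> linarith

/-- A function vanishing at both end points is controlled by its second derivative. -/
lemma abs_le_of_vanishing_endpoints {f f1 f2 : ℝ → ℝ} {a b m : ℝ}
    (hf : ContinuousOn f (Set.Icc a b)) (h1 : ∀ y ∈ Set.Ioo a b, HasDerivAt f (f1 y) y)
    (h2 : ∀ y ∈ Set.Ioo a b, HasDerivAt f1 (f2 y) y) (ha : f a = 0) (hb : f b = 0)
    (hm : ∀ y ∈ Set.Ioo a b, |f2 y| ≤ m) {r : ℝ} (hr : r ∈ Set.Icc a b) :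
    |f r| ≤ m / 2 * ((r - a) * (b - r)) := by
  rcases hr.1.eq_or_lt with h | har
  · simp [← h, ha]
  rcases hr.2.eq_or_lt with h | hrb
  · simp [h, hb]
  have hpos : 0 < (r - a) * (b - r) := mul_pos (by linarith) (by linarith)
  -- With this factor f - lam (x - a)(b - x) has a third zero at r, and Rolle's theorem, applied
  -- twice, gives f'' = -2 lam somewhere.
  set lam := f r / ((r - a) * (b - r)) with hlam
  have hfr : f r = lam * ((r - a) * (b - r)) := by rw [hlam]; field_simp
  have hg : ∀ y ∈ Set.Ioo a b, HasDerivAt (fun x => f x - lam * ((x - a) * (b - x)))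
      (f1 y - lam * (a + b - 2 * y)) y := by
    intro y hy
    refine ((h1 y hy).fun_sub ((((hasDerivAt_id' y).sub_const a).fun_mul
      ((hasDerivAt_id' y).const_sub b)).const_mul lam)).congr_deriv ?_
    ring
  have hgc : ContinuousOn (fun x => f x - lam * ((x - a) * (b - x))) (Set.Icc a b) :=
    hf.sub (by fun_prop)
  obtain ⟨ξ1, hξ1, e1⟩ := exists_hasDerivAt_eq_zero (f := fun x => f x - lam * ((x - a) * (b - x)))
    har (hgc.mono (Set.Icc_subset_Icc_right hrb.le)) (by simp [ha, hfr])
    (fun y hy => hg y ⟨hy.1, hy.2.trans hrb⟩)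
  obtain ⟨ξ2, hξ2, e2⟩ := exists_hasDerivAt_eq_zero (f := fun x => f x - lam * ((x - a) * (b - x)))
    hrb (hgc.mono (Set.Icc_subset_Icc_left har.le)) (by simp [hb, hfr])
    (fun y hy => hg y ⟨har.trans hy.1, hy.2⟩)
  have hg2 : ∀ y ∈ Set.Ioo a b, HasDerivAt (fun x => f1 x - lam * (a + b - 2 * x))
      (f2 y + 2 * lam) y := by
    intro y hy
    refine ((h2 y hy).fun_sub ((((hasDerivAt_id' y).const_mul 2).const_sub (a + b)).const_mul
      lam)).congr_deriv ?_
    ring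
  obtain ⟨ξ, hξ, e⟩ := exists_hasDerivAt_eq_zero (f := fun x => f1 x - lam * (a + b - 2 * x))
    (hξ1.2.trans hξ2.1)
    (fun y hy => (hg2 y ⟨hξ1.1.trans_le hy.1, hy.2.trans_lt hξ2.2⟩).continuousAt.continuousWithinAt)
    (by rw [e1, e2])
    (fun y hy => hg2 y ⟨hξ1.1.trans hy.1, hy.2.trans hξ2.2⟩)
  have h3 := hm ξ ⟨hξ1.1.trans hξ.1, hξ.2.trans hξ2.2⟩
  rw [show f2 ξ = -(2 * lam) by linarith, abs_neg, abs_mul, abs_two] at h3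
  rw [hfr, abs_mul, abs_of_pos hpos]
  gcongr
  linarith

/-! ### Integrals of functions with endpoint singularities -/

lemma intervalIntegrable_of_abs_le {f g : ℝ → ℝ} {a b : ℝ} (hab : a ≤ b)
    (hf : ContinuousOn f (Set.Ioo a b)) (hg : IntervalIntegrable g volume a b)
    (hfg : ∀ x ∈ Set.Ioo a b, |f x| ≤ g x) : IntervalIntegrable f volume a b := by
  rw [intervalIntegrable_iff_integrableOn_Ioo_of_le hab] at hg ⊢
  exact Integrable.mono' hg (hf.aestronglyMeasurable measurableSet_Ioo)
    (ae_restrict_of_forall_mem measurableSet_Ioo hfg)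

lemma abs_integral_le_of_abs_le {f g : ℝ → ℝ} {a b : ℝ} (hab : a ≤ b)
    (hg : IntervalIntegrable g volume a b)
    (hfg : ∀ x ∈ Set.Ioo a b, |f x| ≤ g x) : |∫ x in a..b, f x| ≤ ∫ x in a..b, g x := by
  rw [← Real.norm_eq_abs]
  refine intervalIntegral.norm_integral_le_of_norm_le hab ?_ hg
  have : ∀ᵐ x : ℝ, x ≠ b := by simp [ae_iff]
  filter_upwards [this] with x hx hx2
  exact hfg x ⟨hx2.1, lt_of_le_of_ne hx2.2 hx⟩

lemma intervalIntegrable_beta {p q : ℝ} (hp : -1 < p) (hq : -1 < q) {x : ℝ} (hx : 0 < x) :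
    IntervalIntegrable (fun s : ℝ => (x - s) ^ p * s ^ q) volume 0 x := by
  have h1 : IntervalIntegrable (fun s : ℝ => (x - s) ^ p * s ^ q) volume 0 (x / 2) := by
    refine IntervalIntegrable.continuousOn_mul (intervalIntegrable_rpow' hq) ?_
    rw [Set.uIcc_of_le (by linarith)]
    exact ContinuousOn.rpow_const (by fun_prop) fun s hs => Or.inl (by linarith [hs.2])
  have h2 : IntervalIntegrable (fun s : ℝ => (x - s) ^ p * s ^ q) volume (x / 2) x := by
    have h3 : IntervalIntegrable (fun s : ℝ => (x - s) ^ p) volume (x / 2) x := by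
      have := (intervalIntegrable_rpow' (a := 0) (b := x / 2) hp).comp_sub_left x
      simpa [show x - x / 2 = x / 2 by ring] using this.symm
    refine h3.mul_continuousOn ?_
    rw [Set.uIcc_of_le (by linarith)]
    exact ContinuousOn.rpow_const (by fun_prop) fun s hs => Or.inl (by linarith [hs.1])
  exact h1.trans h2

lemma integral_beta_scale (p q : ℝ) {x : ℝ} (hx : 0 < x) :
    ∫ s in (0 : ℝ)..x, (x - s) ^ p * s ^ q
      = x ^ (p + q + 1) * ∫ y in (0 : ℝ)..1, (1 - y) ^ p * y ^ q := by
  have h1 := integral_comp_mul_left (a := 0) (b := 1) (fun s : ℝ => (x - s) ^ p * s ^ q) hx.ne'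
  rw [mul_zero, mul_one, smul_eq_mul] at h1
  have h2 : ∫ y in (0 : ℝ)..1, (x - x * y) ^ p * (x * y) ^ q
      = x ^ (p + q) * ∫ y in (0 : ℝ)..1, (1 - y) ^ p * y ^ q := by
    rw [← intervalIntegral.integral_const_mul]
    refine integral_congr fun y hy => ?_
    rw [Set.uIcc_of_le zero_le_one] at hy
    rw [show x - x * y = x * (1 - y) by ring, Real.mul_rpow hx.le (by linarith [hy.2]),
      Real.mul_rpow hx.le hy.1, Real.rpow_add hx]
    ring
  rw [h2] at h1
  rw [Real.rpow_add hx _ 1, Real.rpow_one]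
  field_simp at h1 ⊢
  linarith

/-- The error of replacing `v'` by the derivative `q'` of an interpolant, integrated against a
smooth kernel. -/
lemma IsConvexKernel.integral_sub_eq {κ κ' : ℝ → ℝ} (h : IsConvexKernel κ κ') {q q' v v1 : ℝ → ℝ}
    {a b : ℝ} (hab : a ≤ b) (hq : ∀ r, HasDerivAt q (q' r) r) (hq' : Continuous q')
    (hv : ContinuousOn v (Set.Icc a b)) (hd : ∀ r ∈ Set.Ioo a b, HasDerivAt v (v1 r) r)
    (hv1 : IntervalIntegrable v1 volume a b) (ha : q a = v a) (hb : q b = v b) :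
    (∫ r in a..b, κ r * q' r) - ∫ r in a..b, κ r * v1 r
      = -∫ r in a..b, κ' r * (q r - v r) := by
  have hκ := h.continuous
  have i1 : IntervalIntegrable (fun r => κ r * q' r) volume a b := by
    apply Continuous.intervalIntegrable; fun_prop
  have i2 : IntervalIntegrable (fun r => κ r * v1 r) volume a b := hv1.continuousOn_mul hκ.continuousOn
  rw [← integral_sub i1 i2]
  have h1 := integral_mul_deriv_eq_deriv_mul_of_hasDerivAt (u := κ) (u' := κ')
    (v := fun r => q r - v r) (v' := fun r => q' r - v1 r) (a := a) (b := b) hκ.continuousOn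
    (by
      rw [Set.uIcc_of_le hab]
      exact ContinuousOn.sub (fun r _ => (hq r).continuousAt.continuousWithinAt) hv)
    (fun r _ => h.hasDerivAt r)
    (fun r hr => by
      rw [min_eq_left hab, max_eq_right hab] at hr
      exact (hq r).fun_sub (hd r hr))
    (h.cont.intervalIntegrable _ _) ((hq'.intervalIntegrable _ _).sub hv1)
  rw [ha, hb, sub_self, sub_self, mul_zero, mul_zero, sub_zero, zero_sub] at h1
  rw [← h1]
  exact integral_congr fun r _ => by ring

end TFBS

/-! ### Functions of time with an initial singularity t^σ. -/

namespace TFBS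

open Finset intervalIntegral MeasureTheory Filter Topology

/-- A function of time on `(0,T]` with three derivatives and an initial singularity of the type
`t^σ`. -/
structure TimeReg (σ K T : ℝ) (v v1 v2 v3 : ℝ → ℝ) : Prop where
  c0 : ContinuousOn v (Set.Ioc 0 T)
  c1 : ContinuousOn v1 (Set.Ioc 0 T)
  c2 : ContinuousOn v2 (Set.Ioc 0 T)
  d0 : ∀ t ∈ Set.Ioo 0 T, HasDerivAt v (v1 t) t
  d1 : ∀ t ∈ Set.Ioo 0 T, HasDerivAt v1 (v2 t) t
  d2 : ∀ t ∈ Set.Ioo 0 T, HasDerivAt v2 (v3 t) t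
  b1 : ∀ t ∈ Set.Ioc 0 T, |v1 t| ≤ K * (1 + t ^ (σ - 1))
  b2 : ∀ t ∈ Set.Ioc 0 T, |v2 t| ≤ K * t ^ (σ - 2)
  b3 : ∀ t ∈ Set.Ioc 0 T, |v3 t| ≤ K * t ^ (σ - 3)

lemma one_add_rpow_le {T t p : ℝ} (ht : 0 < t) (htT : t ≤ T) (hp : p ≤ 0) :
    1 + t ^ p ≤ (1 + T ^ (-p)) * t ^ p := by
  have h1 : t ^ (-p) ≤ T ^ (-p) := Real.rpow_le_rpow ht.le htT (by linarith)
  have h2 : t ^ (-p) * t ^ p = 1 := by rw [← Real.rpow_add ht]; simp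
  have := mul_le_mul_of_nonneg_right h1 (Real.rpow_nonneg ht.le p)
  linarith

/-- A common treatment of σ < 1 and σ > 1 near t = 0. Quadratic and linear interpolation are exact
on affine functions, so a slope p may be subtracted: p = 0 if σ < 1, and p = v'(x) if σ > 1. In both
cases the remaining increments are O(x^σ). Integrating the bounds divides by σ or by σ - 1, so this
argument leaves out σ = 1. -/
lemma exists_linear_approx {σ K T : ℝ} (hσ : σ ∈ Set.Ioo (0 : ℝ) 1 ∪ Set.Ioo (1 : ℝ) 2)
    (hK : 0 ≤ K) (hT : 0 < T) : ∃ C, 0 ≤ C ∧ ∀ v v1 v2 v3, TimeReg σ K T v v1 v2 v3 →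
      (∀ t ∈ Set.Ioc 0 T, |v1 t| ≤ C * t ^ (min σ 1 - 1)) ∧
      ∀ x ∈ Set.Ioc 0 T, ∃ p,
        (∀ r ∈ Set.Ioc 0 x, |v1 r - p| ≤ C * (x ^ (σ - min σ 1) * r ^ (min σ 1 - 1))) ∧
        ∀ r r', 0 < r' → r' ≤ r → r ≤ x → |v r - v r' - p * (r - r')| ≤ C * x ^ σ := by
  rcases hσ with hσ | hσ
  · have hσ0 := hσ.1
    rw [min_eq_left hσ.2.le]
    set C0 := K * (1 + T ^ (1 - σ)) with hC0
    have hC00 : 0 ≤ C0 := by positivity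
    have hle : C0 ≤ C0 / σ := by
      rw [le_div_iff₀ hσ0]
      nlinarith [hσ.2]
    refine ⟨C0 / σ, by positivity, fun v v1 v2 v3 hv => ?_⟩
    have key : ∀ t ∈ Set.Ioc 0 T, |v1 t| ≤ C0 * t ^ (σ - 1) := by
      intro t ht
      refine (hv.b1 t ht).trans ?_
      have := one_add_rpow_le ht.1 ht.2 (p := σ - 1) (by linarith [hσ.2])
      rw [show -(σ - 1) = 1 - σ by ring] at this
      rw [hC0, mul_assoc]
      gcongr
    refine ⟨fun t ht => (key t ht).trans ?_, fun x hx => ⟨0, fun r hr => ?_, fun r r' h0 h1 h2 => ?_⟩⟩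
    · have := Real.rpow_nonneg ht.1.le (σ - 1)
      gcongr
    · rw [sub_zero, sub_self, Real.rpow_zero, one_mul]
      refine (key r ⟨hr.1, hr.2.trans hx.2⟩).trans ?_
      have := Real.rpow_nonneg hr.1.le (σ - 1)
      gcongr
    · rw [zero_mul, sub_zero]
      have hsub : Set.Icc r' r ⊆ Set.Ioc 0 T := fun y hy =>
        ⟨h0.trans_le hy.1, hy.2.trans (h2.trans hx.2)⟩
      have hsub' : Set.Ioo r' r ⊆ Set.Ioo 0 T := fun y hy =>
        ⟨h0.trans hy.1, hy.2.trans_le (h2.trans hx.2)⟩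
      have hB : ∀ y ∈ Set.Icc r' r, HasDerivAt (fun y => C0 / σ * y ^ σ) (C0 * y ^ (σ - 1)) y := by
        intro y hy
        refine ((Real.hasDerivAt_rpow_const (Or.inl (hsub hy).1.ne')).const_mul _).congr_deriv ?_
        field_simp
      have := abs_sub_le_of_hasDerivAt_le h1 (hv.c0.mono hsub) (fun y hy => hv.d0 y (hsub' hy))
        (fun y hy => (hB y hy).continuousAt.continuousWithinAt)
        (fun y hy => hB y (Set.Ioo_subset_Icc_self hy))
        (fun y hy => key y (hsub (Set.Ioo_subset_Icc_self hy)))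
      refine this.trans ?_
      have e1 : 0 ≤ C0 / σ * r' ^ σ := by positivity
      have e2 : r ^ σ ≤ x ^ σ := Real.rpow_le_rpow (h0.le.trans h1) h2 hσ0.le
      have e3 : C0 / σ * r ^ σ ≤ C0 / σ * x ^ σ := by gcongr
      linarith
  · have hσ0 : 0 < σ - 1 := by linarith [hσ.1]
    rw [min_eq_right hσ.1.le]
    set C0 := K * (1 + T ^ (σ - 1)) + K / (σ - 1) with hC0
    have hA : K * (1 + T ^ (σ - 1)) ≤ C0 := by rw [hC0]; linarith [div_nonneg hK hσ0.le]
    have hB' : K / (σ - 1) ≤ C0 := by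
      have : 0 ≤ K * (1 + T ^ (σ - 1)) := by positivity
      linarith
    have hC00 : 0 ≤ C0 := (div_nonneg hK hσ0.le).trans hB'
    refine ⟨C0, hC00, fun v v1 v2 v3 hv => ⟨fun t ht => ?_, fun x hx => ⟨v1 x, ?_⟩⟩⟩
    · rw [sub_self, Real.rpow_zero, mul_one]
      refine (hv.b1 t ht).trans (le_trans ?_ hA)
      have := Real.rpow_le_rpow ht.1.le ht.2 hσ0.le
      gcongr
    have key : ∀ r ∈ Set.Ioc 0 x, |v1 r - v1 x| ≤ C0 * x ^ (σ - 1) := by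
      intro r hr
      have hsub : Set.Icc r x ⊆ Set.Ioc 0 T := fun y hy =>
        ⟨hr.1.trans_le hy.1, hy.2.trans hx.2⟩
      have hsub' : Set.Ioo r x ⊆ Set.Ioo 0 T := fun y hy =>
        ⟨hr.1.trans hy.1, hy.2.trans_le hx.2⟩
      have hB : ∀ y ∈ Set.Icc r x,
          HasDerivAt (fun y => K / (σ - 1) * y ^ (σ - 1)) (K * y ^ (σ - 2)) y := by
        intro y hy
        refine ((Real.hasDerivAt_rpow_const (Or.inl (hsub hy).1.ne')).const_mul _).congr_deriv ?_
        rw [show σ - 1 - 1 = σ - 2 by ring]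
        field_simp
      have := abs_sub_le_of_hasDerivAt_le hr.2 (hv.c1.mono hsub) (fun y hy => hv.d1 y (hsub' hy))
        (fun y hy => (hB y hy).continuousAt.continuousWithinAt)
        (fun y hy => hB y (Set.Ioo_subset_Icc_self hy))
        (fun y hy => hv.b2 y (hsub (Set.Ioo_subset_Icc_self hy)))
      rw [abs_sub_comm]
      refine this.trans ?_
      have hr0 := hr.1
      have e1 : 0 ≤ K / (σ - 1) * r ^ (σ - 1) := by positivity
      have e2 : K / (σ - 1) * x ^ (σ - 1) ≤ C0 * x ^ (σ - 1) := by
        have := Real.rpow_nonneg hx.1.le (σ - 1)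
        gcongr
      linarith
    refine ⟨fun r hr => ?_, fun r r' h0 h1 h2 => ?_⟩
    · rw [sub_self, Real.rpow_zero, mul_one]
      exact key r hr
    · have hsub : Set.Icc r' r ⊆ Set.Ioc 0 T := fun y hy =>
        ⟨h0.trans_le hy.1, hy.2.trans (h2.trans hx.2)⟩
      have hsub' : Set.Ioo r' r ⊆ Set.Ioo 0 T := fun y hy =>
        ⟨h0.trans hy.1, hy.2.trans_le (h2.trans hx.2)⟩
      have e1 := abs_sub_le_of_hasDerivAt (f := fun y => v y - v1 x * y)
        (f' := fun y => v1 y - v1 x) (M := C0 * x ^ (σ - 1))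
        ((hv.c0.mono hsub).sub (by fun_prop))
        (fun y hy => ((hv.d0 y (hsub' hy)).fun_sub ((hasDerivAt_id' y).const_mul (v1 x))).congr_deriv
          (by ring)) (Set.right_mem_Icc.2 h1) (Set.left_mem_Icc.2 h1)
        (fun y hy _ => key y ⟨h0.trans hy.1, hy.2.le.trans h2⟩)
      rw [show v r - v r' - v1 x * (r - r') = v r - v1 x * r - (v r' - v1 x * r') by ring]
      refine e1.trans ?_
      rw [abs_of_nonneg (by linarith), mul_assoc]
      have e2 : x ^ (σ - 1) * (r - r') ≤ x ^ σ := by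
        calc _ ≤ x ^ (σ - 1) * x := by
              have := Real.rpow_nonneg hx.1.le (σ - 1)
              gcongr
              linarith
          _ = x ^ σ := by
              nth_rw 2 [← Real.rpow_one x]
              rw [← Real.rpow_add hx.1]
              ring_nf
      gcongr

/-- Passing to the initial time in a bound of increments. -/
lemma abs_sub_initial_le {v : ℝ → ℝ} {T x p D : ℝ} (hv : ContinuousOn v (Set.Icc 0 T)) (hxT : x ≤ T)
    (hle : ∀ r r', 0 < r' → r' ≤ r → r ≤ x → |v r - v r' - p * (r - r')| ≤ D) (hx : 0 < x) {r : ℝ}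
    (hr : r ∈ Set.Icc 0 x) : |v r - v 0 - p * r| ≤ D := by
  rcases hr.1.eq_or_lt with h | h
  · subst h
    have := hle x x hx le_rfl le_rfl
    simp only [sub_self, mul_zero, abs_zero] at this ⊢
    exact this
  · have hc : Tendsto v (𝓝[>] 0) (𝓝 (v 0)) :=
      ((hv 0 ⟨le_rfl, hx.le.trans hxT⟩).mono_of_mem_nhdsWithin
        (mem_of_superset (Ioc_mem_nhdsGT (hx.trans_le hxT)) Set.Ioc_subset_Icc_self))
    have hid : Tendsto (fun y : ℝ => y) (𝓝[>] 0) (𝓝 0) := tendsto_id.mono_left nhdsWithin_le_nhds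
    have h1 : Tendsto (fun r' => |v r - v r' - p * (r - r')|) (𝓝[>] 0)
        (𝓝 |v r - v 0 - p * (r - 0)|) :=
      ((tendsto_const_nhds.sub hc).sub ((tendsto_const_nhds.sub hid).const_mul p)).abs
    rw [sub_zero] at h1
    refine le_of_tendsto h1 ?_
    filter_upwards [Ioc_mem_nhdsGT h] with r' hr'
    exact hle r r' hr'.1 hr'.2 hr.2

namespace TimeReg

variable {σ K T : ℝ} {v v1 v2 v3 : ℝ → ℝ} (hv : TimeReg σ K T v v1 v2 v3)
include hv

/-- Repeated mean value estimates, without factorials in the constants and without any continuity of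
the third derivative. -/
lemma taylor {l u c V : ℝ} (hl : 0 < l) (hu : u ≤ T) (hV : 0 ≤ V) (hc : c ∈ Set.Icc l u)
    (hb : ∀ y ∈ Set.Ioo l u, |v3 y| ≤ V) {x : ℝ} (hx : x ∈ Set.Icc l u) :
    |v2 x - v2 c| ≤ V * |x - c| ∧
    |v1 x - v1 c - v2 c * (x - c)| ≤ V * |x - c| ^ 2 ∧
    |v x - v c - v1 c * (x - c) - v2 c / 2 * (x - c) ^ 2| ≤ V * |x - c| ^ 3 := by
  have hsub : Set.Icc l u ⊆ Set.Ioc 0 T := fun y hy => ⟨hl.trans_le hy.1, hy.2.trans hu⟩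
  have hsub' : Set.Ioo l u ⊆ Set.Ioo 0 T := fun y hy => ⟨hl.trans hy.1, hy.2.trans_le hu⟩
  have e0 : ∀ x ∈ Set.Icc l u, |v2 x - v2 c| ≤ V * |x - c| := fun x hx => by
    simpa using abs_sub_le_pow_succ (k := 0) (hv.c2.mono hsub) (fun y hy => hv.d2 y (hsub' hy)) hV hc
      (fun y hy => by simpa using hb y hy) hx
  have e1 : ∀ x ∈ Set.Icc l u, |v1 x - v1 c - v2 c * (x - c)| ≤ V * |x - c| ^ 2 := fun x hx => by
    have := abs_sub_le_pow_succ (k := 1) (f := fun x => v1 x - v2 c * (x - c))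
      (f' := fun x => v2 x - v2 c) ((hv.c1.mono hsub).sub (by fun_prop))
      (fun y hy => ((hv.d1 y (hsub' hy)).fun_sub
        (((hasDerivAt_id' y).sub_const c).const_mul (v2 c))).congr_deriv (by ring)) hV hc
      (fun y hy => by simpa using e0 y (Set.Ioo_subset_Icc_self hy)) hx
    rw [show v1 x - v1 c - v2 c * (x - c) = v1 x - v2 c * (x - c) - (v1 c - v2 c * (c - c)) by ring]
    exact this
  refine ⟨e0 x hx, e1 x hx, ?_⟩
  have := abs_sub_le_pow_succ (k := 2) (f := fun x => v x - v1 c * (x - c) - v2 c / 2 * (x - c) ^ 2)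
      (f' := fun x => v1 x - v1 c - v2 c * (x - c)) (((hv.c0.mono hsub).sub (by fun_prop)).sub
        (by fun_prop))
      (fun y hy => (((hv.d0 y (hsub' hy)).fun_sub
        (((hasDerivAt_id' y).sub_const c).const_mul (v1 c))).fun_sub
        ((((hasDerivAt_id' y).sub_const c).fun_pow 2).const_mul (v2 c / 2))).congr_deriv
          (by push_cast; ring)) hV hc
      (fun y hy => e1 y (Set.Ioo_subset_Icc_self hy)) hx
  rw [show v x - v c - v1 c * (x - c) - v2 c / 2 * (x - c) ^ 2
    = v x - v1 c * (x - c) - v2 c / 2 * (x - c) ^ 2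
      - (v c - v1 c * (c - c) - v2 c / 2 * (c - c) ^ 2) by ring]
  exact this

/-- The second difference quotient approximates the second derivative. -/
lemma second_quotient {c y z V : ℝ} (hy : 0 < y) (hz : 0 < z) (hl : 0 < c - y) (hu : c + z ≤ T)
    (hV : 0 ≤ V) (hb : ∀ x ∈ Set.Ioo (c - y) (c + z), |v3 x| ≤ V) {r : ℝ}
    (hr : r ∈ Set.Icc (c - y) c) :
    |2 * (((v (c + z) - v c) / z - (v c - v (c - y)) / y) / (y + z)) - v2 r| ≤ 3 * V * (y + z) := by
  have hc : c ∈ Set.Icc (c - y) (c + z) := ⟨by linarith, by linarith⟩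
  obtain ⟨-, -, t1⟩ := hv.taylor hl hu hV hc hb (x := c + z) ⟨by linarith, le_rfl⟩
  obtain ⟨-, -, t2⟩ := hv.taylor hl hu hV hc hb (x := c - y) ⟨le_rfl, by linarith⟩
  obtain ⟨t3, -, -⟩ := hv.taylor hl hu hV hc hb (x := r) ⟨hr.1, by linarith [hr.2]⟩
  rw [show c + z - c = z by ring, abs_of_pos hz] at t1
  rw [show c - y - c = -y by ring, abs_neg, abs_of_pos hy] at t2
  have t3' : |v2 r - v2 c| ≤ V * y := t3.trans (by
    gcongr
    rw [abs_le]
    constructor <;> linarith [hr.1, hr.2])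
  set e1 := v (c + z) - v c - v1 c * z - v2 c / 2 * z ^ 2 with he1
  set e2 := v (c - y) - v c - v1 c * -y - v2 c / 2 * (-y) ^ 2 with he2
  have id : 2 * (((v (c + z) - v c) / z - (v c - v (c - y)) / y) / (y + z)) - v2 r
      = (2 * (e1 / z) + 2 * (e2 / y)) / (y + z) - (v2 r - v2 c) := by
    rw [he1, he2]
    field_simp
    ring
  have q1 : |e1 / z| ≤ V * z ^ 2 := by
    rw [abs_div, abs_of_pos hz, div_le_iff₀ hz]
    linarith
  have q2 : |e2 / y| ≤ V * y ^ 2 := by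
    rw [abs_div, abs_of_pos hy, div_le_iff₀ hy]
    linarith
  have q3 : |(2 * (e1 / z) + 2 * (e2 / y)) / (y + z)| ≤ 2 * V * (y + z) := by
    rw [abs_div, abs_of_pos (by linarith : 0 < y + z), div_le_iff₀ (by linarith)]
    have h1 := abs_add_le (2 * (e1 / z)) (2 * (e2 / y))
    rw [abs_mul 2 (e1 / z), abs_mul 2 (e2 / y), abs_two] at h1
    have h2 : 0 ≤ V * (y * z) := by positivity
    nlinarith
  rw [id]
  refine (abs_sub _ _).trans ?_
  have : 0 ≤ V * z := by positivity
  linarith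

end TimeReg

end TFBS

/-! ### Interpolation errors on the history intervals. -/

namespace TFBS

open Finset intervalIntegral MeasureTheory Filter Topology

/-- The choice θ = α/2 enters here: the midpoint of the step is the barycentre of the weight
ω_{1-α}(t_{n-θ} - r) on [t_{n-1}, t_{n-θ}], which gives the local difference quotient an additional
order. -/
lemma integral_fracKernel_moment {α : ℝ} (hα : α ∈ Set.Ioo (0 : ℝ) 1) {τ x : ℝ} (hτ : 0 < τ) :
    ∫ r in (x - (1 - α / 2) * τ)..x,
      fracKernel (1 - α) (x - r) * (r - (x - (1 - α / 2) * τ) - τ / 2) = 0 := by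
  have hL : 0 < (1 - α / 2) * τ := mul_pos (by linarith [hα.2]) hτ
  have h1 := integral_comp_sub_left (a := x - (1 - α / 2) * τ) (b := x)
    (fun y => fracKernel (1 - α) y * ((1 / 2 - α / 2) * τ - y)) x
  rw [sub_self, sub_sub_cancel] at h1
  have h2 : ∫ y in (0 : ℝ)..(1 - α / 2) * τ, fracKernel (1 - α) y * ((1 / 2 - α / 2) * τ - y)
      = ∫ y in (0 : ℝ)..(1 - α / 2) * τ, ((1 / 2 - α / 2) * τ / Real.Gamma (1 - α) * y ^ (-α)
        - 1 / Real.Gamma (1 - α) * y ^ (1 - α)) := by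
    refine integral_congr fun y hy => ?_
    rw [Set.uIcc_of_le hL.le] at hy
    simp only [fracKernel_eq]
    have : y ^ (1 - α) = y * y ^ (-α) := by
      rcases hy.1.eq_or_lt with h | h
      · rw [← h, zero_mul, Real.zero_rpow (by linarith [hα.2])]
      · rw [sub_eq_add_neg, Real.rpow_add h, Real.rpow_one]
    rw [this]
    ring
  rw [integral_sub ((intervalIntegrable_rpow' (by linarith [hα.2])).const_mul _)
    ((intervalIntegrable_rpow' (by linarith [hα.2])).const_mul _),
    intervalIntegral.integral_const_mul, intervalIntegral.integral_const_mul,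
    integral_rpow (Or.inl (by linarith [hα.2])),
    integral_rpow (Or.inl (by linarith [hα.2])), Real.zero_rpow (by linarith [hα.2]),
    Real.zero_rpow (by linarith [hα.2])] at h2
  have h3 : ((1 - α / 2) * τ) ^ (1 - α + 1) = (1 - α / 2) * τ * ((1 - α / 2) * τ) ^ (-α + 1) := by
    rw [show 1 - α + 1 = 1 + (-α + 1) by ring, Real.rpow_add hL, Real.rpow_one]
  calc _ = _ := integral_congr fun r _ => by ring_nf
    _ = _ := h1
    _ = _ := h2
    _ = 0 := by
      rw [h3]
      have : -α + 1 ≠ 0 := by linarith [hα.2]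
      have : 1 - α + 1 ≠ 0 := by linarith [hα.2]
      have : Real.Gamma (1 - α) ≠ 0 := (Real.Gamma_pos_of_pos (by linarith [hα.2])).ne'
      field_simp
      ring

lemma intervalIntegrable_fracKernel_sub {α : ℝ} (hα : α < 1) (x a b : ℝ) :
    IntervalIntegrable (fun r => fracKernel (1 - α) (x - r)) volume a b := by
  have := ((intervalIntegrable_rpow' (a := x - a) (b := x - b) (r := -α)
    (by linarith)).div_const (Real.Gamma (1 - α))).comp_sub_left x
  simpa [fracKernel_eq] using this

/-- The local quantity `(τ_k / t_k)^3 t_k^σ` controlling the interpolation errors. -/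
noncomputable def localSize (σ : ℝ) (t : ℕ → ℝ) (k : ℕ) : ℝ := (step t k / t k) ^ 3 * t k ^ σ

/-- The derivative of the quadratic interpolant integrates to the history terms. -/
lemma integral_kernel_interpolant {κ : ℝ → ℝ} (hκ : Continuous κ) (t v : ℕ → ℝ) (k : ℕ) :
    ∫ r in (t (k - 1))..(t k), κ r * (nabla v k / step t k
        + 2 * (r - (t (k - 1) + t k) / 2) / (step t k * (step t k + step t (k + 1)))
          * (ratio t k * nabla v (k + 1) - nabla v k))
      = histMean κ t k * nabla v k
        + histSlope κ t k * (ratio t k * nabla v (k + 1) - nabla v k) := by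
  rw [histMean, histSlope, ← intervalIntegral.integral_mul_const,
    mul_assoc, mul_comm (∫ r in (t (k - 1))..(t k), κ r), ← mul_assoc,
    ← intervalIntegral.integral_const_mul, ← intervalIntegral.integral_add
      (by apply Continuous.intervalIntegrable; fun_prop)
      (by apply Continuous.intervalIntegrable; fun_prop)]
  exact integral_congr fun r _ => by ring

/-- Comparability of neighbouring nodes and steps, as provided by M2. -/
structure IsComparable (Cγ : ℝ) (N : ℕ) (t : ℕ → ℝ) : Prop where
  one_le : 1 ≤ Cγ
  node_le : ∀ k, 1 ≤ k → k < N → t (k + 1) ≤ Cγ * t k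
  step_le : ∀ k, 1 ≤ k → k < N → step t (k + 1) ≤ Cγ * step t k

/-- The interpolant of `v` at three consecutive nodes, on the `k`-th mesh interval. -/
noncomputable def quadInterp (t : ℕ → ℝ) (v : ℝ → ℝ) (k : ℕ) (r : ℝ) : ℝ :=
  v (t (k - 1)) + (r - t (k - 1)) * (nabla (fun j => v (t j)) k / step t k)
    + (r - t (k - 1)) * (r - t k) * ((ratio t k * nabla (fun j => v (t j)) (k + 1)
      - nabla (fun j => v (t j)) k) / (step t k * (step t k + step t (k + 1))))

lemma hasDerivAt_quadInterp (t : ℕ → ℝ) (v : ℝ → ℝ) (k : ℕ) (r : ℝ) :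
    HasDerivAt (quadInterp t v k) (nabla (fun j => v (t j)) k / step t k
        + 2 * (r - (t (k - 1) + t k) / 2) / (step t k * (step t k + step t (k + 1)))
          * (ratio t k * nabla (fun j => v (t j)) (k + 1) - nabla (fun j => v (t j)) k)) r := by
  have h1 := ((hasDerivAt_id' r).sub_const (t (k - 1))).mul_const
    (nabla (fun j => v (t j)) k / step t k)
  have h2 := (((hasDerivAt_id' r).sub_const (t (k - 1))).fun_mul
    ((hasDerivAt_id' r).sub_const (t k))).mul_const ((ratio t k * nabla (fun j => v (t j)) (k + 1)
      - nabla (fun j => v (t j)) k) / (step t k * (step t k + step t (k + 1))))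
  refine ((h1.const_add (v (t (k - 1)))).fun_add h2).congr_deriv ?_
  ring

lemma quadInterp_left (t : ℕ → ℝ) (v : ℝ → ℝ) (k : ℕ) :
    quadInterp t v k (t (k - 1)) = v (t (k - 1)) := by
  simp [quadInterp]

lemma quadInterp_right {t : ℕ → ℝ} (v : ℝ → ℝ) {k : ℕ} (hk : step t k ≠ 0) :
    quadInterp t v k (t k) = v (t k) := by
  rw [quadInterp, show t k - t (k - 1) = step t k from rfl]
  simp only [nabla]
  field_simp
  ring

namespace IsFastMesh

variable {α T ε σ K Cγ : ℝ} {N : ℕ} {t : ℕ → ℝ} {Nq : ℕ} {s w : Fin Nq → ℝ}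
  (h : IsFastMesh α T ε N t s w) (hc : IsComparable Cγ N t)
  {v v1 v2 v3 : ℝ → ℝ} (hv : TimeReg σ K T v v1 v2 v3)
include h

/-- The error of a history term is the interpolation error tested with the derivative of the
kernel. -/
lemma history_error_eq {v v1 : ℝ → ℝ} {k : ℕ} (hk : 1 ≤ k) (hkN : k < N)
    (x : ℝ) (hv : ContinuousOn v (Set.Icc (t (k - 1)) (t k)))
    (hd : ∀ r ∈ Set.Ioo (t (k - 1)) (t k), HasDerivAt v (v1 r) r)
    (hv1 : IntervalIntegrable v1 volume (t (k - 1)) (t k)) :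
    histMean (soeKernel s w x) t k * nabla (fun j => v (t j)) k
        + histSlope (soeKernel s w x) t k
          * (ratio t k * nabla (fun j => v (t j)) (k + 1) - nabla (fun j => v (t j)) k)
        - ∫ r in (t (k - 1))..(t k), soeKernel s w x r * v1 r
      = -∫ r in (t (k - 1))..(t k), soeKernelDeriv s w x r * (quadInterp t v k r - v r) := by
  rw [← integral_kernel_interpolant (h.convexKernel x).continuous]
  exact (h.convexKernel x).integral_sub_eq (h.mesh.increasing k hk hkN.le).le
    (hasDerivAt_quadInterp t v k) (by fun_prop) hv hd hv1 (quadInterp_left t v k)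
    (quadInterp_right v (h.step_pos hk hkN.le).ne')

include hc in
lemma rpow_node_le (hK : 0 ≤ K) (hσ : σ < 3) {k : ℕ} (hk : 2 ≤ k) (hkN : k ≤ N) {y : ℝ}
    (hy : t (k - 1) ≤ y) : K * y ^ (σ - 3) ≤ K * Cγ ^ (3 - σ) * t k ^ (σ - 3) := by
  obtain ⟨j, rfl⟩ : ∃ j, k = j + 1 := ⟨k - 1, by omega⟩
  rw [Nat.add_sub_cancel] at hy
  have h1 := h.mesh.pos (k := j) (by omega) (by omega)
  have h2 := h.mesh.pos (k := j + 1) (by omega) (by omega)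
  have h3 := hc.node_le j (by omega) (by omega)
  have hC := hc.one_le
  rw [mul_assoc]
  gcongr
  calc y ^ (σ - 3) ≤ (t (j + 1) / Cγ) ^ (σ - 3) := by
        refine Real.rpow_le_rpow_of_nonpos (by positivity) ?_ (by linarith)
        rw [div_le_iff₀ (by positivity)]
        nlinarith
    _ = _ := by
        rw [Real.div_rpow h2.le (by positivity), div_eq_inv_mul, ← Real.rpow_neg (by positivity)]
        ring_nf

include hc hv in
-- The interpolation error carries the factor (r - t_{k-1})(t_k - r), so testing it with κ' produces
-- the bubble integral, which `weight_diff_ge` bounds by a weight difference times τ_k². The error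
-- is thus measured by the same differences that occur in the discrete derivative, and a barrier can
-- absorb it.
lemma history_error_le (hK : 0 ≤ K) (hσ : σ < 3) {n k : ℕ} (hk : 2 ≤ k) (hkn : k < n)
    (hn : n ≤ N) :
    |histMean (soeKernel s w (offTime (α / 2) t n)) t k * nabla (fun j => v (t j)) k
        + histSlope (soeKernel s w (offTime (α / 2) t n)) t k
          * (ratio t k * nabla (fun j => v (t j)) (k + 1) - nabla (fun j => v (t j)) k)
        - ∫ r in (t (k - 1))..(t k), soeKernel s w (offTime (α / 2) t n) r * v1 r|
      ≤ 3 / 2 * (K * Cγ ^ (3 - σ)) * (1 + Cγ)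
        * ((weight α t s w n (k + 1) - weight α t s w n k) * localSize σ t k) := by
  set x := offTime (α / 2) t n
  have hpos := h.mesh.pos (k := k - 1) (by omega) (by omega)
  have hkpos := h.mesh.pos (k := k) (by omega) (by omega)
  have hkT := h.mesh.le_horizon (k := k) (by omega)
  have hk1T := h.mesh.le_horizon (k := k + 1) (by omega)
  have hlt := h.mesh.increasing k (by omega) (by omega)
  have hs := h.step_pos (k := k) (by omega) (by omega)
  have hs1 := h.step_pos (k := k + 1) (by omega) (by omega)
  have hsub : Set.Icc (t (k - 1)) (t k) ⊆ Set.Ioc 0 T := fun y hy =>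
    ⟨hpos.trans_le hy.1, hy.2.trans hkT⟩
  have hsub' : Set.Ioo (t (k - 1)) (t k) ⊆ Set.Ioo 0 T := fun y hy =>
    ⟨hpos.trans hy.1, hy.2.trans_le hkT⟩
  rw [h.history_error_eq (by omega) (by omega) x (hv.c0.mono hsub) (fun r hr => hv.d0 r (hsub' hr))
    ((hv.c1.mono hsub).intervalIntegrable_of_Icc hlt.le), abs_neg]
  have hKx := h.convexKernel x
  set V := K * Cγ ^ (3 - σ) * t k ^ (σ - 3) with hV
  have hC := hc.one_le
  have hV0 : 0 ≤ V := by positivity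
  have e1 : step t k = t k - t (k - 1) := rfl
  have e2 : step t (k + 1) = t (k + 1) - t k := rfl
  -- The interpolation error vanishes at both end points, and its second derivative is a second
  -- divided difference minus v''.
  have hη : ∀ r ∈ Set.Icc (t (k - 1)) (t k), |quadInterp t v k r - v r|
      ≤ 3 * V * (step t k + step t (k + 1)) / 2 * ((r - t (k - 1)) * (t k - r)) := by
    intro r hr
    refine abs_le_of_vanishing_endpoints (f := fun r => quadInterp t v k r - v r)
      (f1 := fun r => nabla (fun j => v (t j)) k / step t k
        + 2 * (r - (t (k - 1) + t k) / 2) / (step t k * (step t k + step t (k + 1)))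
          * (ratio t k * nabla (fun j => v (t j)) (k + 1) - nabla (fun j => v (t j)) k) - v1 r)
      (f2 := fun r => 2 * (((v (t k + step t (k + 1)) - v (t k)) / step t (k + 1)
        - (v (t k) - v (t k - step t k)) / step t k) / (step t k + step t (k + 1))) - v2 r)
      ?_ ?_ ?_ ?_ ?_ ?_ hr
    · exact ContinuousOn.sub
        (fun r _ => (hasDerivAt_quadInterp t v k r).continuousAt.continuousWithinAt)
        (hv.c0.mono hsub)
    · exact fun y hy => (hasDerivAt_quadInterp t v k y).fun_sub (hv.d0 y (hsub' hy))
    · intro y hy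
      refine ((((((hasDerivAt_id' y).sub_const ((t (k - 1) + t k) / 2)).const_mul 2).div_const
        (step t k * (step t k + step t (k + 1)))).mul_const
          (ratio t k * nabla (fun j => v (t j)) (k + 1) - nabla (fun j => v (t j)) k)).const_add
            (nabla (fun j => v (t j)) k / step t k)).fun_sub (hv.d1 y (hsub' hy)) |>.congr_deriv ?_
      have a1 : t k + step t (k + 1) = t (k + 1) := by rw [e2]; ring
      have a2 : t k - step t k = t (k - 1) := by rw [e1]; ring
      rw [a1, a2]
      simp only [nabla, ratio, Nat.add_sub_cancel]
      field_simp
    · simp [quadInterp_left]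
    · simp [quadInterp_right v hs.ne']
    · intro y hy
      have a2 : t k - step t k = t (k - 1) := by rw [e1]; ring
      refine hv.second_quotient hs hs1 (by rw [a2]; exact hpos) (by rw [e2]; linarith) hV0 ?_
        ⟨by rw [a2]; exact hy.1.le, hy.2.le⟩
      intro z hz
      rw [a2] at hz
      exact (hv.b3 z ⟨hpos.trans hz.1, by rw [e2] at hz; linarith [hz.2]⟩).trans
        (h.rpow_node_le hc hK hσ hk (by omega) hz.1.le)
  have hb : |∫ r in (t (k - 1))..(t k), soeKernelDeriv s w x r * (quadInterp t v k r - v r)|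
      ≤ 3 * V * (step t k + step t (k + 1)) / 2
        * bubble (soeKernelDeriv s w x) (t (k - 1)) (t k) := by
    rw [bubble, ← intervalIntegral.integral_const_mul]
    have := hKx.cont
    refine abs_integral_le_of_abs_le hlt.le (by apply Continuous.intervalIntegrable; fun_prop) ?_
    intro r hr
    rw [abs_mul, abs_of_nonneg (hKx.nonneg r)]
    have := mul_le_mul_of_nonneg_left (hη r (Set.Ioo_subset_Icc_self hr)) (hKx.nonneg r)
    linarith
  refine hb.trans ?_
  have hd := h.weight_diff_ge (n := n) (by omega) hkn hn
  rw [div_le_iff₀ (by positivity)] at hd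
  have hst := hc.step_le k (by omega) (by omega)
  have hd0 := h.weight_mono hkn hn
  have hb0 := h.bubble_nonneg (k := k) (by omega) (by omega) x
  set d := weight α t s w n (k + 1) - weight α t s w n k
  have hpow : t k ^ (σ - 3) * t k ^ 3 = t k ^ σ := by
    rw [← Real.rpow_natCast, ← Real.rpow_add hkpos]
    norm_num
  calc 3 * V * (step t k + step t (k + 1)) / 2 * bubble (soeKernelDeriv s w x) (t (k - 1)) (t k)
      ≤ 3 * V * (step t k + Cγ * step t k) / 2 * (d * step t k ^ 2) := by gcongr
    _ = _ := by
        rw [hV, localSize, ← hpow]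
        field_simp

/-- In the first interval v'' may be unbounded. After removal of a slope p the values of v vary by
at most D, and a supremum bound on the interpolation error, integrated against κ', gives the
increment of κ, which `weight_diff_one_ge` controls. -/
lemma history_error_one_le {v v1 : ℝ → ℝ} {p D : ℝ} {n : ℕ} (hn2 : 2 ≤ n) (hn : n ≤ N)
    (hv : ContinuousOn v (Set.Icc 0 (t 1))) (hd : ∀ r ∈ Set.Ioo 0 (t 1), HasDerivAt v (v1 r) r)
    (hv1 : IntervalIntegrable v1 volume 0 (t 1))
    (hD : ∀ r ∈ Set.Icc 0 (t 2), |v r - v 0 - p * r| ≤ D) :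
    |histMean (soeKernel s w (offTime (α / 2) t n)) t 1 * nabla (fun j => v (t j)) 1
        + histSlope (soeKernel s w (offTime (α / 2) t n)) t 1
          * (ratio t 1 * nabla (fun j => v (t j)) (1 + 1) - nabla (fun j => v (t j)) 1)
        - ∫ r in (t 0)..(t 1), soeKernel s w (offTime (α / 2) t n) r * v1 r|
      ≤ 14 * D * (weight α t s w n 2 - weight α t s w n 1) := by
  set x := offTime (α / 2) t n
  have h0 := h.mesh.start
  have h1pos := h.mesh.pos (k := 1) (by omega) (by omega)
  have e := h.history_error_eq (k := 1) le_rfl (by omega) x (v := v) (v1 := v1)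
    (by rwa [Nat.sub_self, h0]) (by rwa [Nat.sub_self, h0]) (by rwa [Nat.sub_self, h0])
  rw [Nat.sub_self] at e
  rw [e, abs_neg]
  have hKx := h.convexKernel x
  have hs := h.step_pos (k := 1) (by omega) (by omega)
  have hs1 := h.step_pos (k := 2) (by omega) (by omega)
  have hlt := h.mesh.increasing 2 (by omega) (by omega)
  have e1 : step t 1 = t 1 := by rw [step, Nat.sub_self, h0, sub_zero]
  have e2 : t 2 = t 1 + step t 2 := by rw [step]; ring_nf
  have hD1 := hD (t 1) ⟨h1pos.le, by linarith⟩
  have hD2 := hD (t 2) ⟨by linarith, le_rfl⟩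
  have hD0 : 0 ≤ D := (abs_nonneg _).trans hD1
  set R : ℝ → ℝ := fun r => v r - v 0 - p * r with hR
  have hρ := h.ratio_le (k := 1) le_rfl (by omega)
  have hρ0 := h.ratio_nonneg (k := 1) le_rfl (by omega)
  have hη : ∀ r ∈ Set.Icc 0 (t 1), |quadInterp t v 1 r - v r| ≤ 7 * D := by
    intro r hr
    have hDr := hD r ⟨hr.1, by linarith [hr.2]⟩
    set y := step t 1
    set z := step t 2
    -- Affine functions are reproduced, so only R = v - v(0) - p r enters. With ρ_1 ≤ 7/4 the three
    -- terms are at most D, (7/2 + 1)D and D, which 7D covers.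
    have id : quadInterp t v 1 r - v r = r / y * R (t 1)
        + (r / y) * ((r - y) / (y + z)) * (y / z * (R (t 2) - R (t 1)) - R (t 1)) - R r := by
      rw [quadInterp]
      simp only [nabla, ratio, Nat.sub_self, hR, h0, e2, show 1 + 1 = 2 from rfl]
      rw [← e1, show step t 1 = y from rfl, show step t 2 = z from rfl]
      field_simp
      ring
    have a1 : |r / y| ≤ 1 := by
      rw [abs_div, abs_of_pos hs, div_le_one hs, abs_of_nonneg hr.1, e1]
      exact hr.2
    have a2 : |(r - y) / (y + z)| ≤ 1 := by
      rw [abs_div, abs_of_pos (by linarith : 0 < y + z), div_le_one (by linarith), abs_le]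
      constructor
      · linarith [hr.1]
      · linarith [hr.2]
    have a3 : |y / z| ≤ 7 / 4 := by
      rw [show y / z = ratio t 1 from rfl, abs_of_nonneg hρ0]
      exact hρ
    have b1 : |r / y * R (t 1)| ≤ 1 * D := by rw [abs_mul]; gcongr
    have b2 : |y / z * (R (t 2) - R (t 1)) - R (t 1)| ≤ 7 / 4 * (D + D) + D := by
      refine (abs_sub _ _).trans (add_le_add ?_ hD1)
      rw [abs_mul]
      gcongr
      exact (abs_sub _ _).trans (add_le_add hD2 hD1)
    have b3 : |(r / y) * ((r - y) / (y + z)) * (y / z * (R (t 2) - R (t 1)) - R (t 1))|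
        ≤ 1 * 1 * (7 / 4 * (D + D) + D) := by
      rw [abs_mul, abs_mul]
      gcongr
    rw [id]
    refine (abs_sub _ _).trans ?_
    have := abs_add_le (r / y * R (t 1))
      ((r / y) * ((r - y) / (y + z)) * (y / z * (R (t 2) - R (t 1)) - R (t 1)))
    linarith
  have hb : |∫ r in (t 0)..(t 1), soeKernelDeriv s w x r * (quadInterp t v 1 r - v r)|
      ≤ 7 * D * (soeKernel s w x (t 1) - soeKernel s w x (t 0)) := by
    rw [← integral_eq_sub_of_hasDerivAt (fun r _ => hKx.hasDerivAt r)
      (hKx.cont.intervalIntegrable _ _), ← intervalIntegral.integral_const_mul]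
    have := hKx.cont
    refine abs_integral_le_of_abs_le (by linarith)
      (by apply Continuous.intervalIntegrable; fun_prop) ?_
    intro r hr
    rw [h0] at hr
    rw [abs_mul, abs_of_nonneg (hKx.nonneg r)]
    have := mul_le_mul_of_nonneg_left (hη r (Set.Ioo_subset_Icc_self hr)) (hKx.nonneg r)
    linarith
  refine hb.trans ?_
  have := mul_le_mul_of_nonneg_left (h.weight_diff_one_ge hn2 hn) (by linarith : 0 ≤ 14 * D)
  linarith

end IsFastMesh

end TFBS

/-! ### Consistency of the local part, including the singular first step. -/

namespace TFBS

open Finset intervalIntegral MeasureTheory Filter Topology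

lemma TimeReg.intervalIntegrable_caputo {α σ K T C : ℝ} {v v1 v2 v3 : ℝ → ℝ} (hα : α < 1)
    (hσ0 : 0 < σ) (hv : TimeReg σ K T v v1 v2 v3)
    (hC : ∀ t ∈ Set.Ioc 0 T, |v1 t| ≤ C * t ^ (min σ 1 - 1)) {x : ℝ} (hx : 0 < x) (hxT : x ≤ T) :
    IntervalIntegrable (fun r => fracKernel (1 - α) (x - r) * v1 r) volume 0 x := by
  have hG : 0 < Real.Gamma (1 - α) := Real.Gamma_pos_of_pos (by linarith)
  have hσ' : 0 < min σ 1 := lt_min hσ0 one_pos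
  refine intervalIntegrable_of_abs_le hx.le ?_
    ((intervalIntegrable_beta (p := -α) (q := min σ 1 - 1) (by linarith) (by linarith) hx).const_mul
      (C / Real.Gamma (1 - α))) ?_
  · refine ContinuousOn.mul ?_ (hv.c1.mono fun y hy => ⟨hy.1, hy.2.le.trans hxT⟩)
    simp only [fracKernel_eq]
    refine ContinuousOn.div_const (ContinuousOn.rpow_const (by fun_prop) fun y hy => Or.inl ?_) _
    linarith [hy.2]
  · intro r hr
    rw [abs_mul, fracKernel_eq, abs_of_nonneg (by
      have : 0 ≤ x - r := by linarith [hr.2]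
      positivity)]
    have h1 := hC r ⟨hr.1, hr.2.le.trans hxT⟩
    have h2 : 0 ≤ (x - r) ^ (-α) := Real.rpow_nonneg (by linarith [hr.2]) _
    calc _ ≤ (x - r) ^ (-α) / Real.Gamma (1 - α) * (C * r ^ (min σ 1 - 1)) := by gcongr
      _ = _ := by ring

lemma caputo_eq {α T x : ℝ} {v v1 : ℝ → ℝ} (hd : ∀ t ∈ Set.Ioo 0 T, HasDerivAt v (v1 t) t)
    (hx : 0 ≤ x) (hxT : x < T) :
    caputo α v x = ∫ r in (0 : ℝ)..x, fracKernel (1 - α) (x - r) * v1 r := by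
  rw [caputo]
  refine integral_congr_ae (ae_of_all _ fun r hr => ?_)
  rw [Set.uIoc_of_le hx] at hr
  rw [(hd r ⟨hr.1, hr.2.trans_lt hxT⟩).deriv]

namespace IsFastMesh

variable {α T ε σ K Cγ : ℝ} {N : ℕ} {t : ℕ → ℝ} {Nq : ℕ} {s w : Fin Nq → ℝ}
  (h : IsFastMesh α T ε N t s w) (hc : IsComparable Cγ N t)
  {v v1 v2 v3 : ℝ → ℝ} (hv : TimeReg σ K T v v1 v2 v3)
include h

lemma integral_local {n : ℕ} (h1 : 1 ≤ n) (hn : n ≤ N) :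
    ∫ r in (t (n - 1))..(offTime (α / 2) t n), fracKernel (1 - α) (offTime (α / 2) t n - r)
      = step t n * localCoeff α t n := by
  have := h.step_pos h1 hn
  rw [localCoeff]
  field_simp

lemma offTime_gt {n : ℕ} (h1 : 1 ≤ n) (hn : n ≤ N) : t (n - 1) < offTime (α / 2) t n := by
  have := offTime_sub (α / 2) t n
  have := h.step_off_pos h1 hn
  linarith

lemma offTime_lt {n : ℕ} (h1 : 1 ≤ n) (hn : n ≤ N) : offTime (α / 2) t n < t n := by
  have := h.mesh.increasing n h1 hn
  rw [offTime]
  nlinarith [h.order.1]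

lemma localCoeff_nonneg {n : ℕ} (h1 : 1 ≤ n) (hn : n ≤ N) : 0 ≤ localCoeff α t n := by
  rw [localCoeff_eq h.order (h.step_pos h1 hn)]
  have := fracKernel_pos h.order.2 (h.step_off_pos h1 hn)
  have : 0 < 1 - α := by linarith [h.order.2]
  have : 0 < 1 - α / 2 := by linarith
  positivity

include hc hv in
/-- Superconvergence of the local part at the off-set point. -/
lemma local_error_le (hK : 0 ≤ K) (hσ : σ < 3) {n : ℕ} (hn2 : 2 ≤ n) (hn : n ≤ N) :
    |localCoeff α t n * nabla (fun j => v (t j)) n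
        - ∫ r in (t (n - 1))..(offTime (α / 2) t n),
          fracKernel (1 - α) (offTime (α / 2) t n - r) * v1 r|
      ≤ 2 * (K * Cγ ^ (3 - σ)) * (weight α t s w n n * localSize σ t n) := by
  set x := offTime (α / 2) t n with hx
  have hs := h.step_pos (k := n) (by omega) hn
  have hpos := h.mesh.pos (k := n - 1) (by omega) (by omega)
  have hnpos := h.mesh.pos (k := n) (by omega) (by omega)
  have hnT := h.mesh.le_horizon hn
  have hlt := h.offTime_gt (n := n) (by omega) hn
  have hxt := h.offTime_lt (n := n) (by omega) hn
  have hlt' := h.mesh.increasing n (by omega) hn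
  have e1 : step t n = t n - t (n - 1) := rfl
  set τ := step t n
  have hC := hc.one_le
  set V := K * Cγ ^ (3 - σ) * t n ^ (σ - 3) with hV
  have hV0 : 0 ≤ V := by positivity
  set D := nabla (fun j => v (t j)) n / τ with hD
  have hIv : IntervalIntegrable v1 volume (t (n - 1)) x :=
    (hv.c1.mono fun y hy => ⟨hpos.trans_le hy.1, hy.2.trans (hxt.le.trans hnT)⟩
      : ContinuousOn v1 (Set.Icc (t (n - 1)) x)).intervalIntegrable_of_Icc hlt.le
  have hIω := intervalIntegrable_fracKernel_sub h.order.2 x (t (n - 1)) x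
  have hcont1 : ContinuousOn v1 (Set.uIcc (t (n - 1)) x) := by
    rw [Set.uIcc_of_le hlt.le]
    exact hv.c1.mono fun y hy => ⟨hpos.trans_le hy.1, hy.2.trans (hxt.le.trans hnT)⟩
  have hzero : ∫ r in (t (n - 1))..x, fracKernel (1 - α) (x - r) * (r - t (n - 1) - τ / 2) = 0 := by
    have := integral_fracKernel_moment h.order (x := x) hs
    rwa [show x - (1 - α / 2) * τ = t (n - 1) by
      have := offTime_sub (α / 2) t n
      linarith] at this
  -- Adding a multiple of the vanishing moment cancels the first-order part of the difference
  -- between D and v', and the integrand becomes O(τ²).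
  have id : localCoeff α t n * nabla (fun j => v (t j)) n
        - ∫ r in (t (n - 1))..x, fracKernel (1 - α) (x - r) * v1 r
      = ∫ r in (t (n - 1))..x, fracKernel (1 - α) (x - r)
          * (D - v1 r + v2 (t n) * (r - t (n - 1) - τ / 2)) := by
    have i1 : IntervalIntegrable (fun r => fracKernel (1 - α) (x - r) * D) volume (t (n - 1)) x :=
      hIω.mul_const _
    have i2 : IntervalIntegrable (fun r => fracKernel (1 - α) (x - r) * v1 r) volume
      (t (n - 1)) x := hIω.mul_continuousOn hcont1
    have i3 : IntervalIntegrable (fun r => v2 (t n) *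
        (fracKernel (1 - α) (x - r) * (r - t (n - 1) - τ / 2))) volume (t (n - 1)) x :=
      (hIω.mul_continuousOn (by fun_prop)).const_mul _
    have : ∫ r in (t (n - 1))..x, fracKernel (1 - α) (x - r)
          * (D - v1 r + v2 (t n) * (r - t (n - 1) - τ / 2))
        = ∫ r in (t (n - 1))..x, (fracKernel (1 - α) (x - r) * D
          - fracKernel (1 - α) (x - r) * v1 r
          + v2 (t n) * (fracKernel (1 - α) (x - r) * (r - t (n - 1) - τ / 2))) :=
      integral_congr fun r _ => by ring
    rw [this, intervalIntegral.integral_add (i1.sub i2) i3, intervalIntegral.integral_sub i1 i2,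
      intervalIntegral.integral_mul_const, intervalIntegral.integral_const_mul, hzero,
      h.integral_local (by omega) hn, hD]
    field_simp
    ring
  have hb3 : ∀ y ∈ Set.Ioo (t (n - 1)) (t n), |v3 y| ≤ V := fun y hy =>
    (hv.b3 y ⟨hpos.trans hy.1, hy.2.le.trans hnT⟩).trans
      (h.rpow_node_le hc hK hσ hn2 hn hy.1.le)
  have hcc : t n ∈ Set.Icc (t (n - 1)) (t n) := ⟨hlt'.le, le_rfl⟩
  have hpt : ∀ r ∈ Set.Ioo (t (n - 1)) x,
      |D - v1 r + v2 (t n) * (r - t (n - 1) - τ / 2)| ≤ 2 * V * τ ^ 2 := by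
    intro r hr
    obtain ⟨-, t1, -⟩ := hv.taylor hpos hnT hV0 hcc hb3 (x := r) ⟨hr.1.le, (hr.2.trans hxt).le⟩
    obtain ⟨-, -, t2⟩ := hv.taylor hpos hnT hV0 hcc hb3 (x := t (n - 1)) ⟨le_rfl, hlt'.le⟩
    set E1 := v1 r - v1 (t n) - v2 (t n) * (r - t n)
    set E2 := v (t (n - 1)) - v (t n) - v1 (t n) * (t (n - 1) - t n)
      - v2 (t n) / 2 * (t (n - 1) - t n) ^ 2 with hE2
    have t1' : |E1| ≤ V * τ ^ 2 := t1.trans (by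
      gcongr
      rw [abs_le]
      constructor <;> linarith [hr.1, hr.2])
    have t2' : |E2 / τ| ≤ V * τ ^ 2 := by
      rw [abs_div, abs_of_pos hs, div_le_iff₀ hs]
      refine t2.trans (le_of_eq ?_)
      rw [abs_sub_comm, ← e1, abs_of_pos hs]
      ring
    have : D - v1 r + v2 (t n) * (r - t (n - 1) - τ / 2) = -(E2 / τ) - E1 := by
      have ht : t (n - 1) = t n - τ := by rw [e1]; ring
      rw [hD, nabla, hE2]
      rw [ht]
      field_simp
      ring
    rw [this]
    refine (abs_sub _ _).trans ?_
    rw [abs_neg]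
    linarith
  have hb : |∫ r in (t (n - 1))..x, fracKernel (1 - α) (x - r)
          * (D - v1 r + v2 (t n) * (r - t (n - 1) - τ / 2))|
      ≤ ∫ r in (t (n - 1))..x, fracKernel (1 - α) (x - r) * (2 * V * τ ^ 2) := by
    refine abs_integral_le_of_abs_le hlt.le (hIω.mul_const _) fun r hr => ?_
    have : 0 < fracKernel (1 - α) (x - r) := fracKernel_pos h.order.2 (by linarith [hr.2])
    rw [abs_mul, abs_of_pos this]
    have := hpt r hr
    gcongr
  rw [id]
  refine hb.trans ?_
  rw [intervalIntegral.integral_mul_const, h.integral_local (by omega) hn]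
  have hw := h.localCoeff_le_weight (n := n) (by omega) hn
  have hw0 := h.localCoeff_nonneg (n := n) (by omega) hn
  have hpow : t n ^ (σ - 3) * t n ^ 3 = t n ^ σ := by
    rw [← Real.rpow_natCast, ← Real.rpow_add hnpos]
    norm_num
  calc τ * localCoeff α t n * (2 * V * τ ^ 2) ≤ τ * weight α t s w n n * (2 * V * τ ^ 2) := by gcongr
    _ = _ := by
        rw [hV, localSize, ← hpow, show step t n = τ from rfl]
        field_simp

/-- No regularity beyond v' is used in the first step. Subtracting p leaves a singular integrand
whose integral is a Beta integral; its scaling gives t_1^(σ-α), which is comparable with the local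
coefficient times t_1^σ. -/
lemma local_error_one_le {v v1 : ℝ → ℝ} (hσ : σ ∈ Set.Ioo (0 : ℝ) 1 ∪ Set.Ioo (1 : ℝ) 2)
    {C p : ℝ} (hC0 : 0 ≤ C) (hN : 1 ≤ N)
    (hint : IntervalIntegrable (fun r => fracKernel (1 - α) (offTime (α / 2) t 1 - r) * v1 r) volume
      0 (offTime (α / 2) t 1))
    (hp : ∀ r ∈ Set.Ioc 0 (t 1), |v1 r - p| ≤ C * (t 1 ^ (σ - min σ 1) * r ^ (min σ 1 - 1)))
    (hD : |v (t 1) - v 0 - p * t 1| ≤ C * t 1 ^ σ) :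
    |localCoeff α t 1 * nabla (fun j => v (t j)) 1
        - ∫ r in (t 0)..(offTime (α / 2) t 1),
          fracKernel (1 - α) (offTime (α / 2) t 1 - r) * v1 r|
      ≤ C * (1 + ∫ y in (0 : ℝ)..1, (1 - y) ^ (-α) * y ^ (min σ 1 - 1))
        * (weight α t s w 1 1 * localSize σ t 1) := by
  set x := offTime (α / 2) t 1 with hx
  set B := ∫ y in (0 : ℝ)..1, (1 - y) ^ (-α) * y ^ (min σ 1 - 1) with hB
  have hσ0 : 0 < σ := by rcases hσ with h | h <;> linarith [h.1]
  have hσ' : 0 < min σ 1 := lt_min hσ0 one_pos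
  have h0 := h.mesh.start
  have hs := h.step_pos (k := 1) le_rfl hN
  have h1pos := h.mesh.pos (k := 1) le_rfl hN
  have e1 : step t 1 = t 1 := by rw [step, Nat.sub_self, h0, sub_zero]
  have hα := h.order
  have hx1 : x = (1 - α / 2) * t 1 := by rw [hx, offTime, Nat.sub_self, h0]; ring
  have hθ : 0 < 1 - α / 2 := by linarith [hα.2]
  have hxpos : 0 < x := by rw [hx1]; positivity
  have hxt : x < t 1 := h.offTime_lt le_rfl hN
  have hG : 0 < Real.Gamma (1 - α) := Real.Gamma_pos_of_pos (by linarith [hα.2])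
  have hB0 : 0 ≤ B := by
    refine integral_nonneg zero_le_one fun y hy => ?_
    have : 0 ≤ 1 - y := by linarith [hy.2]
    have := hy.1
    positivity
  have hIω := intervalIntegrable_fracKernel_sub hα.2 x 0 x
  have hloc := h.integral_local (n := 1) le_rfl hN
  rw [Nat.sub_self, h0, e1, ← hx] at hloc
  have ha := h.localCoeff_nonneg (n := 1) le_rfl hN
  set a := localCoeff α t 1 with hadef
  set D := nabla (fun j => v (t j)) 1 / t 1 with hDdef
  have hDp : |D - p| ≤ C * t 1 ^ σ / t 1 := by
    have : D - p = (v (t 1) - v 0 - p * t 1) / t 1 := by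
      rw [hDdef, nabla, Nat.sub_self, h0]
      field_simp
    rw [this, abs_div, abs_of_pos h1pos]
    gcongr
  have id : a * nabla (fun j => v (t j)) 1 - ∫ r in (t 0)..x, fracKernel (1 - α) (x - r) * v1 r
      = (D - p) * (t 1 * a) - ∫ r in (0 : ℝ)..x, (fracKernel (1 - α) (x - r) * v1 r
          - fracKernel (1 - α) (x - r) * p) := by
    rw [intervalIntegral.integral_sub hint (hIω.mul_const _), intervalIntegral.integral_mul_const,
      hloc, h0, hDdef]
    field_simp
    ring
  have hbeta := intervalIntegrable_beta (p := -α) (q := min σ 1 - 1) (by linarith [hα.2])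
    (by linarith) hxpos
  have hb : |∫ r in (0 : ℝ)..x, (fracKernel (1 - α) (x - r) * v1 r
          - fracKernel (1 - α) (x - r) * p)|
      ≤ ∫ r in (0 : ℝ)..x, C * t 1 ^ (σ - min σ 1) / Real.Gamma (1 - α)
        * ((x - r) ^ (-α) * r ^ (min σ 1 - 1)) := by
    refine abs_integral_le_of_abs_le hxpos.le (hbeta.const_mul _) fun r hr => ?_
    have hpos : 0 < fracKernel (1 - α) (x - r) := fracKernel_pos h.order.2 (by linarith [hr.2])
    rw [← mul_sub, abs_mul, abs_of_pos hpos]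
    calc _ ≤ fracKernel (1 - α) (x - r) * (C * (t 1 ^ (σ - min σ 1) * r ^ (min σ 1 - 1))) := by
          have := hp r ⟨hr.1, (hr.2.trans hxt).le⟩
          gcongr
      _ = _ := by rw [fracKernel_eq]; ring
  rw [intervalIntegral.integral_const_mul, integral_beta_scale _ _ hxpos, ← hB] at hb
  have hxa : x ^ (-α) / Real.Gamma (1 - α) ≤ a := by
    rw [hadef, localCoeff_eq hα hs, fracKernel_eq, e1, ← hx1]
    have : 1 ≤ (1 - α / 2) / (1 - α) := by
      rw [le_div_iff₀ (by linarith [hα.2])]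
      linarith [hα.1]
    exact le_mul_of_one_le_left (by positivity) this
  have hb2 : C * t 1 ^ (σ - min σ 1) / Real.Gamma (1 - α)
      * (x ^ (-α + (min σ 1 - 1) + 1) * B) ≤ C * B * (a * t 1 ^ σ) := by
    have e2 : x ^ (-α + (min σ 1 - 1) + 1) = x ^ (-α) * x ^ (min σ 1) := by
      rw [← Real.rpow_add hxpos]; ring_nf
    have e3 : t 1 ^ (σ - min σ 1) * t 1 ^ (min σ 1) = t 1 ^ σ := by
      rw [← Real.rpow_add h1pos]; ring_nf
    have e4 : x ^ (min σ 1) ≤ t 1 ^ (min σ 1) := Real.rpow_le_rpow hxpos.le hxt.le hσ'.le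
    calc _ = C * B * ((x ^ (-α) / Real.Gamma (1 - α)) * (t 1 ^ (σ - min σ 1) * x ^ (min σ 1))) := by
          rw [e2]; ring
      _ ≤ C * B * (a * (t 1 ^ (σ - min σ 1) * t 1 ^ (min σ 1))) := by gcongr
      _ = _ := by rw [e3]
  have hfin : |(D - p) * (t 1 * a)| ≤ C * (a * t 1 ^ σ) := by
    rw [abs_mul, abs_of_nonneg (by positivity : 0 ≤ t 1 * a)]
    calc _ ≤ C * t 1 ^ σ / t 1 * (t 1 * a) := by gcongr
      _ = _ := by field_simp
  have hw := h.localCoeff_le_weight (n := 1) le_rfl hN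
  have hg : localSize σ t 1 = t 1 ^ σ := by
    rw [localSize, e1, div_self h1pos.ne', one_pow, one_mul]
  rw [id, hg]
  calc _ ≤ C * (a * t 1 ^ σ) + C * B * (a * t 1 ^ σ) :=
        (abs_sub _ _).trans (add_le_add hfin (hb.trans hb2))
    _ = C * (1 + B) * (a * t 1 ^ σ) := by ring
    _ ≤ _ := by gcongr

end IsFastMesh

end TFBS

/-! ### Global consistency of the fast Alikhanov formula. -/

namespace TFBS

open Finset intervalIntegral MeasureTheory Filter Topology

lemma localSize_zero (σ : ℝ) (t : ℕ → ℝ) :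
    localSize σ t 0 = 0 := by
  simp [localSize, step]

/-- Global consistency of the fast Alikhanov formula, in convolution form. -/
theorem exists_temporal_truncation {α σ K Cγ T : ℝ}
    (hσ : σ ∈ Set.Ioo (0 : ℝ) 1 ∪ Set.Ioo (1 : ℝ) 2) (hK : 0 ≤ K) (hT : 0 < T) (hCγ : 1 ≤ Cγ) :
    ∃ C, 0 ≤ C ∧ ∀ (N : ℕ) (t : ℕ → ℝ) (Nq : ℕ) (s w : Fin Nq → ℝ) (ε : ℝ),
      IsFastMesh α T ε N t s w → IsComparable Cγ N t →
      ∀ v v1 v2 v3 : ℝ → ℝ, ContinuousOn v (Set.Icc 0 T) → TimeReg σ K T v v1 v2 v3 →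
      ∀ n, 1 ≤ n → n ≤ N →
        |fastAlikhanov α t s w (fun j => v (t j)) n - caputo α v (offTime (α / 2) t n)|
          ≤ C * (weight α t s w n n * localSize σ t n
            + ∑ k ∈ range n, (weight α t s w n (k + 1) - weight α t s w n k) * localSize σ t k
            + ε) := by
  have hσ0 : 0 < σ := by rcases hσ with h | h <;> linarith [h.1]
  have hσ2 : σ < 2 := by rcases hσ with h | h <;> linarith [h.2]
  have hσ' : 0 < min σ 1 := lt_min hσ0 one_pos
  obtain ⟨C0, hC00, hC0⟩ := exists_linear_approx hσ hK hT
  set B := ∫ y in (0 : ℝ)..1, (1 - y) ^ (-α) * y ^ (min σ 1 - 1) with hB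
  have hB0 : 0 ≤ B := by
    refine integral_nonneg zero_le_one fun y hy => ?_
    have : 0 ≤ 1 - y := by linarith [hy.2]
    have := hy.1
    positivity
  set Kc := K * Cγ ^ (3 - σ) with hKc
  have hKc0 : 0 ≤ Kc := by positivity
  set Cl := C0 * (1 + B) + 2 * Kc with hCl
  set Ch := 3 / 2 * Kc * (1 + Cγ) + 14 * (C0 * Cγ ^ σ) with hCh
  set Ce := C0 * (T ^ (min σ 1) / min σ 1) with hCe
  have hCl0 : 0 ≤ Cl := by positivity
  have hCh0 : 0 ≤ Ch := by positivity
  have hCe0 : 0 ≤ Ce := by positivity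
  refine ⟨Cl + Ch + Ce, by positivity, ?_⟩
  intro N t Nq s w ε h hc v v1 v2 v3 hvc hv n hn1 hn
  obtain ⟨hv1, hlin⟩ := hC0 v v1 v2 v3 hv
  obtain ⟨m, rfl⟩ : ∃ m, n = m + 1 := ⟨n - 1, by omega⟩
  set x := offTime (α / 2) t (m + 1) with hx
  have hx0 : t m < x := h.offTime_gt hn1 hn
  have hxt : x < t (m + 1) := h.offTime_lt hn1 hn
  have htm0 : 0 ≤ t m := h.mesh.nonneg (by omega)
  have htT : t (m + 1) ≤ T := h.mesh.le_horizon hn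
  have hxpos : 0 < x := htm0.trans_lt hx0
  have h0 := h.mesh.start
  have hα := h.order
  have hint := hv.intervalIntegrable_caputo hα.2 hσ0 hv1 hxpos (hxt.le.trans htT)
  have hintv : IntervalIntegrable (fun r : ℝ => C0 * r ^ (min σ 1 - 1)) volume 0 x :=
    (intervalIntegrable_rpow' (by linarith)).const_mul _
  have hintv1 : IntervalIntegrable v1 volume 0 x :=
    intervalIntegrable_of_abs_le hxpos.le
      (hv.c1.mono fun y hy => ⟨hy.1, hy.2.le.trans (hxt.le.trans htT)⟩) hintv
      (fun y hy => hv1 y ⟨hy.1, hy.2.le.trans (hxt.le.trans htT)⟩)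
  have hsubI : ∀ k ≤ m, ∀ l ≤ m, Set.uIcc (t k) (t l) ⊆ Set.uIcc 0 x := by
    intro k hk l hl
    rw [Set.uIcc_of_le hxpos.le]
    exact Set.uIcc_subset_Icc
      ⟨h.mesh.nonneg (by omega), (h.mesh.mono hk (by omega)).trans hx0.le⟩
      ⟨h.mesh.nonneg (by omega), (h.mesh.mono hl (by omega)).trans hx0.le⟩
  set κ := soeKernel s w x with hκ
  have hκc : Continuous κ := (h.convexKernel x).continuous
  have hcap : caputo α v x = ∑ k ∈ range m, (∫ r in (t k)..(t (k + 1)),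
      fracKernel (1 - α) (x - r) * v1 r) + ∫ r in (t m)..x, fracKernel (1 - α) (x - r) * v1 r := by
    rw [caputo_eq hv.d0 hxpos.le (hxt.trans_le htT), sum_integral_adjacent_intervals
      (fun k hk => hint.mono_set (hsubI k (by omega) (k + 1) (by omega))), h0,
      integral_add_adjacent_intervals (by
        have := hint.mono_set (hsubI 0 (by omega) m le_rfl)
        rwa [h0] at this) (hint.mono_set (by
          rw [Set.uIcc_of_le hx0.le, Set.uIcc_of_le hxpos.le]
          exact Set.Icc_subset_Icc_left htm0))]
  have hlocal : |localCoeff α t (m + 1) * nabla (fun j => v (t j)) (m + 1)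
      - ∫ r in (t m)..x, fracKernel (1 - α) (x - r) * v1 r|
      ≤ Cl * (weight α t s w (m + 1) (m + 1) * localSize σ t (m + 1)) := by
    have hpos : 0 ≤ weight α t s w (m + 1) (m + 1) * localSize σ t (m + 1) := by
      have := (h.localCoeff_nonneg hn1 hn).trans (h.localCoeff_le_weight hn1 hn)
      have := (h.step_pos hn1 hn)
      have := h.mesh.pos hn1 hn
      rw [localSize]
      positivity
    rcases Nat.eq_zero_or_pos m with hm | hm
    · subst hm
      obtain ⟨p, hp1, hp2⟩ := hlin (t 1) ⟨h.mesh.pos hn1 hn, htT⟩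
      have hD := abs_sub_initial_le hvc htT hp2 (h.mesh.pos hn1 hn)
        (r := t 1) ⟨(h.mesh.pos hn1 hn).le, le_rfl⟩
      refine (h.local_error_one_le hσ hC00 hn hint hp1 hD).trans ?_
      refine mul_le_mul_of_nonneg_right ?_ hpos
      rw [hCl]
      linarith
    · have := h.local_error_le hc hv hK (by linarith) (n := m + 1) (by omega) hn
      rw [Nat.add_sub_cancel] at this
      refine this.trans (mul_le_mul_of_nonneg_right ?_ hpos)
      rw [hCl]
      have : 0 ≤ C0 * (1 + B) := by positivity
      linarith
  have hhist : ∀ k ∈ range m,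
      |(histMean κ t (k + 1) * nabla (fun j => v (t j)) (k + 1)
        + histSlope κ t (k + 1) * (ratio t (k + 1) * nabla (fun j => v (t j)) (k + 2)
          - nabla (fun j => v (t j)) (k + 1)))
        - ∫ r in (t k)..(t (k + 1)), κ r * v1 r|
      ≤ Ch * ((weight α t s w (m + 1) (k + 1 + 1) - weight α t s w (m + 1) (k + 1))
        * localSize σ t (k + 1)) := by
    intro k hk
    have hkm := mem_range.1 hk
    have hpos : 0 ≤ (weight α t s w (m + 1) (k + 1 + 1) - weight α t s w (m + 1) (k + 1))
        * localSize σ t (k + 1) := by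
      have := h.weight_mono (n := m + 1) (k := k + 1) (by omega) hn
      have := h.step_pos (k := k + 1) (by omega) (by omega)
      have := h.mesh.pos (k := k + 1) (by omega) (by omega)
      rw [localSize]
      positivity
    rcases Nat.eq_zero_or_pos k with hk0 | hk0
    · subst hk0
      have ht2 : t 2 ∈ Set.Ioc 0 T :=
        ⟨h.mesh.pos (by omega) (by omega), h.mesh.le_horizon (by omega)⟩
      have ht1 := h.mesh.pos (k := 1) (by omega) (by omega)
      obtain ⟨p, -, hp2⟩ := hlin (t 2) ht2
      have hD := fun r hr => abs_sub_initial_le hvc ht2.2 hp2 ht2.1 (r := r) hr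
      have ht1T := h.mesh.le_horizon (k := 1) (by omega)
      have := h.history_error_one_le (v := v) (v1 := v1) (n := m + 1) (by omega) hn
        (hvc.mono (Set.Icc_subset_Icc_right ht1T))
        (fun r hr => hv.d0 r ⟨hr.1, hr.2.trans_le ht1T⟩)
        (by
          have := hintv1.mono_set (hsubI 0 (by omega) 1 (by omega))
          rwa [h0] at this) hD
      refine this.trans ?_
      have hg : localSize σ t 1 = t 1 ^ σ := by
        rw [localSize, show step t 1 = t 1 by rw [step, Nat.sub_self, h0, sub_zero],
          div_self ht1.ne', one_pow, one_mul]
      have hle : t 2 ^ σ ≤ Cγ ^ σ * t 1 ^ σ := by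
        rw [← Real.mul_rpow (by linarith) ht1.le]
        exact Real.rpow_le_rpow ht2.1.le (hc.node_le 1 le_rfl (by omega)) hσ0.le
      have hd := h.weight_mono (n := m + 1) (k := 1) (by omega) hn
      simp only [zero_add] at hpos ⊢
      rw [hg] at hpos ⊢
      norm_num at hd hpos ⊢
      set d := weight α t s w (m + 1) 2 - weight α t s w (m + 1) 1 with hd_def
      have hd' : 0 ≤ d := by rw [hd_def]; linarith
      calc 14 * (C0 * t 2 ^ σ) * d ≤ 14 * (C0 * (Cγ ^ σ * t 1 ^ σ)) * d := by gcongr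
        _ = 14 * (C0 * Cγ ^ σ) * (d * t 1 ^ σ) := by ring
        _ ≤ Ch * (d * t 1 ^ σ) := by
          refine mul_le_mul_of_nonneg_right ?_ hpos
          rw [hCh]
          have : 0 ≤ 3 / 2 * Kc * (1 + Cγ) := by positivity
          linarith
    · have := h.history_error_le hc hv hK (by linarith) (n := m + 1) (k := k + 1) (by omega)
        (by omega) hn
      rw [Nat.add_sub_cancel] at this
      refine this.trans (mul_le_mul_of_nonneg_right ?_ hpos)
      rw [hCh]
      have : 0 ≤ 14 * (C0 * Cγ ^ σ) := by positivity
      linarith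
  -- Replacing the power kernel by the exponential sum costs ε times the integral of |v'|, which is
  -- finite because min σ 1 - 1 > -1.
  have hsoe : ∀ k ∈ range m, |(∫ r in (t k)..(t (k + 1)), κ r * v1 r)
        - ∫ r in (t k)..(t (k + 1)), fracKernel (1 - α) (x - r) * v1 r|
      ≤ ∫ r in (t k)..(t (k + 1)), ε * (C0 * r ^ (min σ 1 - 1)) := by
    intro k hk
    have hkm := mem_range.1 hk
    have hs := hsubI k (by omega) (k + 1) (by omega)
    have hkt := h.mesh.increasing (k + 1) (by omega) (by omega)
    rw [Nat.add_sub_cancel] at hkt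
    rw [← intervalIntegral.integral_sub ((hintv1.mono_set hs).continuousOn_mul hκc.continuousOn)
      (hint.mono_set hs)]
    refine abs_integral_le_of_abs_le hkt.le ((hintv.mono_set hs).const_mul _) fun r hr => ?_
    have hk0 := h.mesh.nonneg (k := k) (by omega)
    have hk1 := h.mesh.mono (j := k + 1) (k := m) (by omega) (by omega)
    have h1 := h.kernel_le (n := m + 1) (by omega) hn (r := r) (hk0.trans hr.1.le)
      (hr.2.le.trans hk1)
    rw [← sub_mul, abs_mul, abs_sub_comm]
    have h2 := hv1 r ⟨hk0.trans_lt hr.1, by linarith [hr.2]⟩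
    have := h.tol_pos
    gcongr
  have hsoe_sum : ∑ k ∈ range m, ∫ r in (t k)..(t (k + 1)), ε * (C0 * r ^ (min σ 1 - 1))
      ≤ Ce * ε := by
    rw [sum_integral_adjacent_intervals (fun k hk =>
      (hintv.mono_set (hsubI k (by omega) (k + 1) (by omega))).const_mul _), h0,
      intervalIntegral.integral_const_mul, intervalIntegral.integral_const_mul,
      integral_rpow (Or.inl (by linarith))]
    simp only [sub_add_cancel]
    rw [Real.zero_rpow hσ'.ne', sub_zero, hCe]
    have : t m ^ min σ 1 ≤ T ^ min σ 1 := Real.rpow_le_rpow htm0 (by linarith) hσ'.le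
    have := h.tol_pos
    calc ε * (C0 * (t m ^ min σ 1 / min σ 1)) ≤ ε * (C0 * (T ^ min σ 1 / min σ 1)) := by gcongr
      _ = _ := by ring
  have hsum : ∑ k ∈ range (m + 1),
        (weight α t s w (m + 1) (k + 1) - weight α t s w (m + 1) k) * localSize σ t k
      = ∑ k ∈ range m, (weight α t s w (m + 1) (k + 1 + 1) - weight α t s w (m + 1) (k + 1))
        * localSize σ t (k + 1) := by
    rw [sum_range_succ', localSize_zero, mul_zero, add_zero]
  have hS0 : 0 ≤ ∑ k ∈ range m, (weight α t s w (m + 1) (k + 1 + 1)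
      - weight α t s w (m + 1) (k + 1)) * localSize σ t (k + 1) := by
    refine sum_nonneg fun k hk => ?_
    have hkm := mem_range.1 hk
    have := h.weight_mono (n := m + 1) (k := k + 1) (by omega) hn
    have := h.step_pos (k := k + 1) (by omega) (by omega)
    have := h.mesh.pos (k := k + 1) (by omega) (by omega)
    rw [localSize]
    positivity
  have hw0 : 0 ≤ weight α t s w (m + 1) (m + 1) * localSize σ t (m + 1) := by
    have := (h.localCoeff_nonneg hn1 hn).trans (h.localCoeff_le_weight hn1 hn)
    have := (h.step_pos hn1 hn)
    have := h.mesh.pos hn1 hn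
    rw [localSize]
    positivity
  rw [fastAlikhanov_eq_hist, hcap, hsum, ← hx, ← hκ]
  set L := localCoeff α t (m + 1) * nabla (fun j => v (t j)) (m + 1)
  set IL := ∫ r in (t m)..x, fracKernel (1 - α) (x - r) * v1 r
  have hsplit : L + ∑ k ∈ range m, (histMean κ t (k + 1) * nabla (fun j => v (t j)) (k + 1)
        + histSlope κ t (k + 1) * (ratio t (k + 1) * nabla (fun j => v (t j)) (k + 2)
          - nabla (fun j => v (t j)) (k + 1)))
      - (∑ k ∈ range m, (∫ r in (t k)..(t (k + 1)), fracKernel (1 - α) (x - r) * v1 r) + IL)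
      = (L - IL) + (∑ k ∈ range m, ((histMean κ t (k + 1) * nabla (fun j => v (t j)) (k + 1)
        + histSlope κ t (k + 1) * (ratio t (k + 1) * nabla (fun j => v (t j)) (k + 2)
          - nabla (fun j => v (t j)) (k + 1))) - ∫ r in (t k)..(t (k + 1)), κ r * v1 r)
        + ∑ k ∈ range m, ((∫ r in (t k)..(t (k + 1)), κ r * v1 r)
        - ∫ r in (t k)..(t (k + 1)), fracKernel (1 - α) (x - r) * v1 r)) := by
    rw [sum_sub_distrib, sum_sub_distrib]
    ring
  rw [hsplit]
  have f1 := (abs_sum_le_sum_abs _ _).trans (sum_le_sum hhist)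
  have f2 := ((abs_sum_le_sum_abs _ _).trans (sum_le_sum hsoe)).trans hsoe_sum
  rw [← mul_sum] at f1
  refine (abs_add_le _ _).trans ((add_le_add hlocal ((abs_add_le _ _).trans
    (add_le_add f1 f2))).trans ?_)
  have := h.tol_pos.le
  set W := weight α t s w (m + 1) (m + 1) * localSize σ t (m + 1)
  set S := ∑ k ∈ range m, (weight α t s w (m + 1) (k + 1 + 1) - weight α t s w (m + 1) (k + 1))
    * localSize σ t (k + 1)
  have g1 := mul_nonneg hCl0 hS0
  have g2 := mul_nonneg hCl0 this
  have g3 := mul_nonneg hCh0 hw0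
  have g4 := mul_nonneg hCh0 this
  have g5 := mul_nonneg hCe0 hw0
  have g6 := mul_nonneg hCe0 hS0
  linarith

end TFBS

/-! ### Graded meshes and the barrier function. -/

namespace TFBS

open Finset

/-- M2 controls τ_{k+1}/t_{k+1} and t_{k+1} separately, so steps compare with constant Cγ². Adding
the lower terms makes the constant serve for the nodes as well and keeps it at least 1. -/
lemma isComparable_of_meshM2 {γ Cγ T : ℝ} {N : ℕ} {t : ℕ → ℝ} (hCγ : 0 < Cγ)
    (h : IsTimeMesh T N t) (h2 : MeshM2 γ Cγ N t) : IsComparable (1 + Cγ + Cγ ^ 2) N t where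
  one_le := by nlinarith
  node_le k hk hkN := by
    have h1 := h2.node_le (k + 1) (by omega) (by omega)
    rw [Nat.add_sub_cancel] at h1
    have := h.pos hk hkN.le
    nlinarith
  step_le k hk hkN := by
    have h1 := h2.node_le (k + 1) (by omega) (by omega)
    have h3 := h2.relative_step_le (k + 1) (by omega) (by omega)
    rw [Nat.add_sub_cancel] at h1 h3
    have p1 := h.pos hk hkN.le
    have p2 := h.pos (k := k + 1) (by omega) (by omega)
    have s1 := h.step_pos hk hkN.le
    rw [div_le_iff₀ p2] at h3
    calc step t (k + 1) ≤ Cγ * (step t k / t k) * (Cγ * t k) := h3.trans (by gcongr)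
      _ = Cγ ^ 2 * step t k := by field_simp
      _ ≤ _ := by gcongr; nlinarith

/-- Read off from M2 at k = 1, where the left-hand side is positive. -/
lemma maxStep_pos {γ Cγ T : ℝ} {N : ℕ} {t : ℕ → ℝ} (hCγ : 0 < Cγ) (hN : 1 ≤ N)
    (h : IsTimeMesh T N t) (h2 : MeshM2 γ Cγ N t) : 0 < maxStep N t := by
  have h1 := h2.step_le 1 le_rfl hN
  have s1 := h.step_pos le_rfl hN
  have p1 := h.pos le_rfl hN
  have hm : 0 < min 1 (t 1 ^ (1 - 1 / γ)) := lt_min one_pos (by positivity)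
  by_contra! hc
  have : Cγ * maxStep N t * min 1 (t 1 ^ (1 - 1 / γ)) ≤ 0 :=
    mul_nonpos_of_nonpos_of_nonneg (mul_nonpos_of_nonneg_of_nonpos hCγ.le hc) hm.le
  linarith

/-- The graded mesh turns relative step sizes into powers of the maximal step. -/
lemma relative_step_rpow_le {γ Cγ T σ q : ℝ} {N : ℕ} {t : ℕ → ℝ} (hγ : 0 < γ) (hCγ : 0 < Cγ)
    (hN : 1 ≤ N) (h : IsTimeMesh T N t) (h2 : MeshM2 γ Cγ N t) (hq0 : 0 ≤ q) (hq : q ≤ γ * σ)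
    {k : ℕ} (hk : 1 ≤ k) (hkN : k ≤ N) :
    (step t k / t k) ^ q * t k ^ σ ≤ Cγ ^ q * T ^ (σ - q / γ) * maxStep N t ^ q := by
  have p := h.pos hk hkN
  have s := h.step_pos hk hkN
  have hτ := maxStep_pos hCγ hN h h2
  have e1 : step t k / t k ≤ Cγ * maxStep N t * t k ^ (-(1 / γ)) := by
    rw [div_le_iff₀ p]
    refine (h2.step_le k hk hkN).trans ?_
    rw [mul_assoc _ (t k ^ (-(1 / γ))) (t k)]
    have : t k ^ (-(1 / γ)) * t k = t k ^ (1 - 1 / γ) := by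
      rw [sub_eq_neg_add, Real.rpow_add p, Real.rpow_one]
    rw [this]
    gcongr
    exact min_le_right _ _
  have e2 : (step t k / t k) ^ q ≤ Cγ ^ q * maxStep N t ^ q * t k ^ (-(q / γ)) := by
    refine (Real.rpow_le_rpow (by positivity) e1 hq0).trans (le_of_eq ?_)
    rw [Real.mul_rpow (by positivity) (by positivity), Real.mul_rpow hCγ.le hτ.le,
      ← Real.rpow_mul p.le]
    ring_nf
  have e3 : t k ^ (-(q / γ)) * t k ^ σ ≤ T ^ (σ - q / γ) := by
    rw [← Real.rpow_add p, neg_add_eq_sub]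
    refine Real.rpow_le_rpow p.le (h.le_horizon hkN) ?_
    rw [sub_nonneg, div_le_iff₀ hγ]
    linarith
  calc _ ≤ Cγ ^ q * maxStep N t ^ q * t k ^ (-(q / γ)) * t k ^ σ := by gcongr
    _ = Cγ ^ q * maxStep N t ^ q * (t k ^ (-(q / γ)) * t k ^ σ) := by ring
    _ ≤ Cγ ^ q * maxStep N t ^ q * T ^ (σ - q / γ) := by gcongr
    _ = _ := by ring

/-- The barrier function dominating all consistency errors. -/
theorem exists_barrier {α γ Cγ T σ : ℝ} (hα : α ∈ Set.Ioo (0 : ℝ) 1) (hγ : 0 < γ) (hCγ : 0 < Cγ)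
    (hσ : 0 < σ) (hT : 0 < T) :
    ∃ C, 0 ≤ C ∧ ∀ (N : ℕ) (t : ℕ → ℝ) (Nq : ℕ) (s w : Fin Nq → ℝ) (ε : ℝ), 1 ≤ N →
      IsFastMesh α T ε N t s w → MeshM2 γ Cγ N t → ∀ H A : ℝ, 0 ≤ H → 0 ≤ A →
      ∃ Ψ : ℕ → ℝ, (∀ n ≤ N, 0 ≤ Ψ n) ∧
        (∀ n ≤ N, Ψ n ≤ C * A * (maxStep N t ^ min (γ * σ) 2 + H + ε)) ∧
        ∀ n, 1 ≤ n → n ≤ N →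
          A * ((weight α t s w n n * localSize σ t n
            + ∑ k ∈ range n, (weight α t s w n (k + 1) - weight α t s w n k) * localSize σ t k
            + ε) + (step t n / t n) ^ 2 * t n ^ σ + H)
          ≤ ∑ k ∈ range n, (weight α t s w n (k + 1) - weight α t s w n k) * (Ψ n - Ψ k) := by
  set q := min (γ * σ) 2 with hq
  have hq0 : 0 < q := lt_min (by positivity) two_pos
  have hq2 : q ≤ 2 := min_le_right _ _
  have hqγ : q ≤ γ * σ := min_le_left _ _
  have hωT := fracKernel_pos hα.2 hT
  set C5 := Cγ ^ q * T ^ (σ - q / γ) with hC5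
  set C4 := 1 / (1 - α) + 4 with hC4
  have h1α : 0 < 1 - α := by linarith [hα.2]
  have hC40 : 0 ≤ C4 := by positivity
  have hC50 : 0 ≤ C5 := by positivity
  set C := 121 / 16 * (4 * C4 * C5 + (1 + C5) / fracKernel (1 - α) T) + C5 with hC
  have hC0 : 0 ≤ C := by positivity
  refine ⟨C, hC0, ?_⟩
  intro N t Nq s w ε hN h h2 H A hH hA
  have hτ := maxStep_pos hCγ hN h.mesh h2
  have hε := h.tol_pos
  set X := maxStep N t ^ q + H + ε with hX
  have hτq : 0 ≤ maxStep N t ^ q := by positivity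
  have hY : ∀ k, 1 ≤ k → k ≤ N → (step t k / t k) ^ q * t k ^ σ ≤ C5 * maxStep N t ^ q :=
    fun k hk hkN => relative_step_rpow_le hγ hCγ hN h.mesh h2 hq0.le hqγ hk hkN
  have hrel : ∀ k, 1 ≤ k → k ≤ N → 0 < step t k / t k ∧ step t k / t k ≤ 1 := fun k hk hkN =>
    ⟨div_pos (h.step_pos hk hkN) (h.mesh.pos hk hkN),
      (div_le_one (h.mesh.pos hk hkN)).2 (h.mesh.step_le hkN)⟩
  have hg0 : ∀ k ≤ N, 0 ≤ localSize σ t k := by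
    intro k hk
    rcases Nat.eq_zero_or_pos k with rfl | hk0
    · rw [localSize_zero]
    · have := (hrel k hk0 hk).1
      have := h.mesh.pos hk0 hk
      rw [localSize]
      positivity
  have hpow : ∀ k, 1 ≤ k → k ≤ N → ∀ p : ℝ, q ≤ p →
      (step t k / t k) ^ p * t k ^ σ ≤ C5 * maxStep N t ^ q := by
    intro k hk hkN p hp
    refine le_trans ?_ (hY k hk hkN)
    have := h.mesh.pos hk hkN
    gcongr ?_ * _
    exact Real.rpow_le_rpow_of_exponent_ge (hrel k hk hkN).1 (hrel k hk hkN).2 hp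
  have hg1 : ∀ k ≤ N, localSize σ t k ≤ C5 * maxStep N t ^ q := by
    intro k hk
    rcases Nat.eq_zero_or_pos k with rfl | hk0
    · rw [localSize_zero]
      positivity
    · have := hpow k hk0 hk 3 (by linarith)
      rw [localSize]
      exact_mod_cast this
  -- A constant with a jump at k = 0 has discrete derivative const · A_1, and -g_k contributes Σ d_k
  -- g_k - A_n g_n. The part CX also keeps the barrier nonnegative.
  refine ⟨fun k => if k = 0 then 0 else A * (C * X - localSize σ t k), ?_, ?_, ?_⟩
  · intro n hn
    beta_reduce
    split_ifs with h0
    · exact le_rfl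
    · refine mul_nonneg hA ?_
      have e1 := hg1 n hn
      have e2 : C5 * maxStep N t ^ q ≤ C * X := by
        have e4 : C5 ≤ C := by
          rw [hC]
          have : 0 ≤ 121 / 16 * (4 * C4 * C5 + (1 + C5) / fracKernel (1 - α) T) := by positivity
          linarith
        have e5 : maxStep N t ^ q ≤ X := by rw [hX]; linarith
        gcongr
      linarith
  · intro n hn
    beta_reduce
    split_ifs with h0
    · positivity
    · have := hg0 n hn
      nlinarith
  · intro n hn1 hn
    have htn := h.mesh.pos hn1 hn
    have hωn := fracKernel_pos hα.2 htn
    have hωle : fracKernel (1 - α) T ≤ fracKernel (1 - α) (t n) :=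
      h.horizon_kernel_le htn (h.mesh.le_horizon hn)
    -- The history part of the residual is matched exactly. It remains to pay for twice the local
    -- term, for ε, the off-set interpolation error and H by means of CX times the first weight.
    have hsum : ∑ k ∈ range n, (weight α t s w n (k + 1) - weight α t s w n k)
        * ((if n = 0 then 0 else A * (C * X - localSize σ t n))
          - (if k = 0 then 0 else A * (C * X - localSize σ t k)))
        = A * (C * X * weight α t s w n 1 - weight α t s w n n * localSize σ t n
          + ∑ k ∈ range n, (weight α t s w n (k + 1) - weight α t s w n k) * localSize σ t k) := by
      obtain ⟨m, rfl⟩ : ∃ m, n = m + 1 := ⟨n - 1, by omega⟩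
      have e1 : ∑ k ∈ range m, (weight α t s w (m + 1) (k + 1 + 1) - weight α t s w (m + 1) (k + 1))
          = weight α t s w (m + 1) (m + 1) - weight α t s w (m + 1) 1 := by
        rw [sum_range_sub (fun k => weight α t s w (m + 1) (k + 1))]
      rw [sum_range_succ', sum_range_succ', localSize_zero, IsFastMesh.weight_zero]
      simp only [Nat.succ_ne_zero, if_false, if_true, mul_zero, add_zero, sub_zero, zero_add]
      have e2 : ∀ k ∈ range m, (weight α t s w (m + 1) (k + 1 + 1) - weight α t s w (m + 1) (k + 1))
          * (A * (C * X - localSize σ t (m + 1)) - A * (C * X - localSize σ t (k + 1)))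
          = A * ((weight α t s w (m + 1) (k + 1 + 1) - weight α t s w (m + 1) (k + 1))
              * localSize σ t (k + 1))
            - A * localSize σ t (m + 1)
              * (weight α t s w (m + 1) (k + 1 + 1) - weight α t s w (m + 1) (k + 1)) :=
        fun k _ => by ring
      rw [sum_congr rfl e2, sum_sub_distrib, ← mul_sum, ← mul_sum, e1]
      ring
    rw [hsum]
    refine mul_le_mul_of_nonneg_left ?_ hA
    have hw1 := h.weight_one_ge hn1 hn
    have hwn := h.weight_self_le hn1 hn
    obtain ⟨r0, r1⟩ := hrel n hn1 hn
    have hs := h.step_pos hn1 hn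
    have h2α : 0 < 1 - α / 2 := by linarith
    have hωs : fracKernel (1 - α) ((1 - α / 2) * step t n)
        ≤ 2 * (step t n / t n) ^ (-α) * fracKernel (1 - α) (t n) := by
      rw [fracKernel_eq, fracKernel_eq, Real.div_rpow hs.le htn.le, Real.mul_rpow h2α.le hs.le]
      have hG := Real.Gamma_pos_of_pos h1α
      have : (1 - α / 2) ^ (-α) ≤ 2 := by
        calc (1 - α / 2) ^ (-α) ≤ (1 / 2 : ℝ) ^ (-α) :=
              Real.rpow_le_rpow_of_nonpos (by norm_num) (by linarith [hα.2]) (by linarith [hα.1])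
          _ ≤ (1 / 2 : ℝ) ^ (-1 : ℝ) :=
              Real.rpow_le_rpow_of_exponent_ge (by norm_num) (by norm_num) (by linarith [hα.2])
          _ = 2 := by rw [Real.rpow_neg_one]; norm_num
      calc _ ≤ 2 * step t n ^ (-α) / Real.Gamma (1 - α) := by gcongr
        _ = _ := by field_simp
    -- The last weight exceeds ω_{1-α}(t_n) by a factor of order (τ_n/t_n)^(-α). Three powers of
    -- τ_n/t_n compensate, leaving 3 - α ≥ 2 ≥ q.
    have hcg : weight α t s w n n * localSize σ t n
        ≤ 2 * C4 * (C5 * maxStep N t ^ q) * fracKernel (1 - α) (t n) := by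
      have e1 := hpow n hn1 hn (3 - α) (by linarith)
      have e2 : (step t n / t n) ^ (3 - α) = (step t n / t n) ^ (-α) * (step t n / t n) ^ 3 := by
        rw [← Real.rpow_natCast, ← Real.rpow_add r0]
        push_cast
        ring_nf
      rw [e2] at e1
      calc _ ≤ C4 * (2 * (step t n / t n) ^ (-α) * fracKernel (1 - α) (t n)) * localSize σ t n := by
            have := hg0 n hn
            gcongr
            exact hwn.trans (by gcongr)
        _ = 2 * C4 * ((step t n / t n) ^ (-α) * (step t n / t n) ^ 3 * t n ^ σ)
            * fracKernel (1 - α) (t n) := by rw [localSize]; ring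
        _ ≤ _ := by gcongr
    have hint : (step t n / t n) ^ 2 * t n ^ σ ≤ C5 * maxStep N t ^ q := by
      have := hpow n hn1 hn 2 hq2
      exact_mod_cast this
    have hrest : ε + (step t n / t n) ^ 2 * t n ^ σ + H
        ≤ (1 + C5) * X / fracKernel (1 - α) T * fracKernel (1 - α) (t n) := by
      have e1 : ε + (step t n / t n) ^ 2 * t n ^ σ + H ≤ (1 + C5) * X := by
        rw [hX]
        have : 0 ≤ C5 * (H + ε) := by positivity
        linarith
      have e2 : 0 ≤ (1 + C5) * X := by positivity
      rw [div_mul_eq_mul_div, le_div_iff₀ hωT]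
      calc _ ≤ (1 + C5) * X * fracKernel (1 - α) T := by gcongr
        _ ≤ _ := by gcongr
    have hCX : (4 * C4 * (C5 * maxStep N t ^ q) + (1 + C5) * X / fracKernel (1 - α) T)
        * fracKernel (1 - α) (t n) ≤ C * X * weight α t s w n 1 := by
      have e5 : maxStep N t ^ q ≤ X := by rw [hX]; linarith
      have e6 : 0 ≤ X := hτq.trans e5
      calc _ ≤ (4 * C4 * (C5 * X) + (1 + C5) * X / fracKernel (1 - α) T)
            * fracKernel (1 - α) (t n) := by gcongr
        _ = 121 / 16 * (4 * C4 * C5 + (1 + C5) / fracKernel (1 - α) T) * X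
            * (16 / 121 * fracKernel (1 - α) (t n)) := by ring
        _ ≤ C * X * weight α t s w n 1 := by
            have : 121 / 16 * (4 * C4 * C5 + (1 + C5) / fracKernel (1 - α) T) ≤ C := by
              rw [hC]; linarith
            gcongr
    linarith

end TFBS

namespace TFBS

open Finset

/-! ### Stability of the compact difference operators -/

/-- The right-hand side operator `(a + h² b² / (12 a)) δ_x² + b δ_x̂` of the compact scheme. -/
noncomputable def fluxOp (a b h : ℝ) (v : ℕ → ℝ) (i : ℕ) : ℝ :=
  (a + h ^ 2 * b ^ 2 / (12 * a)) * secondDiff h v i + b * centralDiff h v i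

lemma averageOp_succ {a h : ℝ} (b : ℝ) (ha : a ≠ 0) (hh : h ≠ 0) (v : ℕ → ℝ) (i : ℕ) :
    averageOp a b h v (i + 1) = v (i + 1) + (v (i + 2) - 2 * v (i + 1) + v i) / 12
      + b * h / a / 24 * (v (i + 2) - v i) := by
  rw [averageOp, secondDiff, centralDiff, Nat.add_sub_cancel]
  field_simp
  ring

lemma fluxOp_succ {a h : ℝ} (b : ℝ) (ha : a ≠ 0) (hh : h ≠ 0) (v : ℕ → ℝ) (i : ℕ) :
    fluxOp a b h v (i + 1) = a / h ^ 2 * ((1 + (b * h / a) ^ 2 / 12)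
      * (v (i + 2) - 2 * v (i + 1) + v i) + b * h / a / 2 * (v (i + 2) - v i)) := by
  rw [fluxOp, secondDiff, centralDiff, Nat.add_sub_cancel]
  field_simp

lemma sum_diff_sq_le (e : ℕ → ℝ) (h0 : e 0 = 0) (m : ℕ) (hm : e (m + 1) = 0) :
    ∑ i ∈ range (m + 1), (e (i + 1) - e i) ^ 2 ≤ 4 * ∑ i ∈ range m, e (i + 1) ^ 2 := by
  have h1 : ∑ i ∈ range (m + 1), (e (i + 1) - e i) ^ 2
      ≤ ∑ i ∈ range (m + 1), (2 * e (i + 1) ^ 2 + 2 * e i ^ 2) :=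
    sum_le_sum fun i _ => by nlinarith [sq_nonneg (e (i + 1) + e i)]
  rw [sum_add_distrib, ← mul_sum, ← mul_sum, sum_range_succ (fun i => e (i + 1) ^ 2), hm,
    sum_range_succ' (fun i => e i ^ 2), h0] at h1
  linarith

lemma sum_secondDiff_mul (e : ℕ → ℝ) (m : ℕ) :
    ∑ i ∈ range m, (e (i + 2) - 2 * e (i + 1) + e i) * e (i + 1)
      = -∑ i ∈ range (m + 1), (e (i + 1) - e i) ^ 2 + e (m + 1) * (e (m + 1) - e m)
        - e 0 * (e 1 - e 0) := by
  induction m with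
  | zero => simp; ring
  | succ m ih => rw [sum_range_succ, ih, sum_range_succ _ (m + 1)]; ring

lemma sum_centralDiff_mul (e : ℕ → ℝ) (m : ℕ) :
    ∑ i ∈ range m, (e (i + 2) - e i) * e (i + 1) = e (m + 1) * e m - e 1 * e 0 := by
  induction m with
  | zero => simp
  | succ m ih => rw [sum_range_succ, ih]; ring

/-- In terms of p_i = e_{i+1} - e_i the summand is p_{i+1}² - p_i². The boundary terms do not
vanish, even for homogeneous Dirichlet values. -/
lemma sum_secondDiff_mul_centralDiff (e : ℕ → ℝ) (m : ℕ) :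
    ∑ i ∈ range m, (e (i + 2) - 2 * e (i + 1) + e i) * (e (i + 2) - e i)
      = (e (m + 1) - e m) ^ 2 - (e 1 - e 0) ^ 2 := by
  induction m with
  | zero => simp
  | succ m ih => rw [sum_range_succ, ih]; ring

/-- The parallelogram law for consecutive differences. -/
lemma sum_secondDiff_sq_add (e : ℕ → ℝ) (m : ℕ) :
    ∑ i ∈ range m, (e (i + 2) - 2 * e (i + 1) + e i) ^ 2 + ∑ i ∈ range m, (e (i + 2) - e i) ^ 2
      = 4 * ∑ i ∈ range (m + 1), (e (i + 1) - e i) ^ 2 - 2 * (e 1 - e 0) ^ 2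
        - 2 * (e (m + 1) - e m) ^ 2 := by
  induction m with
  | zero => simp; ring
  | succ m ih =>
    rw [sum_range_succ, sum_range_succ _ m, sum_range_succ _ (m + 1)]
    linear_combination ih

/-- Dissipativity of the compact scheme for small mesh Péclet number `P`. -/
lemma sum_flux_mul_average_nonpos (e : ℕ → ℝ) (h0 : e 0 = 0) (m : ℕ) (hm : e (m + 1) = 0) {P : ℝ}
    (hP : |P| ≤ 1) :
    ∑ i ∈ range m, ((1 + P ^ 2 / 12) * (e (i + 2) - 2 * e (i + 1) + e i)
        + P / 2 * (e (i + 2) - e i))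
      * (e (i + 1) + (e (i + 2) - 2 * e (i + 1) + e i) / 12 + P / 24 * (e (i + 2) - e i)) ≤ 0 := by
  have e1 := sum_secondDiff_mul e m
  have e2 := sum_centralDiff_mul e m
  have e3 := sum_secondDiff_mul_centralDiff e m
  have e4 := sum_secondDiff_sq_add e m
  rw [hm, h0] at e1 e2
  have hexp : ∑ i ∈ range m, ((1 + P ^ 2 / 12) * (e (i + 2) - 2 * e (i + 1) + e i)
        + P / 2 * (e (i + 2) - e i))
      * (e (i + 1) + (e (i + 2) - 2 * e (i + 1) + e i) / 12 + P / 24 * (e (i + 2) - e i))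
      = (1 + P ^ 2 / 12) * ∑ i ∈ range m, (e (i + 2) - 2 * e (i + 1) + e i) * e (i + 1)
        + P / 2 * ∑ i ∈ range m, (e (i + 2) - e i) * e (i + 1)
        + ((2 + P ^ 2 / 12) * P / 24)
          * ∑ i ∈ range m, (e (i + 2) - 2 * e (i + 1) + e i) * (e (i + 2) - e i)
        + (1 + P ^ 2 / 12) / 12 * ∑ i ∈ range m, (e (i + 2) - 2 * e (i + 1) + e i) ^ 2
        + P ^ 2 / 48 * ∑ i ∈ range m, (e (i + 2) - e i) ^ 2 := by
    simp only [mul_sum, ← sum_add_distrib]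
    exact sum_congr rfl fun i _ => by ring
  have sX : 0 ≤ ∑ i ∈ range m, (e (i + 2) - e i) ^ 2 := sum_nonneg fun i _ => sq_nonneg _
  have sD : 0 ≤ ∑ i ∈ range m, (e (i + 2) - 2 * e (i + 1) + e i) ^ 2 :=
    sum_nonneg fun i _ => sq_nonneg _
  have sG : 0 ≤ ∑ i ∈ range (m + 1), (e (i + 1) - e i) ^ 2 := sum_nonneg fun i _ => sq_nonneg _
  rw [hexp, e1, e2, e3]
  set SX := ∑ i ∈ range m, (e (i + 2) - e i) ^ 2
  set SD := ∑ i ∈ range m, (e (i + 2) - 2 * e (i + 1) + e i) ^ 2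
  set G := ∑ i ∈ range (m + 1), (e (i + 1) - e i) ^ 2
  set pm := (e (m + 1) - e m) ^ 2 with hpm
  set p0 := (e 1 - e 0) ^ 2 with hp0
  have hpm0 : 0 ≤ pm := sq_nonneg _
  have hp00 : 0 ≤ p0 := sq_nonneg _
  have hP2 : P ^ 2 ≤ 1 := by rw [← sq_abs]; nlinarith [abs_nonneg P]
  set Q := P ^ 2 / 12 with hQ
  have hQ0 : 0 ≤ Q := by positivity
  have hQ1 : Q ≤ 1 / 12 := by rw [hQ]; linarith
  have hκ : |(2 + Q) * P / 24| ≤ 1 / 6 := by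
    rw [abs_div, abs_mul, abs_of_pos (by norm_num : (0 : ℝ) < 24), abs_of_pos (by linarith)]
    rw [div_le_iff₀ (by norm_num)]
    nlinarith [abs_nonneg P]
  obtain ⟨k1, k2⟩ := abs_le.1 hκ
  have hSD : SD = 4 * G - 2 * p0 - 2 * pm - SX := by linarith
  have hP48 : P ^ 2 / 48 = Q / 4 := by rw [hQ]; ring
  rw [hSD, hP48]
  -- The only term of indefinite sign comes from the boundary. For |P| ≤ 1 it is absorbed by the
  -- negative boundary terms that `hSD` supplies.
  have f1 : (2 + Q) * P / 24 * (pm - p0) ≤ 1 / 6 * (pm + p0) := by nlinarith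
  have f2 : 0 ≤ Q * (p0 + pm) := by positivity
  have f3 : Q * SX ≤ Q * (4 * G) := mul_le_mul_of_nonneg_left (by linarith) hQ0
  have f4 : Q * G ≤ 1 / 12 * G := mul_le_mul_of_nonneg_right hQ1 sG
  nlinarith [mul_nonneg hQ0 sX]

/-- Let H be the averaging operator and n the sum of squares on the left. The central difference is
skew, so testing with e gives ⟨He, e⟩ = n - G/12 with G ≤ 4n, hence ⟨He, e⟩ ≥ (2/3) n; Young's
inequality finishes. The bound is uniform in P. -/
lemma sum_sq_le_average (e : ℕ → ℝ) (h0 : e 0 = 0) (m : ℕ) (hm : e (m + 1) = 0) (P : ℝ) :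
    ∑ i ∈ range m, e (i + 1) ^ 2 ≤ 9 / 4 * ∑ i ∈ range m,
      (e (i + 1) + (e (i + 2) - 2 * e (i + 1) + e i) / 12 + P / 24 * (e (i + 2) - e i)) ^ 2 := by
  have e1 := sum_secondDiff_mul e m
  have e2 := sum_centralDiff_mul e m
  have e3 := sum_diff_sq_le e h0 m hm
  rw [hm, h0] at e1 e2
  set y : ℕ → ℝ := fun i =>
    e (i + 1) + (e (i + 2) - 2 * e (i + 1) + e i) / 12 + P / 24 * (e (i + 2) - e i) with hy
  have h1 : ∑ i ∈ range m, y i * e (i + 1) = ∑ i ∈ range m, e (i + 1) ^ 2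
      + 1 / 12 * ∑ i ∈ range m, (e (i + 2) - 2 * e (i + 1) + e i) * e (i + 1)
      + P / 24 * ∑ i ∈ range m, (e (i + 2) - e i) * e (i + 1) := by
    simp only [mul_sum, ← sum_add_distrib]
    exact sum_congr rfl fun i _ => by simp only [hy]; ring
  have h2 : 0 ≤ ∑ i ∈ range m, (9 / 4 * y i ^ 2 - 3 * (y i * e (i + 1)) + e (i + 1) ^ 2) :=
    sum_nonneg fun i _ => by nlinarith [sq_nonneg (3 / 2 * y i - e (i + 1))]
  rw [sum_add_distrib, sum_sub_distrib, ← mul_sum, ← mul_sum, h1, e1, e2] at h2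
  change _ ≤ 9 / 4 * ∑ i ∈ range m, y i ^ 2
  linarith

/-- Uniform stability of the compact scheme in a Hilbert space norm obtained through a linear map
`J` of grid functions: the norm dominates the discrete `L²` norm, and the spatial part of the
scheme is dissipative in it. -/
def IsSpaceStable (a b c h : ℝ) (m : ℕ) (μ : ℝ) : Prop :=
  ∃ (F : Type) (_ : NormedAddCommGroup F) (_ : InnerProductSpace ℝ F) (J : (ℕ → ℝ) →ₗ[ℝ] F),
    (∀ x : ℕ → ℝ, x 0 = 0 → x (m + 1) = 0 →
      Real.sqrt (∑ i ∈ range m, x (i + 1) ^ 2) ≤ μ * ‖J x‖) ∧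
    ∀ x y R : ℕ → ℝ, x 0 = 0 → x (m + 1) = 0 → y 0 = 0 → y (m + 1) = 0 →
      (∀ i < m, averageOp a b h y (i + 1)
        = fluxOp a b h x (i + 1) - c * averageOp a b h x (i + 1) + R i) →
      inner ℝ (J y) (J x) ≤ μ * Real.sqrt (∑ i ∈ range m, R i ^ 2) * ‖J x‖

lemma IsSpaceStable.mono {a b c h : ℝ} {m : ℕ} {μ ν : ℝ} (hs : IsSpaceStable a b c h m μ)
    (hle : μ ≤ ν) : IsSpaceStable a b c h m ν := by
  obtain ⟨F, i1, i2, J, h1, h2⟩ := hs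
  refine ⟨F, i1, i2, J, fun x hx hx' => (h1 x hx hx').trans (by gcongr),
    fun x y R hx hx' hy hy' he => (h2 x y R hx hx' hy hy' he).trans (by gcongr)⟩

/-- Here J is the averaging operator itself: the scheme is tested with the average of x, the flux
term has a sign and the reaction term becomes -c‖Jx‖². -/
lemma isSpaceStable_of_small {a b c h : ℝ} (ha : 0 < a) (hc : 0 ≤ c) (hh : 0 < h)
    (hP : |b * h / a| ≤ 1) (m : ℕ) : IsSpaceStable a b c h m (3 / 2) := by
  let J : (ℕ → ℝ) →ₗ[ℝ] EuclideanSpace ℝ (Fin m) :=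
    { toFun := fun x => WithLp.toLp 2 fun i => averageOp a b h x (i + 1)
      map_add' := by
        intro x y
        ext i
        simp only [averageOp, secondDiff, centralDiff, Pi.add_apply, PiLp.add_apply]
        ring
      map_smul' := by
        intro r x
        ext i
        simp only [averageOp, secondDiff, centralDiff, Pi.smul_apply, PiLp.smul_apply, smul_eq_mul,
          RingHom.id_apply]
        ring }
  have hJ : ∀ x i, J x i = averageOp a b h x (i + 1) := fun x i => rfl
  have hnorm : ∀ x, ‖J x‖ = Real.sqrt (∑ i ∈ range m, averageOp a b h x (i + 1) ^ 2) := by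
    intro x
    rw [EuclideanSpace.norm_eq, ← Fin.sum_univ_eq_sum_range
      (fun i => averageOp a b h x (i + 1) ^ 2)]
    simp only [hJ, Real.norm_eq_abs, sq_abs]
  have hinner : ∀ x y, inner ℝ (J y) (J x)
      = ∑ i ∈ range m, averageOp a b h y (i + 1) * averageOp a b h x (i + 1) := by
    intro x y
    rw [PiLp.inner_apply, ← Fin.sum_univ_eq_sum_range
      (fun i => averageOp a b h y (i + 1) * averageOp a b h x (i + 1))]
    refine sum_congr rfl fun i _ => ?_
    simp only [hJ, RCLike.inner_apply, conj_trivial]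
    ring
  refine ⟨_, _, _, J, ?_, ?_⟩
  · intro x h0 hm
    have := sum_sq_le_average x h0 m hm (b * h / a)
    rw [hnorm]
    simp only [averageOp_succ b ha.ne' hh.ne']
    refine (Real.sqrt_le_sqrt this).trans (le_of_eq ?_)
    rw [Real.sqrt_mul (by norm_num), show (9 / 4 : ℝ) = (3 / 2) ^ 2 by norm_num,
      Real.sqrt_sq (by norm_num)]
  · intro x y R h0 hm _ _ he
    rw [hinner]
    have h1 : ∑ i ∈ range m, averageOp a b h y (i + 1) * averageOp a b h x (i + 1)
        = ∑ i ∈ range m, fluxOp a b h x (i + 1) * averageOp a b h x (i + 1)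
          - c * ∑ i ∈ range m, averageOp a b h x (i + 1) ^ 2
          + ∑ i ∈ range m, R i * averageOp a b h x (i + 1) := by
      rw [mul_sum, ← sum_sub_distrib, ← sum_add_distrib]
      refine sum_congr rfl fun i hi => ?_
      rw [he i (mem_range.1 hi)]
      ring
    have h2 : ∑ i ∈ range m, fluxOp a b h x (i + 1) * averageOp a b h x (i + 1) ≤ 0 := by
      have := sum_flux_mul_average_nonpos x h0 m hm hP
      simp only [averageOp_succ b ha.ne' hh.ne', fluxOp_succ b ha.ne' hh.ne']
      simp only [mul_assoc (a / h ^ 2), ← mul_sum]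
      exact mul_nonpos_of_nonneg_of_nonpos (by positivity) this
    have h3 := Real.sum_mul_le_sqrt_mul_sqrt (range m) R (fun i => averageOp a b h x (i + 1))
    rw [← hnorm] at h3
    have h4 : 0 ≤ c * ∑ i ∈ range m, averageOp a b h x (i + 1) ^ 2 :=
      mul_nonneg hc (sum_nonneg fun i _ => sq_nonneg _)
    have h5 : 0 ≤ Real.sqrt (∑ i ∈ range m, R i ^ 2) * ‖J x‖ := by positivity
    linarith

end TFBS

namespace TFBS

open Finset

/-! ### Discrete Lyapunov functions -/

/-- Gelfand's formula: the k-th roots of the norms of powers tend to the spectral radius. -/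
lemma exists_pow_norm_lt_one_of_spectrum {A : Type*} [NormedRing A] [NormedAlgebra ℂ A]
    [CompleteSpace A] [Nontrivial A] (B : A) (hB : ∀ μ ∈ spectrum ℂ B, ‖μ‖ < 1) :
    ∃ k : ℕ, ‖B ^ (k + 1)‖ < 1 := by
  have hr : spectralRadius ℂ B < (1 : NNReal) :=
    spectrum.spectralRadius_lt_of_forall_lt B fun z hz => by
      rw [← NNReal.coe_lt_coe]; simpa using hB z hz
  have hev := (spectrum.pow_nnnorm_pow_one_div_tendsto_nhds_spectralRadius B).eventually
    (gt_mem_nhds hr)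
  obtain ⟨k, hk, hk1⟩ := (hev.and (Filter.eventually_ge_atTop 1)).exists
  refine ⟨k - 1, ?_⟩
  rw [Nat.sub_add_cancel hk1]
  by_contra hcon
  rw [not_lt] at hcon
  refine absurd hk (not_lt.2 ?_)
  have h1 : (1 : ENNReal) ≤ (‖B ^ k‖₊ : ENNReal) := by
    exact_mod_cast hcon
  simpa using ENNReal.one_le_rpow h1 (by positivity)

lemma exists_pow_norm_lt_one {V : Type*} [NormedAddCommGroup V] [NormedSpace ℂ V]
    [FiniteDimensional ℂ V] [Nontrivial V] (B : V →L[ℂ] V)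
    (hB : ∀ (μ : ℂ) (x : V), x ≠ 0 → B x = μ • x → ‖μ‖ < 1) :
    ∃ k : ℕ, ‖B ^ (k + 1)‖ < 1 := by
  have : CompleteSpace V := FiniteDimensional.complete ℂ V
  refine exists_pow_norm_lt_one_of_spectrum B fun μ hμ => ?_
  rw [spectrum.mem_iff, ContinuousLinearMap.isUnit_iff_isUnit_toLinearMap,
    LinearMap.isUnit_iff_ker_eq_bot, LinearMap.ker_eq_bot'] at hμ
  push Not at hμ
  obtain ⟨x, hx, hx0⟩ := hμ
  refine hB μ x hx0 ?_
  have h : μ • x - B x = 0 := by simpa [Algebra.algebraMap_eq_smul_one] using hx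
  exact (sub_eq_zero.1 h).symm

/-- Translates nonexpansiveness of a Cayley transform into dissipativity. -/
lemma inner_nonpos_of_norm_add_le {F : Type*} [NormedAddCommGroup F] [InnerProductSpace ℝ F]
    {x y : F} (h : ‖y + x‖ ≤ ‖y - x‖) : inner ℝ x y ≤ 0 := by
  have h1 := norm_add_sq_real y x
  have h2 := norm_sub_sq_real y x
  have h3 : ‖y + x‖ ^ 2 ≤ ‖y - x‖ ^ 2 := by gcongr
  rw [real_inner_comm]
  linarith

/-- If the field of values of the pencil `(H, L)` lies in the open left half plane, then `L` is
dissipative with respect to `H` in an equivalent Hilbert norm. -/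
lemma exists_lyapunov {V : Type} [NormedAddCommGroup V] [InnerProductSpace ℂ V]
    [FiniteDimensional ℂ V] [Nontrivial V] (H L : V →ₗ[ℂ] V)
    (h : ∀ z : V, z ≠ 0 → (inner ℂ z (H z)).re * (inner ℂ z (L z)).re
      + (inner ℂ z (H z)).im * (inner ℂ z (L z)).im < 0) :
    ∃ (F : Type) (_ : NormedAddCommGroup F) (_ : InnerProductSpace ℂ F) (J : V →L[ℂ] F),
      (∀ z, ‖z‖ ≤ ‖J z‖) ∧ ∀ z, ‖J (H z + L z)‖ ≤ ‖J (H z - L z)‖ := by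
  -- If Hz = Lz, the expression in `h` is a sum of squares and cannot be negative.
  have hinj : Function.Injective (H - L) := by
    rw [← LinearMap.ker_eq_bot, LinearMap.ker_eq_bot']
    intro z hz
    by_contra hz0
    have h1 := h z hz0
    rw [LinearMap.sub_apply, sub_eq_zero] at hz
    rw [hz] at h1
    nlinarith [mul_self_nonneg (inner ℂ z (L z)).re, mul_self_nonneg (inner ℂ z (L z)).im]
  let e : V ≃ₗ[ℂ] V := LinearEquiv.ofInjectiveEndo (H - L) hinj
  have he : ∀ z, e z = H z - L z := fun z => rfl
  -- The Cayley transform (H + L)(H - L)⁻¹.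
  let B : V →L[ℂ] V := LinearMap.toContinuousLinearMap ((H + L) ∘ₗ e.symm.toLinearMap)
  have hBe : ∀ z, B (H z - L z) = H z + L z := by
    intro z
    rw [← he]
    change (H + L) (e.symm (e z)) = _
    rw [e.symm_apply_apply]
    rfl
  have hB : ∀ (μ : ℂ) (x : V), x ≠ 0 → B x = μ • x → ‖μ‖ < 1 := by
    intro μ x hx hμ
    obtain ⟨z, rfl⟩ := e.surjective x
    have hz0 : z ≠ 0 := by
      rintro rfl
      exact hx (map_zero e)
    rw [he, hBe] at hμ
    have h1 := congrArg (fun v => inner ℂ z v) hμ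
    simp only [inner_add_right, inner_smul_right, inner_sub_right] at h1
    have h2 := h z hz0
    set p := inner ℂ z (H z)
    set q := inner ℂ z (L z)
    -- The difference of the two sides is four times the expression in `h`, the real part of p times
    -- the conjugate of q. An eigenvalue of B maps p - q to p + q, so its modulus is below 1.
    have hsq : ‖p + q‖ ^ 2 < ‖p - q‖ ^ 2 := by
      rw [← Complex.normSq_eq_norm_sq, ← Complex.normSq_eq_norm_sq, Complex.normSq_apply,
        Complex.normSq_apply]
      simp only [Complex.add_re, Complex.add_im, Complex.sub_re, Complex.sub_im]
      nlinarith
    rw [h1, norm_mul, mul_pow] at hsq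
    have h3 : 0 < ‖p - q‖ ^ 2 := by
      by_contra h4
      have : ‖p - q‖ ^ 2 = 0 := le_antisymm (not_lt.1 h4) (sq_nonneg _)
      rw [this] at hsq
      simp at hsq
    have h5 : ‖μ‖ ^ 2 < 1 := by
      by_contra h6
      nlinarith
    nlinarith [norm_nonneg μ]
  obtain ⟨k, hk⟩ := exists_pow_norm_lt_one B hB
  -- The discrete Lyapunov norm ‖Jz‖² = Σ_{j ≤ k} ‖B^j z‖². Applying B shifts the sum by one index,
  -- so only ‖B^{k+1} z‖ against ‖z‖ has to be compared.
  let J : V →L[ℂ] PiLp 2 (fun _ : Fin (k + 1) => V) := LinearMap.toContinuousLinearMap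
    { toFun := fun z => WithLp.toLp 2 fun j => (B ^ (j : ℕ)) z
      map_add' := fun x y => by ext j; simp
      map_smul' := fun c x => by ext j; simp }
  have hJ : ∀ z, ‖J z‖ ^ 2 = ∑ j ∈ range (k + 1), ‖(B ^ j) z‖ ^ 2 := by
    intro z
    rw [PiLp.norm_sq_eq_of_L2, ← Fin.sum_univ_eq_sum_range (fun j => ‖(B ^ j) z‖ ^ 2)]
    rfl
  refine ⟨_, inferInstance, inferInstance, J, fun z => ?_, fun z => ?_⟩
  · refine le_of_sq_le_sq ?_ (norm_nonneg _)
    rw [hJ, sum_range_succ']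
    have : 0 ≤ ∑ j ∈ range k, ‖(B ^ (j + 1)) z‖ ^ 2 := sum_nonneg fun _ _ => sq_nonneg _
    simpa using this
  · refine le_of_sq_le_sq ?_ (norm_nonneg _)
    rw [hJ, hJ, ← hBe z]
    have hs : ∀ j, (B ^ j) (B (H z - L z)) = (B ^ (j + 1)) (H z - L z) := fun j => by
      rw [pow_succ]; rfl
    simp only [hs]
    rw [sum_range_succ, sum_range_succ' (fun j => ‖(B ^ j) (H z - L z)‖ ^ 2)]
    have h1 := (B ^ (k + 1)).le_opNorm (H z - L z)
    have h2 : ‖(B ^ (k + 1)) (H z - L z)‖ ≤ ‖H z - L z‖ :=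
      h1.trans (by nlinarith [norm_nonneg (H z - L z)])
    have h3 : ‖(B ^ (k + 1)) (H z - L z)‖ ^ 2 ≤ ‖H z - L z‖ ^ 2 := by gcongr
    simpa using h3

end TFBS

namespace TFBS

open Finset

/-! ### The compact scheme on a fixed grid -/

lemma sum_diff_sq_pos (e : ℕ → ℝ) (h0 : e 0 = 0) (m : ℕ) (hne : ∃ i < m, e (i + 1) ≠ 0) :
    0 < ∑ i ∈ range (m + 1), (e (i + 1) - e i) ^ 2 := by
  by_contra hcon
  have hz : ∀ i ∈ range (m + 1), (e (i + 1) - e i) ^ 2 = 0 :=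
    (sum_eq_zero_iff_of_nonneg fun i _ => sq_nonneg _).1
      (le_antisymm (not_lt.1 hcon) (sum_nonneg fun i _ => sq_nonneg _))
  have hall : ∀ i, i ≤ m + 1 → e i = 0 := by
    intro i
    induction i with
    | zero => exact fun _ => h0
    | succ i ih =>
      intro hi
      have h1 := pow_eq_zero_iff (two_ne_zero) |>.1 (hz i (mem_range.2 (by omega)))
      rw [ih (by omega)] at h1
      linarith
  obtain ⟨i, hi, hne⟩ := hne
  exact hne (hall _ (by omega))

/-- The field of values of the compact pencil, in terms of real and imaginary parts. -/
lemma compact_pencil_neg (p q : ℕ → ℝ) (m : ℕ) (p0 : p 0 = 0) (q0 : q 0 = 0)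
    (pm : p (m + 1) = 0) (qm : q (m + 1) = 0)
    (hne : ∃ i < m, p (i + 1) ≠ 0 ∨ q (i + 1) ≠ 0) (P : ℝ) {n G W : ℝ}
    (hn : n = ∑ i ∈ range m, p (i + 1) ^ 2 + ∑ i ∈ range m, q (i + 1) ^ 2)
    (hG : G = ∑ i ∈ range (m + 1), (p (i + 1) - p i) ^ 2
      + ∑ i ∈ range (m + 1), (q (i + 1) - q i) ^ 2)
    (hW : W = ∑ i ∈ range m, ((q (i + 2) - q i) * p (i + 1) - (p (i + 2) - p i) * q (i + 1))) :
    (n - G / 12) * (-(1 + P ^ 2 / 12) * G) + (P / 24 * W) * (P / 2 * W) < 0 := by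
  have hGpos : 0 < G := by
    have g1 : 0 ≤ ∑ i ∈ range (m + 1), (p (i + 1) - p i) ^ 2 := sum_nonneg fun i _ => sq_nonneg _
    have g2 : 0 ≤ ∑ i ∈ range (m + 1), (q (i + 1) - q i) ^ 2 := sum_nonneg fun i _ => sq_nonneg _
    obtain ⟨i, hi, h | h⟩ := hne
    · have := sum_diff_sq_pos p p0 m ⟨i, hi, h⟩
      linarith
    · have := sum_diff_sq_pos q q0 m ⟨i, hi, h⟩
      linarith
  have hGn : G ≤ 4 * n := by
    have := sum_diff_sq_le p p0 m pm
    have := sum_diff_sq_le q q0 m qm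
    rw [hG, hn]
    linarith
  have np : 0 ≤ ∑ i ∈ range m, p (i + 1) ^ 2 := sum_nonneg fun i _ => sq_nonneg _
  have nq : 0 ≤ ∑ i ∈ range m, q (i + 1) ^ 2 := sum_nonneg fun i _ => sq_nonneg _
  have ep := sum_secondDiff_sq_add p m
  have eq := sum_secondDiff_sq_add q m
  have dp := sum_secondDiff_mul p m
  have dq := sum_secondDiff_mul q m
  rw [p0, pm] at dp
  rw [q0, qm] at dq
  set SX := ∑ i ∈ range m, (p (i + 2) - p i) ^ 2 + ∑ i ∈ range m, (q (i + 2) - q i) ^ 2 with hSX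
  set SD := ∑ i ∈ range m, (p (i + 2) - 2 * p (i + 1) + p i) ^ 2
    + ∑ i ∈ range m, (q (i + 2) - 2 * q (i + 1) + q i) ^ 2 with hSD
  have hn0 : 0 ≤ n := by rw [hn]; linarith
  have hSXD : SX + SD ≤ 4 * G := by
    rw [hSX, hSD, hG]
    linarith [sq_nonneg (p 1 - p 0), sq_nonneg (q 1 - q 0), sq_nonneg (p (m + 1) - p m),
      sq_nonneg (q (m + 1) - q m)]
  have cs : ∀ f g : ℕ → ℝ, (∑ i ∈ range m, (f i * p (i + 1) + g i * q (i + 1))) ^ 2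
      ≤ (∑ i ∈ range m, f i ^ 2 + ∑ i ∈ range m, g i ^ 2) * n := by
    intro f g
    have h1 := sum_mul_sq_le_sq_mul_sq (range m) f (fun i => p (i + 1))
    have h2 := sum_mul_sq_le_sq_mul_sq (range m) g (fun i => q (i + 1))
    have f0 : 0 ≤ ∑ i ∈ range m, f i ^ 2 := sum_nonneg fun i _ => sq_nonneg _
    have g0 : 0 ≤ ∑ i ∈ range m, g i ^ 2 := sum_nonneg fun i _ => sq_nonneg _
    rw [sum_add_distrib, hn]
    set a := ∑ i ∈ range m, f i * p (i + 1)
    set b := ∑ i ∈ range m, g i * q (i + 1)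
    set A := ∑ i ∈ range m, f i ^ 2
    set B := ∑ i ∈ range m, g i ^ 2
    set X := ∑ i ∈ range m, p (i + 1) ^ 2
    set Y := ∑ i ∈ range m, q (i + 1) ^ 2
    have h3 : 2 * (a * b) ≤ A * Y + B * X := by
      refine le_of_sq_le_sq ?_ (by positivity)
      have : (a * b) ^ 2 ≤ (A * X) * (B * Y) := by
        rw [mul_pow]; exact mul_le_mul h1 h2 (sq_nonneg _) (by positivity)
      nlinarith [sq_nonneg (A * Y - B * X)]
    have h5 : (a + b) ^ 2 = a ^ 2 + 2 * (a * b) + b ^ 2 := by ring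
    have h6 : (A + B) * (X + Y) = A * X + (A * Y + B * X) + B * Y := by ring
    rw [h5, h6]
    linarith
  have hWX : W ^ 2 ≤ SX * n := by
    have h := cs (fun i => q (i + 2) - q i) (fun i => -(p (i + 2) - p i))
    simp only [neg_mul, ← sub_eq_add_neg, neg_sq] at h
    rw [← hW] at h
    rw [hSX]
    linarith
  have hGD : G ^ 2 ≤ SD * n := by
    have h := cs (fun i => p (i + 2) - 2 * p (i + 1) + p i)
      (fun i => q (i + 2) - 2 * q (i + 1) + q i)
    rw [sum_add_distrib, dp, dq] at h
    rw [hSD]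
    refine le_trans (le_of_eq ?_) h
    rw [hG]
    ring
  -- Cauchy–Schwarz for the central and for the second differences, W² ≤ SX · n and G² ≤ SD · n,
  -- joined by SX + SD ≤ 4G. This compensates the imaginary parts for every P, which the separate
  -- bound W² ≤ 4nG would not do in this decomposition.
  have hWG : W ^ 2 ≤ 4 * n * G - G ^ 2 := by
    have h := mul_le_mul_of_nonneg_right hSXD hn0
    rw [add_mul] at h
    linarith
  have h1 : 0 < G * (n - G / 12) := mul_pos hGpos (by linarith)
  have h2 := mul_nonneg (sq_nonneg P) (sub_nonneg.2 hWG)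
  have h3 := mul_nonneg (sq_nonneg P) (sq_nonneg G)
  have h4 : (n - G / 12) * (-(1 + P ^ 2 / 12) * G) + (P / 24 * W) * (P / 2 * W)
      = -(G * (n - G / 12)) - 1 / 48 * (P ^ 2 * (4 * n * G - G ^ 2 - W ^ 2))
        - 1 / 72 * (P ^ 2 * G ^ 2) := by ring
  rw [h4]
  linarith

/-- Extension by zero of a vector of interior grid values. -/
noncomputable def zeroExtend {m : ℕ} (z : EuclideanSpace ℂ (Fin m)) (i : ℕ) : ℂ :=
  if h : i - 1 < m ∧ i ≠ 0 then z ⟨i - 1, h.1⟩ else 0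

lemma zeroExtend_zero {m : ℕ} (z : EuclideanSpace ℂ (Fin m)) : zeroExtend z 0 = 0 := by
  simp [zeroExtend]

lemma zeroExtend_last {m : ℕ} (z : EuclideanSpace ℂ (Fin m)) : zeroExtend z (m + 1) = 0 := by
  simp [zeroExtend]

lemma zeroExtend_succ {m : ℕ} (z : EuclideanSpace ℂ (Fin m)) (i : Fin m) :
    zeroExtend z (i + 1) = z i := by
  simp [zeroExtend]

lemma zeroExtend_add {m : ℕ} (x y : EuclideanSpace ℂ (Fin m)) (i : ℕ) :
    zeroExtend (x + y) i = zeroExtend x i + zeroExtend y i := by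
  simp only [zeroExtend]; split_ifs <;> simp

lemma zeroExtend_smul {m : ℕ} (c : ℂ) (x : EuclideanSpace ℂ (Fin m)) (i : ℕ) :
    zeroExtend (c • x) i = c * zeroExtend x i := by
  simp only [zeroExtend]; split_ifs <;> simp

/-- The operator `κ + β Δ + δ X` on interior grid values, with `Δ` and `X` the unscaled second and
central differences. -/
noncomputable def stencilOp (m : ℕ) (κ β δ : ℝ) :
    EuclideanSpace ℂ (Fin m) →ₗ[ℂ] EuclideanSpace ℂ (Fin m) where
  toFun z := WithLp.toLp 2 fun i : Fin m => (κ : ℂ) * zeroExtend z (i + 1)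
    + β * (zeroExtend z (i + 2) - 2 * zeroExtend z (i + 1) + zeroExtend z i)
    + δ * (zeroExtend z (i + 2) - zeroExtend z i)
  map_add' x y := by
    ext i
    simp only [zeroExtend_add, PiLp.add_apply]
    ring
  map_smul' c x := by
    ext i
    simp only [zeroExtend_smul, PiLp.smul_apply, smul_eq_mul, RingHom.id_apply]
    ring

lemma stencilOp_apply {m : ℕ} (κ β δ : ℝ) (z : EuclideanSpace ℂ (Fin m)) (i : Fin m) :
    stencilOp m κ β δ z i = (κ : ℂ) * zeroExtend z (i + 1)
    + β * (zeroExtend z (i + 2) - 2 * zeroExtend z (i + 1) + zeroExtend z i)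
    + δ * (zeroExtend z (i + 2) - zeroExtend z i) := rfl

/-- The symmetric parts κ and β contribute only to the real part and the skew part δ only to the
imaginary part. -/
lemma inner_stencilOp {m : ℕ} (κ β δ : ℝ) (z : EuclideanSpace ℂ (Fin m)) {p q : ℕ → ℝ}
    (hp : ∀ i, p i = (zeroExtend z i).re) (hq : ∀ i, q i = (zeroExtend z i).im) :
    (inner ℂ z (stencilOp m κ β δ z)).re
      = κ * (∑ i ∈ range m, p (i + 1) ^ 2 + ∑ i ∈ range m, q (i + 1) ^ 2)
        - β * (∑ i ∈ range (m + 1), (p (i + 1) - p i) ^ 2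
          + ∑ i ∈ range (m + 1), (q (i + 1) - q i) ^ 2) ∧
    (inner ℂ z (stencilOp m κ β δ z)).im
      = δ * ∑ i ∈ range m, ((q (i + 2) - q i) * p (i + 1) - (p (i + 2) - p i) * q (i + 1)) := by
  have p0 : p 0 = 0 := by rw [hp, zeroExtend_zero]; rfl
  have q0 : q 0 = 0 := by rw [hq, zeroExtend_zero]; rfl
  have pm : p (m + 1) = 0 := by rw [hp, zeroExtend_last]; rfl
  have qm : q (m + 1) = 0 := by rw [hq, zeroExtend_last]; rfl
  have e1 := sum_secondDiff_mul p m
  have e2 := sum_secondDiff_mul q m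
  have e3 := sum_centralDiff_mul p m
  have e4 := sum_centralDiff_mul q m
  rw [p0, pm] at e1 e3
  rw [q0, qm] at e2 e4
  have e5 : ∑ i ∈ range m, ((q (i + 2) - 2 * q (i + 1) + q i) * p (i + 1)
      - (p (i + 2) - 2 * p (i + 1) + p i) * q (i + 1)) = 0 := by
    have : ∀ k, ∑ i ∈ range k, ((q (i + 2) - 2 * q (i + 1) + q i) * p (i + 1)
      - (p (i + 2) - 2 * p (i + 1) + p i) * q (i + 1))
        = q (k + 1) * p k - p (k + 1) * q k - (q 1 * p 0 - p 1 * q 0) := by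
      intro k
      induction k with
      | zero => simp
      | succ k ih => rw [sum_range_succ, ih]; ring
    rw [this, p0, q0, pm, qm]
    ring
  have hin : inner ℂ z (stencilOp m κ β δ z)
      = ∑ i ∈ range m, ((κ : ℂ) * zeroExtend z (i + 1)
    + β * (zeroExtend z (i + 2) - 2 * zeroExtend z (i + 1) + zeroExtend z i)
    + δ * (zeroExtend z (i + 2) - zeroExtend z i)) * (starRingEnd ℂ) (zeroExtend z (i + 1)) := by
    rw [PiLp.inner_apply, ← Fin.sum_univ_eq_sum_range (fun i => ((κ : ℂ) * zeroExtend z (i + 1)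
    + β * (zeroExtend z (i + 2) - 2 * zeroExtend z (i + 1) + zeroExtend z i)
    + δ * (zeroExtend z (i + 2) - zeroExtend z i)) * (starRingEnd ℂ) (zeroExtend z (i + 1)))]
    refine sum_congr rfl fun i _ => ?_
    rw [RCLike.inner_apply, stencilOp_apply, zeroExtend_succ]
  constructor
  · rw [hin, Complex.re_sum]
    calc _ = ∑ i ∈ range m, (κ * (p (i + 1) ^ 2 + q (i + 1) ^ 2)
          + β * ((p (i + 2) - 2 * p (i + 1) + p i) * p (i + 1)
            + (q (i + 2) - 2 * q (i + 1) + q i) * q (i + 1))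
          + δ * ((p (i + 2) - p i) * p (i + 1) + (q (i + 2) - q i) * q (i + 1))) := by
          refine sum_congr rfl fun i _ => ?_
          simp only [hp, hq]
          simp
          ring
      _ = _ := by
          rw [sum_add_distrib, sum_add_distrib, ← mul_sum, ← mul_sum, ← mul_sum, sum_add_distrib,
            sum_add_distrib, sum_add_distrib, e1, e2, e3, e4]
          ring
  · rw [hin, Complex.im_sum]
    calc _ = ∑ i ∈ range m, (β * ((q (i + 2) - 2 * q (i + 1) + q i) * p (i + 1)
            - (p (i + 2) - 2 * p (i + 1) + p i) * q (i + 1))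
          + δ * ((q (i + 2) - q i) * p (i + 1) - (p (i + 2) - p i) * q (i + 1))) := by
          refine sum_congr rfl fun i _ => ?_
          simp only [hp, hq]
          simp
          ring
      _ = _ := by
          rw [sum_add_distrib, ← mul_sum, ← mul_sum, e5]
          ring

lemma compact_pencil_inner_neg {m : ℕ} (P : ℝ) (z : EuclideanSpace ℂ (Fin m)) (hz : z ≠ 0) :
    (inner ℂ z (stencilOp m 1 (1 / 12) (P / 24) z)).re
        * (inner ℂ z (stencilOp m 0 (1 + P ^ 2 / 12) (P / 2) z)).re
      + (inner ℂ z (stencilOp m 1 (1 / 12) (P / 24) z)).im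
        * (inner ℂ z (stencilOp m 0 (1 + P ^ 2 / 12) (P / 2) z)).im < 0 := by
  set p : ℕ → ℝ := fun i => (zeroExtend z i).re with hp
  set q : ℕ → ℝ := fun i => (zeroExtend z i).im with hq
  obtain ⟨a1, a2⟩ := inner_stencilOp 1 (1 / 12) (P / 24) z (p := p) (q := q)
    (fun _ => rfl) (fun _ => rfl)
  obtain ⟨b1, b2⟩ := inner_stencilOp 0 (1 + P ^ 2 / 12) (P / 2) z (p := p) (q := q)
    (fun _ => rfl) (fun _ => rfl)
  have hne : ∃ i < m, p (i + 1) ≠ 0 ∨ q (i + 1) ≠ 0 := by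
    by_contra hcon
    push Not at hcon
    refine hz ?_
    ext i
    have h := hcon i i.2
    rw [← zeroExtend_succ]
    exact Complex.ext h.1 h.2
  have key := compact_pencil_neg p q m (by simp [hp, zeroExtend_zero])
    (by simp [hq, zeroExtend_zero]) (by simp [hp, zeroExtend_last])
    (by simp [hq, zeroExtend_last]) hne P rfl rfl rfl
  rw [a1, a2, b1, b2]
  refine lt_of_eq_of_lt ?_ key
  ring

/-- With no restriction on P, but with a constant depending on the grid: the Lyapunov norm of the
Cayley transform is composed with the averaging operator. -/
lemma exists_isSpaceStable {a c h : ℝ} (b : ℝ) (ha : 0 < a) (hc : 0 ≤ c) (hh : 0 < h) {m : ℕ}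
    (hm : m ≠ 0) : ∃ μ, IsSpaceStable a b c h m μ := by
  have : Nonempty (Fin m) := ⟨⟨0, Nat.pos_of_ne_zero hm⟩⟩
  have : Nontrivial (EuclideanSpace ℂ (Fin m)) := inferInstance
  set P := b * h / a with hP
  set H := stencilOp m 1 (1 / 12) (P / 24) with hH
  set L := stencilOp m 0 (1 + P ^ 2 / 12) (P / 2) with hL
  have hneg := fun z hz => compact_pencil_inner_neg (m := m) P z hz
  obtain ⟨F, i1, i2, J, hJ1, hJ2⟩ := exists_lyapunov H L hneg
  have hinj : LinearMap.ker H = ⊥ := by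
    rw [LinearMap.ker_eq_bot']
    intro z hz
    by_contra hz0
    have h1 := hneg z hz0
    rw [← hH, hz] at h1
    simp at h1
  obtain ⟨κ, -, hκ⟩ := H.exists_antilipschitzWith hinj
  let embed : (ℕ → ℝ) →ₗ[ℝ] EuclideanSpace ℂ (Fin m) :=
    { toFun := fun x => WithLp.toLp 2 fun i : Fin m => (x (i + 1) : ℂ)
      map_add' := fun x y => by ext i; simp
      map_smul' := fun r x => by ext i; simp }
  have hemb : ∀ x i, embed x i = (x (i + 1) : ℂ) := fun _ _ => rfl
  have hnorm : ∀ x, ‖embed x‖ = Real.sqrt (∑ i ∈ range m, x (i + 1) ^ 2) := by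
    intro x
    rw [EuclideanSpace.norm_eq, ← Fin.sum_univ_eq_sum_range (fun i => x (i + 1) ^ 2)]
    simp only [hemb, Complex.norm_real, Real.norm_eq_abs, sq_abs]
  have hext : ∀ x : ℕ → ℝ, x 0 = 0 → x (m + 1) = 0 → ∀ i ≤ m + 1,
      zeroExtend (embed x) i = (x i : ℂ) := by
    intro x h0 hm1 i hi
    rcases Nat.eq_zero_or_pos i with rfl | hpos
    · rw [zeroExtend_zero, h0]; simp
    obtain ⟨j, rfl⟩ : ∃ j, i = j + 1 := ⟨i - 1, by omega⟩
    rcases Nat.lt_or_ge j m with hj | hj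
    · have := zeroExtend_succ (embed x) ⟨j, hj⟩
      simpa [hemb] using this
    · obtain rfl : j = m := by omega
      rw [zeroExtend_last, hm1]; simp
  have hHx : ∀ x : ℕ → ℝ, x 0 = 0 → x (m + 1) = 0 → ∀ i : Fin m,
      H (embed x) i = (averageOp a b h x (i + 1) : ℂ) := by
    intro x h0 hm1 i
    have hi := i.2
    rw [hH, stencilOp_apply, hext x h0 hm1 _ (by omega), hext x h0 hm1 _ (by omega),
      hext x h0 hm1 _ (by omega), averageOp_succ b ha.ne' hh.ne', ← hP]
    push_cast
    ring
  have hLx : ∀ x : ℕ → ℝ, x 0 = 0 → x (m + 1) = 0 → ∀ i : Fin m,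
      ((a / h ^ 2 : ℝ) • L (embed x)) i = (fluxOp a b h x (i + 1) : ℂ) := by
    intro x h0 hm1 i
    have hi := i.2
    rw [PiLp.smul_apply, hL, stencilOp_apply, hext x h0 hm1 _ (by omega),
      hext x h0 hm1 _ (by omega), hext x h0 hm1 _ (by omega), fluxOp_succ b ha.ne' hh.ne',
      ← hP, Complex.real_smul]
    push_cast
    ring
  let _ : InnerProductSpace ℝ F := InnerProductSpace.complexToReal
  let Jr : (ℕ → ℝ) →ₗ[ℝ] F :=
    (J.toLinearMap.restrictScalars ℝ) ∘ₗ (H.restrictScalars ℝ) ∘ₗ embed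
  have hJr : ∀ x, Jr x = J (H (embed x)) := fun _ => rfl
  -- The constant κ inverts the averaging operator, for the norm bound; ‖J‖ controls the residual
  -- term.
  refine ⟨max (κ : ℝ) ‖J‖, F, i1, inferInstance, Jr, ?_, ?_⟩
  · intro x _ _
    have h1 := hκ.le_mul_dist (embed x) 0
    rw [map_zero, dist_zero_right, dist_zero_right, hnorm] at h1
    rw [hJr]
    exact h1.trans (mul_le_mul (le_max_left _ _) (hJ1 _) (norm_nonneg _)
      (le_max_of_le_right (norm_nonneg _)))
  · intro x y R hx0 hxm hy0 hym he
    have hvec : H (embed y) = (a / h ^ 2 : ℝ) • L (embed x) - c • H (embed x)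
        + embed (fun i => R (i - 1)) := by
      ext i
      rw [PiLp.add_apply, PiLp.sub_apply, hLx x hx0 hxm, PiLp.smul_apply, hHx x hx0 hxm,
        hHx y hy0 hym, hemb, he i i.2, Complex.real_smul]
      push_cast
      simp
    have hJreal : ∀ (r : ℝ) z, J (r • z) = r • J z := fun r z => by
      rw [← Complex.coe_smul, map_smul, Complex.coe_smul]
    rw [hJr, hJr, hvec, map_add, map_sub, hJreal, hJreal, inner_add_left, inner_sub_left,
      real_inner_smul_left, real_inner_smul_left]
    have h1 : inner ℝ (J (L (embed x))) (J (H (embed x))) ≤ 0 := by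
      refine inner_nonpos_of_norm_add_le ?_
      rw [← map_add, ← map_sub]
      exact hJ2 _
    have h2 : 0 ≤ c * inner ℝ (J (H (embed x))) (J (H (embed x))) :=
      mul_nonneg hc real_inner_self_nonneg
    have h3 : a / h ^ 2 * inner ℝ (J (L (embed x))) (J (H (embed x))) ≤ 0 :=
      mul_nonpos_of_nonneg_of_nonpos (by positivity) h1
    have h4 : inner ℝ (J (embed (fun i => R (i - 1)))) (J (H (embed x)))
        ≤ max (κ : ℝ) ‖J‖ * Real.sqrt (∑ i ∈ range m, R i ^ 2) * ‖J (H (embed x))‖ := by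
      refine (real_inner_le_norm _ _).trans ?_
      gcongr
      refine (J.le_opNorm _).trans ?_
      rw [hnorm]
      simp only [Nat.add_sub_cancel]
      gcongr
      exact le_max_right _ _
    linarith

/-- Stability of the compact scheme, uniformly in the number of grid cells. -/
lemma exists_uniform_isSpaceStable {a c xl xr : ℝ} (b : ℝ) (ha : 0 < a) (hc : 0 ≤ c)
    (hx : xl < xr) :
    ∃ μ, 0 ≤ μ ∧ ∀ M : ℕ, 2 ≤ M → IsSpaceStable a b c (spaceStep xl xr M) (M - 1) μ := by
  have hpos : ∀ M : ℕ, 2 ≤ M → 0 < spaceStep xl xr M := fun M hM =>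
    div_pos (by linarith) (by exact_mod_cast (by omega : 0 < M))
  have hex : ∀ M : ℕ, ∃ μ, 2 ≤ M → IsSpaceStable a b c (spaceStep xl xr M) (M - 1) μ := by
    intro M
    by_cases hM : 2 ≤ M
    · obtain ⟨μ, hμ⟩ := exists_isSpaceStable b ha hc (hpos M hM) (m := M - 1) (by omega)
      exact ⟨μ, fun _ => hμ⟩
    · exact ⟨0, fun h => absurd h hM⟩
  choose μ hμ using hex
  -- From M0 on the mesh Péclet number is at most 1. The finitely many coarser grids have their own
  -- constants, which are summed.
  obtain ⟨M0, hM0⟩ := exists_nat_ge (|b| * (xr - xl) / a)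
  have hsum : 0 ≤ ∑ M ∈ range M0, |μ M| := sum_nonneg fun _ _ => abs_nonneg _
  refine ⟨3 / 2 + ∑ M ∈ range M0, |μ M|, by linarith, fun M hM => ?_⟩
  rcases Nat.lt_or_ge M M0 with hlt | hge
  · refine (hμ M hM).mono ?_
    have := single_le_sum (f := fun M => |μ M|) (fun _ _ => abs_nonneg _) (mem_range.2 hlt)
    have h2 := le_abs_self (μ M)
    linarith
  · have hMpos : (0 : ℝ) < M := by exact_mod_cast (by omega : 0 < M)
    refine (isSpaceStable_of_small ha hc (hpos M hM) ?_ (M - 1)).mono (by linarith)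
    rw [spaceStep, abs_div, abs_mul, abs_div, abs_of_pos ha, abs_of_pos hMpos,
      abs_of_pos (by linarith : 0 < xr - xl), div_le_one ha, ← mul_div_assoc, div_le_iff₀ hMpos]
    rw [div_le_iff₀ ha] at hM0
    have : (M0 : ℝ) ≤ M := by exact_mod_cast hge
    nlinarith

end TFBS

namespace TFBS

open Finset Filter Topology

/-! ### Spatial truncation error -/

/-- Taylor expansion with an absolute remainder estimate. -/
lemma abs_sub_taylor_le {l u c K : ℝ} (hK : 0 ≤ K) (hc : c ∈ Set.Icc l u) (n : ℕ) :
    ∀ D : ℕ → ℝ → ℝ, (∀ m < n, ∀ y ∈ Set.Icc l u, HasDerivAt (D m) (D (m + 1) y) y) →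
      (∀ y ∈ Set.Icc l u, |D n y| ≤ K) → ∀ x ∈ Set.Icc l u,
      |D 0 x - ∑ m ∈ range n, D m c * (x - c) ^ m / (m.factorial : ℝ)| ≤ K * |x - c| ^ n := by
  induction n with
  | zero =>
    intro D _ hb x hx
    simpa using hb x hx
  | succ n ih =>
    intro D hd hb x hx
    have h1 := ih (fun m => D (m + 1)) (fun m hm => hd (m + 1) (by omega)) hb
    have hder : ∀ y ∈ Set.Icc l u, HasDerivAt
        (fun y => D 0 y - ∑ m ∈ range n, D (m + 1) c * (y - c) ^ (m + 1) / ((m + 1).factorial : ℝ))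
        (D 1 y - ∑ m ∈ range n, D (m + 1) c * (y - c) ^ m / (m.factorial : ℝ)) y := by
      intro y hy
      refine (hd 0 (by omega) y hy).sub (HasDerivAt.fun_sum fun m _ => ?_)
      have h2 := ((((hasDerivAt_id y).sub_const c).pow (m + 1)).const_mul
        (D (m + 1) c)).div_const ((m + 1).factorial : ℝ)
      refine h2.congr_deriv ?_
      rw [Nat.factorial_succ]
      have : (m.factorial : ℝ) ≠ 0 := by exact_mod_cast m.factorial_ne_zero
      push_cast
      simp only [id]
      field_simp
    have h3 := abs_sub_le_pow_succ (k := n)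
      (fun y hy => (hder y hy).continuousAt.continuousWithinAt)
      (fun y hy => hder y (Set.Ioo_subset_Icc_self hy)) hK hc
      (fun y hy => h1 y (Set.Ioo_subset_Icc_self hy)) hx
    refine le_trans (le_of_eq ?_) h3
    congr 1
    rw [sum_range_succ']
    simp
    ring

/-- The averaging stencil of the compact scheme with mesh Péclet number `P`. -/
noncomputable def averageStencil (P h : ℝ) (g : ℝ → ℝ) (x : ℝ) : ℝ :=
  g x + (g (x + h) - 2 * g x + g (x - h)) / 12 + P / 24 * (g (x + h) - g (x - h))

/-- The flux stencil of the compact scheme with mesh Péclet number `P`. -/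
noncomputable def fluxStencil (a P h : ℝ) (v : ℝ → ℝ) (x : ℝ) : ℝ :=
  a / h ^ 2 * ((1 + P ^ 2 / 12) * (v (x + h) - 2 * v x + v (x - h)) + P / 2 * (v (x + h) - v (x - h)))

lemma abs_mul_le_mul {x y X Y : ℝ} (hx : |x| ≤ X) (hy : |y| ≤ Y) : |x * y| ≤ X * Y := by
  rw [abs_mul]
  exact mul_le_mul hx hy (abs_nonneg _) ((abs_nonneg _).trans hx)

/-- The averaging of a u'' + b u' and the additional diffusion h²b²/(12a) are matched so that all
Taylor terms below order h⁴ cancel. Two explicit terms of order h⁴, with u⁗ and u⁽⁵⁾, and Taylor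
remainders are left. -/
lemma compact_truncation_interior {a b h K Q x : ℝ} (ha : 0 < a) (hh : 0 < h) (hK : 0 ≤ K)
    (hQ : |b * h / a| ≤ Q) {D : ℕ → ℝ → ℝ}
    (hd : ∀ m < 6, ∀ y ∈ Set.Icc (x - h) (x + h), HasDerivAt (D m) (D (m + 1) y) y)
    (hb : ∀ m, 3 ≤ m → m ≤ 6 → ∀ y ∈ Set.Icc (x - h) (x + h), |D m y| ≤ K) :
    |averageStencil (b * h / a) h (fun y => a * D 2 y + b * D 1 y) x
      - fluxStencil a (b * h / a) h (D 0) x|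
      ≤ (a * (3 + 2 * Q + Q ^ 2) + |b| * (1 + Q) + b ^ 2 / a) * K * h ^ 4 := by
  have hx : x ∈ Set.Icc (x - h) (x + h) := ⟨by linarith, by linarith⟩
  have hr : x + h ∈ Set.Icc (x - h) (x + h) := ⟨by linarith, le_rfl⟩
  have hl : x - h ∈ Set.Icc (x - h) (x + h) := ⟨le_rfl, by linarith⟩
  have hplus : x + h - x = h := by ring
  have hminus : x - h - x = -h := by ring
  have E1 := abs_sub_taylor_le hK hx 6 D hd (hb 6 (by norm_num) le_rfl) _ hr
  have E2 := abs_sub_taylor_le hK hx 6 D hd (hb 6 (by norm_num) le_rfl) _ hl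
  have F1 := abs_sub_taylor_le hK hx 4 (fun m => D (m + 2)) (fun m hm => hd (m + 2) (by omega))
    (hb 6 (by norm_num) le_rfl) _ hr
  have F2 := abs_sub_taylor_le hK hx 4 (fun m => D (m + 2)) (fun m hm => hd (m + 2) (by omega))
    (hb 6 (by norm_num) le_rfl) _ hl
  have H1 := abs_sub_taylor_le hK hx 4 (fun m => D (m + 1)) (fun m hm => hd (m + 1) (by omega))
    (hb 5 (by norm_num) (by norm_num)) _ hr
  have H2 := abs_sub_taylor_le hK hx 4 (fun m => D (m + 1)) (fun m hm => hd (m + 1) (by omega))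
    (hb 5 (by norm_num) (by norm_num)) _ hl
  rw [hplus, abs_of_pos hh] at E1 F1 H1
  rw [hminus, abs_neg, abs_of_pos hh] at E2 F2 H2
  have W4 := hb 4 (by norm_num) (by norm_num) x hx
  have W5 := hb 5 (by norm_num) (by norm_num) x hx
  simp only [sum_range_succ, sum_range_zero, Nat.factorial, zero_add] at E1 E2 F1 F2 H1 H2
  norm_num at E1 E2 F1 F2 H1 H2
  set P := b * h / a with hP
  have hK4 : 0 ≤ K * h ^ 4 := by positivity
  have hQ0 : 0 ≤ Q := (abs_nonneg _).trans hQ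
  have hh2 : 0 < h ^ 2 := by positivity
  have scale : ∀ z, |z| ≤ K * h ^ 6 → |z / h ^ 2| ≤ K * h ^ 4 := by
    intro z hz
    rw [abs_div, abs_of_pos hh2, div_le_iff₀ hh2]
    linarith [show K * h ^ 4 * h ^ 2 = K * h ^ 6 by ring]
  replace E1 := scale _ E1
  replace E2 := scale _ E2
  have w4 : |h ^ 4 * D 4 x| ≤ K * h ^ 4 := by
    rw [abs_mul, abs_of_pos (by positivity)]; nlinarith [pow_pos hh 4]
  have w5 : |h ^ 4 * D 5 x| ≤ K * h ^ 4 := by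
    rw [abs_mul, abs_of_pos (by positivity)]; nlinarith [pow_pos hh 4]
  set k := K * h ^ 4 with hk
  set e1 := (D 0 (x + h) - _) / h ^ 2 with he1
  set e2 := (D 0 (x - h) - _) / h ^ 2 with he2
  set f1 := D 2 (x + h) - _ with hf1
  set f2 := D 2 (x - h) - _ with hf2
  set g1 := D 1 (x + h) - _ with hg1
  set g2 := D 1 (x - h) - _ with hg2
  have key : averageStencil P h (fun y => a * D 2 y + b * D 1 y) x - fluxStencil a P h (D 0) x
      = a * ((f1 + f2) / 12 + P * ((f1 - f2) / 24) - (1 + P ^ 2 / 12) * (e1 + e2)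
          - P * ((e1 - e2) / 2))
        + b * ((g1 + g2) / 12 + P * ((g1 - g2) / 24) + (h ^ 4 * D 5 x) * (1 / 72 - 1 / 120))
        + b ^ 2 / a * ((h ^ 4 * D 4 x) * (1 / 72 - 1 / 144)) := by
    rw [averageStencil, fluxStencil, he1, he2, hf1, hf2, hg1, hg2, hP]
    field_simp
    ring
  have hP2 : P ^ 2 ≤ Q ^ 2 := by rw [← sq_abs]; gcongr
  have b1 : |(f1 + f2) / 12 + P * ((f1 - f2) / 24) - (1 + P ^ 2 / 12) * (e1 + e2)
      - P * ((e1 - e2) / 2)| ≤ (3 + 2 * Q + Q ^ 2) * k := by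
    have t1 : |P * ((f1 - f2) / 24)| ≤ Q * (k / 12) := abs_mul_le_mul hQ (by
      rw [abs_le] at *; constructor <;> linarith [F1.1, F1.2, F2.1, F2.2])
    have t2 : |P * ((e1 - e2) / 2)| ≤ Q * k := abs_mul_le_mul hQ (by
      rw [abs_le] at *; constructor <;> linarith [E1.1, E1.2, E2.1, E2.2])
    have t3 : |(1 + P ^ 2 / 12) * (e1 + e2)| ≤ (1 + Q ^ 2 / 12) * (2 * k) := abs_mul_le_mul
      (by rw [abs_of_nonneg (by positivity)]; linarith) (by
      rw [abs_le] at *; constructor <;> linarith [E1.1, E1.2, E2.1, E2.2])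
    have t4 : 0 ≤ Q * k := by positivity
    have t5 : 0 ≤ Q ^ 2 * k := by positivity
    rw [abs_le] at *
    constructor <;> linarith [F1.1, F1.2, F2.1, F2.2, t1.1, t1.2, t2.1, t2.2, t3.1, t3.2]
  have b2 : |(g1 + g2) / 12 + P * ((g1 - g2) / 24) + (h ^ 4 * D 5 x) * (1 / 72 - 1 / 120)|
      ≤ (1 + Q) * k := by
    have t1 : |P * ((g1 - g2) / 24)| ≤ Q * (k / 12) := abs_mul_le_mul hQ (by
      rw [abs_le] at *; constructor <;> linarith [H1.1, H1.2, H2.1, H2.2])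
    have t4 : 0 ≤ Q * k := by positivity
    rw [abs_le] at *
    constructor <;> linarith [H1.1, H1.2, H2.1, H2.2, t1.1, t1.2, w5.1, w5.2]
  have b3 : |(h ^ 4 * D 4 x) * (1 / 72 - 1 / 144)| ≤ k := by
    rw [abs_le] at *
    constructor <;> linarith [w4.1, w4.2]
  have c1 := abs_mul_le_mul (abs_of_pos ha).le b1
  have c2 := abs_mul_le_mul (le_refl |b|) b2
  have c3 := abs_mul_le_mul (abs_of_nonneg (by positivity : 0 ≤ b ^ 2 / a)).le b3
  rw [key]
  refine (abs_add_three _ _ _).trans ?_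
  rw [mul_assoc _ K, ← hk]
  linarith

lemma second_difference_interior {x h B : ℝ} (hh : 0 < h) {w w1 w2 : ℝ → ℝ}
    (h1 : ∀ y ∈ Set.Icc (x - h) (x + h), HasDerivAt w (w1 y) y)
    (h2 : ∀ y ∈ Set.Icc (x - h) (x + h), HasDerivAt w1 (w2 y) y)
    (hb : ∀ y ∈ Set.Icc (x - h) (x + h), |w2 y| ≤ B) :
    |w (x + h) - 2 * w x + w (x - h)| ≤ 2 * B * h ^ 2 := by
  have hx : x ∈ Set.Icc (x - h) (x + h) := ⟨by linarith, by linarith⟩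
  have hB : 0 ≤ B := (abs_nonneg _).trans (hb x hx)
  have E : ∀ y ∈ Set.Icc (x - h) (x + h), |w y - w x - w1 x * (y - x)| ≤ B * |y - x| ^ 2 := by
    intro y hy
    have := abs_sub_taylor_le hB hx 2 (fun m => if m = 0 then w else if m = 1 then w1 else w2)
      (fun m hm z hz => by
        interval_cases m
        · simpa using h1 z hz
        · simpa using h2 z hz) (by simpa using hb) y hy
    simp only [sum_range_succ, sum_range_zero] at this
    norm_num at this
    rwa [← sub_sub, ← sq_abs (y - x)] at this
  have e1 := E (x + h) ⟨by linarith, le_rfl⟩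
  have e2 := E (x - h) ⟨le_rfl, by linarith⟩
  rw [sq_abs] at e1 e2
  rw [abs_le] at *
  constructor <;> nlinarith [e1.1, e1.2, e2.1, e2.2]

section Endpoint

variable {xl xr x h : ℝ} {F : ℝ → ℝ}

lemma tendsto_comp_add_left (hF : ContinuousOn F (Set.Icc xl xr)) (hh : 0 < h) (hl : xl ≤ x - h)
    (hr : x + h ≤ xr) : Tendsto (fun k => F (x + k)) (𝓝[Set.Ioo 0 h] h) (𝓝 (F (x + h))) := by
  refine (hF (x + h) ⟨by linarith, hr⟩).tendsto.comp (tendsto_nhdsWithin_iff.2 ⟨?_, ?_⟩)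
  · exact (Continuous.tendsto (by fun_prop : Continuous fun k => x + k) h).mono_left
      nhdsWithin_le_nhds
  · filter_upwards [self_mem_nhdsWithin] with k hk
    exact ⟨by linarith [hk.1], by linarith [hk.2]⟩

lemma tendsto_comp_sub_left (hF : ContinuousOn F (Set.Icc xl xr)) (hh : 0 < h) (hl : xl ≤ x - h)
    (hr : x + h ≤ xr) : Tendsto (fun k => F (x - k)) (𝓝[Set.Ioo 0 h] h) (𝓝 (F (x - h))) := by
  refine (hF (x - h) ⟨hl, by linarith⟩).tendsto.comp (tendsto_nhdsWithin_iff.2 ⟨?_, ?_⟩)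
  · exact (Continuous.tendsto (by fun_prop : Continuous fun k => x - k) h).mono_left
      nhdsWithin_le_nhds
  · filter_upwards [self_mem_nhdsWithin] with k hk
    exact ⟨by linarith [hk.2], by linarith [hk.1]⟩

lemma neBot_nhdsWithin_Ioo (hh : 0 < h) : (𝓝[Set.Ioo 0 h] h).NeBot :=
  right_nhdsWithin_Ioo_neBot hh

lemma tendsto_id_nhdsWithin_Ioo : Tendsto (fun k : ℝ => k) (𝓝[Set.Ioo 0 h] h) (𝓝 h) :=
  tendsto_id.mono_left nhdsWithin_le_nhds

end Endpoint

/-- Truncation error of the compact scheme, up to the boundary of the space interval. -/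
lemma compact_truncation {a b h K Q x xl xr : ℝ} (ha : 0 < a) (hh : 0 < h) (hK : 0 ≤ K)
    (hQ : |b * h / a| ≤ Q) (hl : xl ≤ x - h) (hr : x + h ≤ xr) {D : ℕ → ℝ → ℝ} {G : ℝ → ℝ}
    (hG : ContinuousOn G (Set.Icc xl xr)) (hD : ContinuousOn (D 0) (Set.Icc xl xr))
    (hGD : ∀ y ∈ Set.Ioo xl xr, G y = a * D 2 y + b * D 1 y)
    (hd : ∀ m < 6, ∀ y ∈ Set.Ioo xl xr, HasDerivAt (D m) (D (m + 1) y) y)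
    (hb : ∀ m, 3 ≤ m → m ≤ 6 → ∀ y ∈ Set.Ioo xl xr, |D m y| ≤ K) :
    |averageStencil (b * h / a) h G x - fluxStencil a (b * h / a) h (D 0) x|
      ≤ (a * (3 + 2 * Q + Q ^ 2) + |b| * (1 + Q) + b ^ 2 / a) * K * h ^ 4 := by
  have := neBot_nhdsWithin_Ioo hh
  have hQ0 : 0 ≤ Q := (abs_nonneg _).trans hQ
  have hk := tendsto_id_nhdsWithin_Ioo (h := h)
  have gp := tendsto_comp_add_left hG hh hl hr
  have gm := tendsto_comp_sub_left hG hh hl hr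
  have dp := tendsto_comp_add_left hD hh hl hr
  have dm := tendsto_comp_sub_left hD hh hl hr
  have hP : Tendsto (fun k => b * k / a) (𝓝[Set.Ioo 0 h] h) (𝓝 (b * h / a)) :=
    (hk.const_mul b).div_const a
  have t1 : Tendsto (fun k => averageStencil (b * k / a) k G x) (𝓝[Set.Ioo 0 h] h)
      (𝓝 (averageStencil (b * h / a) h G x)) :=
    (((gp.sub_const _).add gm).div_const 12 |>.const_add _).add
      ((hP.div_const 24).mul (gp.sub gm))
  have t2 : Tendsto (fun k => fluxStencil a (b * k / a) k (D 0) x) (𝓝[Set.Ioo 0 h] h)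
      (𝓝 (fluxStencil a (b * h / a) h (D 0) x)) :=
    (tendsto_const_nhds.div (hk.pow 2) (by positivity)).mul
      ((((hP.pow 2).div_const 12 |>.const_add 1).mul ((dp.sub_const _).add dm)).add
        ((hP.div_const 2).mul (dp.sub dm)))
  -- Next to the boundary the stencil touches an end point, where nothing is assumed on derivatives.
  -- Stencils of width k < h stay inside, and k ↑ h uses only the continuity of `G` and `D 0`.
  refine le_of_tendsto_of_tendsto (t1.sub t2).abs ((hk.pow 4).const_mul _) ?_
  filter_upwards [self_mem_nhdsWithin] with k hk
  have hsub : Set.Icc (x - k) (x + k) ⊆ Set.Ioo xl xr := fun y hy =>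
    ⟨by linarith [hy.1, hk.2], by linarith [hy.2, hk.2]⟩
  have hQk : |b * k / a| ≤ Q := by
    refine le_trans ?_ hQ
    rw [abs_div, abs_div, abs_mul, abs_mul, abs_of_pos hk.1, abs_of_pos hh]
    have := hk.2.le
    gcongr
  have key := compact_truncation_interior ha hk.1 hK hQk (fun m hm y hy => hd m hm y (hsub hy))
    (fun m h3 h6 y hy => hb m h3 h6 y (hsub hy))
  have e : averageStencil (b * k / a) k G x
      = averageStencil (b * k / a) k (fun y => a * D 2 y + b * D 1 y) x := by
    have hk0 := hk.1
    rw [averageStencil, averageStencil, hGD x (hsub ⟨by linarith, by linarith⟩),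
      hGD (x + k) (hsub ⟨by linarith, le_rfl⟩), hGD (x - k) (hsub ⟨le_rfl, by linarith⟩)]
  rw [e]
  exact key

/-- Second differences of a function continuous up to the boundary. -/
lemma abs_second_difference_le {x h xl xr B : ℝ} (hh : 0 < h) (hl : xl ≤ x - h) (hr : x + h ≤ xr)
    {w w1 w2 : ℝ → ℝ} (hw : ContinuousOn w (Set.Icc xl xr))
    (h1 : ∀ y ∈ Set.Ioo xl xr, HasDerivAt w (w1 y) y)
    (h2 : ∀ y ∈ Set.Ioo xl xr, HasDerivAt w1 (w2 y) y)
    (hb : ∀ y ∈ Set.Ioo xl xr, |w2 y| ≤ B) :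
    |w (x + h) - 2 * w x + w (x - h)| ≤ 2 * B * h ^ 2 := by
  have := neBot_nhdsWithin_Ioo hh
  have t := ((tendsto_comp_add_left hw hh hl hr).sub_const (2 * w x)).add
    (tendsto_comp_sub_left hw hh hl hr)
  refine le_of_tendsto_of_tendsto t.abs
    (((tendsto_id_nhdsWithin_Ioo (h := h)).pow 2).const_mul (2 * B)) ?_
  filter_upwards [self_mem_nhdsWithin] with k hk
  have hsub : Set.Icc (x - k) (x + k) ⊆ Set.Ioo xl xr := fun y hy =>
    ⟨by linarith [hy.1, hk.2], by linarith [hy.2, hk.2]⟩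
  exact second_difference_interior hk.1 (fun y hy => h1 y (hsub hy)) (fun y hy => h2 y (hsub hy))
    (fun y hy => hb y (hsub hy))

lemma abs_central_difference_le {x h xl xr B : ℝ} (hh : 0 < h) (hl : xl ≤ x - h) (hr : x + h ≤ xr)
    {w w1 : ℝ → ℝ} (hw : ContinuousOn w (Set.Icc xl xr))
    (h1 : ∀ y ∈ Set.Ioo xl xr, HasDerivAt w (w1 y) y) (hb : ∀ y ∈ Set.Ioo xl xr, |w1 y| ≤ B) :
    |w (x + h) - w (x - h)| ≤ 2 * B * h := by
  have := abs_sub_le_of_hasDerivAt (hw.mono (Set.Icc_subset_Icc hl hr))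
    (fun y hy => h1 y (Set.Ioo_subset_Ioo hl hr hy)) (x := x + h) (c := x - h)
    ⟨by linarith, le_rfl⟩ ⟨le_rfl, by linarith⟩
    (fun y hy _ => hb y (Set.Ioo_subset_Ioo hl hr hy))
  rw [show x + h - (x - h) = 2 * h by ring,
    abs_of_pos (by positivity : 0 < 2 * h)] at this
  linarith

end TFBS

namespace TFBS

open Finset Filter Topology MeasureTheory intervalIntegral

/-! ### Consequences of the regularity assumptions -/

lemma HasRegularity.mono {σ K K' xl xr T : ℝ} {u : ℝ → ℝ → ℝ} (h : HasRegularity σ K xl xr T u)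
    (hK : K ≤ K') : HasRegularity σ K' xl xr T u where
  smooth_space := h.smooth_space
  smooth_time := h.smooth_time
  bound_mixed x hx t ht k l hk hl := (h.bound_mixed x hx t ht k l hk hl).trans <| by
    have : 0 ≤ t ^ (σ - k) := Real.rpow_nonneg ht.1.le _
    gcongr
  bound_space x hx t ht m h3 h6 := (h.bound_space x hx t ht m h3 h6).trans hK

section

variable {σ K xl xr T : ℝ} {u : ℝ → ℝ → ℝ}

lemma HasRegularity.hasDerivAt_space (h : HasRegularity σ K xl xr T u) {t : ℝ}
    (ht : t ∈ Set.Ioc 0 T) {m : ℕ} (hm : m < 6) {x : ℝ} (hx : x ∈ Set.Ioo xl xr) :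
    HasDerivAt (iteratedDeriv m fun y => u y t) (iteratedDeriv (m + 1) (fun y => u y t) x) x := by
  have h1 := (h.smooth_space t ht).differentiableOn_iteratedDerivWithin (m := m)
    (by exact_mod_cast hm) isOpen_Ioo.uniqueDiffOn
  have h2 : DifferentiableOn ℝ (iteratedDeriv m fun y => u y t) (Set.Ioo xl xr) :=
    h1.congr fun y hy => (iteratedDerivWithin_of_isOpen isOpen_Ioo hy).symm
  rw [iteratedDeriv_succ]
  exact ((h2 x hx).differentiableAt (isOpen_Ioo.mem_nhds hx)).hasDerivAt

/-- The regularity constant of the time derivatives in power form. -/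
noncomputable def timeRegConst (σ K T : ℝ) : ℝ := K * (1 + T ^ (2 - σ) + T ^ (3 - σ))

lemma timeRegConst_nonneg (hK : 0 ≤ K) (hT : 0 < T) : 0 ≤ timeRegConst σ K T := by
  rw [timeRegConst]; positivity

lemma HasRegularity.timeReg (h : HasRegularity σ K xl xr T u) (hK : 0 ≤ K) (hσ : σ < 2)
    (hT : 0 < T) {l : ℕ} (hl : l ≤ 2) {x : ℝ} (hx : x ∈ Set.Ioo xl xr) :
    TimeReg σ (timeRegConst σ K T) T (fun s => iteratedDeriv l (fun y => u y s) x)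
      (mixedDeriv T u 1 l x) (mixedDeriv T u 2 l x) (mixedDeriv T u 3 l x) := by
  have hs := h.smooth_time x hx l hl
  have hU : UniqueDiffOn ℝ (Set.Ioc 0 T) := uniqueDiffOn_Ioc 0 T
  have hder : ∀ k < 3, ∀ t ∈ Set.Ioo 0 T,
      HasDerivAt (mixedDeriv T u k l x) (mixedDeriv T u (k + 1) l x t) t := by
    intro k hk t ht
    have h1 := hs.differentiableOn_iteratedDerivWithin (m := k) (by exact_mod_cast hk) hU t
      ⟨ht.1, ht.2.le⟩
    have h2 := h1.hasDerivWithinAt.hasDerivAt (Ioc_mem_nhds ht.1 ht.2)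
    change HasDerivAt _ (iteratedDerivWithin (k + 1) _ _ t) t
    rw [iteratedDerivWithin_succ]
    exact h2
  have hcont : ∀ k ≤ 3, ContinuousOn (mixedDeriv T u k l x) (Set.Ioc 0 T) := fun k hk =>
    hs.continuousOn_iteratedDerivWithin (by exact_mod_cast hk) hU
  have hz : mixedDeriv T u 0 l x = fun s => iteratedDeriv l (fun y => u y s) x := by
    ext s; simp [mixedDeriv]
  have hb := fun t ht k hk => h.bound_mixed x hx t ht k l hk hl
  have hA : 0 ≤ T ^ (2 - σ) := by positivity
  have hB : 0 ≤ T ^ (3 - σ) := by positivity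
  have hle : ∀ t : ℝ, t ∈ Set.Ioc 0 T → ∀ k : ℕ, 2 ≤ k → K * (1 + t ^ (σ - k))
      ≤ K * (1 + T ^ (k - σ)) * t ^ (σ - k) := by
    intro t ht k hk
    have hk' : (2 : ℝ) ≤ k := by exact_mod_cast hk
    have := one_add_rpow_le ht.1 ht.2 (p := σ - k) (by linarith)
    rw [neg_sub] at this
    rw [mul_assoc]
    gcongr
  refine ⟨hz ▸ hcont 0 (by norm_num), hcont 1 (by norm_num), hcont 2 (by norm_num),
    hz ▸ hder 0 (by norm_num), hder 1 (by norm_num), hder 2 (by norm_num), ?_, ?_, ?_⟩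
  · intro t ht
    refine (hb t ht 1 (by norm_num)).trans ?_
    rw [Nat.cast_one, timeRegConst]
    have : 0 ≤ t ^ (σ - 1) := Real.rpow_nonneg ht.1.le _
    gcongr
    nlinarith
  · intro t ht
    refine (hb t ht 2 (by norm_num)).trans ((hle t ht 2 le_rfl).trans ?_)
    rw [timeRegConst]
    have : 0 ≤ t ^ (σ - 2) := Real.rpow_nonneg ht.1.le _
    push_cast
    gcongr _ * ?_ * _
    linarith
  · intro t ht
    refine (hb t ht 3 le_rfl).trans ((hle t ht 3 (by norm_num)).trans ?_)
    rw [timeRegConst]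
    have : 0 ≤ t ^ (σ - 3) := Real.rpow_nonneg ht.1.le _
    push_cast
    gcongr _ * ?_ * _
    linarith

end

/-! ### Behaviour of the Caputo derivative at the boundary -/

section Boundary

variable {α a b c σ K xl xr T : ℝ} {f : ℝ → ℝ → ℝ} {φ : ℝ → ℝ} {u : ℝ → ℝ → ℝ}

lemma IsSolution.continuousOn_space (hu : IsSolution α a b c xl xr T f φ u) {t : ℝ}
    (ht : t ∈ Set.Icc 0 T) : ContinuousOn (fun x => u x t) (Set.Icc xl xr) :=
  ContinuousOn.uncurry_right t ht hu.continuousOn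

lemma IsSolution.continuousOn_time (hu : IsSolution α a b c xl xr T f φ u) {x : ℝ}
    (hx : x ∈ Set.Icc xl xr) : ContinuousOn (fun t => u x t) (Set.Icc 0 T) :=
  ContinuousOn.uncurry_left x hx hu.continuousOn

lemma eq_zero_of_boundary (hT : 0 < T) {v : ℝ → ℝ} (hv : ContinuousOn v (Set.Icc 0 T))
    (h0 : ∀ t ∈ Set.Ioc 0 T, v t = 0) {t : ℝ} (ht : t ∈ Set.Icc 0 T) : v t = 0 := by
  rcases ht.1.eq_or_lt with h | h
  · subst h
    have h1 : Tendsto v (𝓝[Set.Ioc 0 T] 0) (𝓝 (v 0)) :=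
      (hv 0 ht).mono_left (nhdsWithin_mono _ Set.Ioc_subset_Icc_self)
    have h2 : Tendsto v (𝓝[Set.Ioc 0 T] 0) (𝓝 0) :=
      tendsto_const_nhds.congr' (by
        filter_upwards [self_mem_nhdsWithin] with s hs using (h0 s hs).symm)
    have : (𝓝[Set.Ioc 0 T] (0 : ℝ)).NeBot := left_nhdsWithin_Ioc_neBot hT
    exact tendsto_nhds_unique h1 h2
  · exact h0 t ⟨h, ht.2⟩

lemma IsSolution.eq_zero_left (hu : IsSolution α a b c xl xr T f φ u) (hx : xl < xr) (hT : 0 < T)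
    {t : ℝ} (ht : t ∈ Set.Icc 0 T) : u xl t = 0 :=
  eq_zero_of_boundary hT (hu.continuousOn_time ⟨le_rfl, hx.le⟩)
    (fun s hs => (hu.boundary s hs).1) ht

lemma IsSolution.eq_zero_right (hu : IsSolution α a b c xl xr T f φ u) (hx : xl < xr) (hT : 0 < T)
    {t : ℝ} (ht : t ∈ Set.Icc 0 T) : u xr t = 0 :=
  eq_zero_of_boundary hT (hu.continuousOn_time ⟨hx.le, le_rfl⟩)
    (fun s hs => (hu.boundary s hs).2) ht

lemma caputo_eq_zero {v : ℝ → ℝ} {t : ℝ} (ht : 0 ≤ t) (hv : ∀ s ∈ Set.Ioo 0 t, v s = 0) :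
    caputo α v t = 0 := by
  have h1 := abs_integral_le_of_abs_le (f := fun s => fracKernel (1 - α) (t - s) * deriv v s)
    (g := fun _ => 0) ht intervalIntegrable_const (fun s hs => by
      have : v =ᶠ[𝓝 s] fun _ => 0 := by
        filter_upwards [isOpen_Ioo.mem_nhds hs] with r hr using hv r hr
      rw [this.deriv_eq]
      simp)
  rw [intervalIntegral.integral_zero] at h1
  exact abs_nonpos_iff.1 h1

lemma abs_le_of_forward_lipschitz {v : ℝ → ℝ} {v' s r B : ℝ} (hsr : s < r)
    (hv : HasDerivAt v v' s) (hB : ∀ y ∈ Set.Ioo s r, |v y - v s| ≤ B * (y - s)) : |v'| ≤ B := by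
  have h1 : Tendsto (slope v s) (𝓝[>] s) (𝓝 v') :=
    (hasDerivAt_iff_tendsto_slope.1 hv).mono_left (nhdsWithin_mono _ fun y hy => ne_of_gt hy)
  refine le_of_tendsto h1.abs ?_
  filter_upwards [Ioo_mem_nhdsGT hsr] with y hy
  have hpos : 0 < y - s := by linarith [hy.1]
  rw [slope_def_field, abs_div, abs_of_pos hpos, div_le_iff₀ hpos]
  exact hB y hy

/-- The time derivative of a solution decays linearly at a boundary point. -/
lemma exists_abs_timeDeriv_le (hσ : σ ∈ Set.Ioo (0 : ℝ) 1 ∪ Set.Ioo (1 : ℝ) 2) (hK : 0 ≤ K)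
    (hT : 0 < T) : ∃ C, 0 ≤ C ∧ ∀ u f φ, IsSolution α a b c xl xr T f φ u →
      HasRegularity σ K xl xr T u → ∀ z ∈ Set.Icc xl xr, (∀ t ∈ Set.Ioc 0 T, u z t = 0) →
      ∀ x ∈ Set.Ioo xl xr, ∀ s ∈ Set.Ioo 0 T,
        |mixedDeriv T u 1 0 x s| ≤ C * |x - z| * s ^ (min σ 1 - 1) := by
  have hσ2 : σ < 2 := by rcases hσ with h | h <;> linarith [h.2]
  obtain ⟨C, hC, hC1⟩ := exists_linear_approx hσ (timeRegConst_nonneg (σ := σ) hK hT) hT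
  refine ⟨C, hC, fun u f φ hu hreg z hz hz0 x hx s hs => ?_⟩
  have hx' := Set.Ioo_subset_Icc_self hx
  have ht1 := hreg.timeReg hK hσ2 hT (l := 0) (by norm_num) hx
  simp only [iteratedDeriv_zero] at ht1
  -- The increment u(·,r) - u(·,s) vanishes at z and its x-derivative is a time increment of u_x,
  -- already bounded. The mean value theorem in x thus gives the decay without exchanging mixed
  -- derivatives.
  refine abs_le_of_forward_lipschitz hs.2 (ht1.d0 s hs) fun r hr => ?_
  have hsI : s ∈ Set.Ioc 0 T := ⟨hs.1, hs.2.le⟩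
  have hrI : r ∈ Set.Ioc 0 T := ⟨hs.1.trans hr.1, hr.2.le⟩
  have hd : ∀ y ∈ Set.Ioo xl xr, HasDerivAt (fun y => u y r - u y s)
      (iteratedDeriv 1 (fun y => u y r) y - iteratedDeriv 1 (fun y => u y s) y) y := by
    intro y hy
    have h1 := hreg.hasDerivAt_space hrI (m := 0) (by norm_num) hy
    have h2 := hreg.hasDerivAt_space hsI (m := 0) (by norm_num) hy
    rw [iteratedDeriv_zero, zero_add] at h1 h2
    exact h1.sub h2
  have hb : ∀ y ∈ Set.Ioo xl xr,
      |iteratedDeriv 1 (fun y => u y r) y - iteratedDeriv 1 (fun y => u y s) y|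
        ≤ C * s ^ (min σ 1 - 1) * (r - s) := by
    intro y hy
    have ht := hreg.timeReg hK hσ2 hT (l := 1) (by norm_num) hy
    have h1 := (hC1 _ _ _ _ ht).1
    have h2 := abs_sub_le_of_hasDerivAt (M := C * s ^ (min σ 1 - 1))
      (ht.c0.mono fun q hq => ⟨hs.1.trans_le hq.1, hq.2.trans hrI.2⟩)
      (fun q hq => ht.d0 q ⟨hs.1.trans hq.1, hq.2.trans_le hrI.2⟩) (x := r) (c := s)
      ⟨hr.1.le, le_rfl⟩ ⟨le_rfl, hr.1.le⟩
      (fun q hq _ => (h1 q ⟨hs.1.trans hq.1, hq.2.le.trans hrI.2⟩).trans (by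
        gcongr C * ?_
        exact Real.rpow_le_rpow_of_nonpos hs.1 hq.1.le (by linarith [min_le_right σ 1])))
    rwa [abs_of_pos (sub_pos.2 hr.1)] at h2
  have key := abs_sub_le_of_hasDerivAt
    ((hu.continuousOn_space (Set.Ioc_subset_Icc_self hrI)).sub
      (hu.continuousOn_space (Set.Ioc_subset_Icc_self hsI))) hd hx' hz (fun y hy _ => hb y hy)
  simp only [Pi.sub_apply, hz0 r hrI, hz0 s hsI, sub_zero] at key
  refine key.trans (le_of_eq ?_)
  ring

/-- The linear decay of the time derivative survives integration against the kernel, the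
singularities at both ends giving a finite Beta integral. -/
lemma exists_abs_caputo_le (hα : α ∈ Set.Ioo (0 : ℝ) 1)
    (hσ : σ ∈ Set.Ioo (0 : ℝ) 1 ∪ Set.Ioo (1 : ℝ) 2) (hK : 0 ≤ K) (hT : 0 < T)
    (hu : IsSolution α a b c xl xr T f φ u) (hreg : HasRegularity σ K xl xr T u) {t : ℝ}
    (ht : t ∈ Set.Ioc 0 T) : ∃ B, 0 ≤ B ∧ ∀ z ∈ Set.Icc xl xr, (∀ t ∈ Set.Ioc 0 T, u z t = 0) →
      ∀ x ∈ Set.Ioo xl xr, |caputo α (fun s => u x s) t| ≤ B * |x - z| := by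
  have hσ2 : σ < 2 := by rcases hσ with h | h <;> linarith [h.2]
  have hσ0 : 0 < min σ 1 := lt_min (by rcases hσ with h | h <;> linarith [h.1]) one_pos
  obtain ⟨C, hC, hC1⟩ := exists_abs_timeDeriv_le (α := α) (a := a) (b := b) (c := c) (xl := xl)
    (xr := xr) hσ hK hT
  have hΓ : 0 < Real.Gamma (1 - α) := Real.Gamma_pos_of_pos (by linarith [hα.2])
  set I := ∫ s in (0 : ℝ)..t, (t - s) ^ (-α) * s ^ (min σ 1 - 1) with hI
  have hint := intervalIntegrable_beta (p := -α) (q := min σ 1 - 1) (by linarith [hα.2])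
    (by linarith) ht.1
  have hI0 : 0 ≤ I := integral_nonneg ht.1.le fun s hs => by
    have : 0 ≤ t - s := by linarith [hs.2]
    have := hs.1
    positivity
  refine ⟨C / Real.Gamma (1 - α) * I, by positivity, fun z hz hz0 x hx => ?_⟩
  have ht1 := hreg.timeReg hK hσ2 hT (l := 0) (by norm_num) hx
  simp only [iteratedDeriv_zero] at ht1
  have h1 := abs_integral_le_of_abs_le
    (f := fun s => fracKernel (1 - α) (t - s) * deriv (fun s => u x s) s)
    (g := fun s => C / Real.Gamma (1 - α) * |x - z| * ((t - s) ^ (-α) * s ^ (min σ 1 - 1)))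
    ht.1.le (hint.const_mul _) (fun s hs => by
      have hs' : s ∈ Set.Ioo 0 T := ⟨hs.1, hs.2.trans_le ht.2⟩
      have h2 := hC1 u f φ hu hreg z hz hz0 x hx s hs'
      have h3 : 0 ≤ (t - s) ^ (-α) := Real.rpow_nonneg (by linarith [hs.2]) _
      rw [(ht1.d0 s hs').deriv, fracKernel_eq, abs_mul, abs_of_nonneg (by positivity)]
      calc (t - s) ^ (-α) / Real.Gamma (1 - α) * |mixedDeriv T u 1 0 x s|
          ≤ (t - s) ^ (-α) / Real.Gamma (1 - α) * (C * |x - z| * s ^ (min σ 1 - 1)) := by gcongr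
        _ = _ := by ring)
  rw [intervalIntegral.integral_const_mul] at h1
  refine h1.trans (le_of_eq ?_)
  ring

/-- The spatial part of the equation extends continuously to the boundary. -/
lemma continuousOn_caputo (hα : α ∈ Set.Ioo (0 : ℝ) 1)
    (hσ : σ ∈ Set.Ioo (0 : ℝ) 1 ∪ Set.Ioo (1 : ℝ) 2) (hK : 0 ≤ K) (hx : xl < xr) (hT : 0 < T)
    (hf : ∀ t ∈ Set.Ioc 0 T, ContinuousOn (fun x => f x t) (Set.Icc xl xr))
    (hu : IsSolution α a b c xl xr T f φ u) (hreg : HasRegularity σ K xl xr T u) {t : ℝ}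
    (ht : t ∈ Set.Ioc 0 T) :
    ContinuousOn (fun x => caputo α (fun s => u x s) t) (Set.Icc xl xr) := by
  obtain ⟨B, hB, hB1⟩ := exists_abs_caputo_le hα hσ hK hT hu hreg ht
  have ht' := Set.Ioc_subset_Icc_self ht
  have hl : xl ∈ Set.Icc xl xr := ⟨le_rfl, hx.le⟩
  have hr : xr ∈ Set.Icc xl xr := ⟨hx.le, le_rfl⟩
  have hcl : caputo α (fun s => u xl s) t = 0 := caputo_eq_zero ht.1.le fun s hs =>
    (hu.boundary s ⟨hs.1, hs.2.le.trans ht.2⟩).1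
  have hcr : caputo α (fun s => u xr s) t = 0 := caputo_eq_zero ht.1.le fun s hs =>
    (hu.boundary s ⟨hs.1, hs.2.le.trans ht.2⟩).2
  have hend : ∀ z ∈ Set.Icc xl xr, (∀ t ∈ Set.Ioc 0 T, u z t = 0) →
      caputo α (fun s => u z s) t = 0 →
      ContinuousWithinAt (fun x => caputo α (fun s => u x s) t) (Set.Icc xl xr) z := by
    intro z hz hz0 hcz
    have hle : ∀ x ∈ Set.Icc xl xr, |caputo α (fun s => u x s) t| ≤ B * |x - z| := by
      intro x hxI
      rcases hxI.1.eq_or_lt with h | h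
      · rw [← h, hcl, abs_zero]; positivity
      rcases hxI.2.eq_or_lt with h' | h'
      · rw [h', hcr, abs_zero]; positivity
      exact hB1 z hz hz0 x ⟨h, h'⟩
    rw [ContinuousWithinAt, hcz]
    have h0 : Tendsto (fun x => B * |x - z|) (𝓝[Set.Icc xl xr] z) (𝓝 0) := by
      have : Continuous fun x => B * |x - z| := by fun_prop
      have h1 := this.tendsto z
      simp only [sub_self, abs_zero, mul_zero] at h1
      exact h1.mono_left nhdsWithin_le_nhds
    refine squeeze_zero_norm' ?_ h0
    filter_upwards [self_mem_nhdsWithin] with x hx using hle x hx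
  intro z hz
  rcases hz.1.eq_or_lt with h | h
  · subst h
    exact hend _ hz (fun s hs => (hu.boundary s hs).1) hcl
  rcases hz.2.eq_or_lt with h' | h'
  · subst h'
    exact hend _ hz (fun s hs => (hu.boundary s hs).2) hcr
  have hzI : z ∈ Set.Ioo xl xr := ⟨h, h'⟩
  -- In the interior, continuity is read off from the right-hand side of the equation; only the end
  -- points need the decay estimate.
  have h1 : ContinuousWithinAt (fun x => a * iteratedDeriv 2 (fun y => u y t) x
      + b * iteratedDeriv 1 (fun y => u y t) x - c * u x t + f x t) (Set.Icc xl xr) z :=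
    ((((hreg.hasDerivAt_space ht (m := 2) (by norm_num) hzI).continuousAt.continuousWithinAt.const_mul
      a).add ((hreg.hasDerivAt_space ht (m := 1) (by norm_num)
        hzI).continuousAt.continuousWithinAt.const_mul b)).sub
        ((hu.continuousOn_space ht' z hz).const_mul c)).add (hf t ht z hz)
  refine h1.congr_of_eventuallyEq ?_ (by rw [hu.equation z hzI t ht, iteratedDeriv_one])
  filter_upwards [mem_nhdsWithin_of_mem_nhds (isOpen_Ioo.mem_nhds hzI)] with x hx
  rw [hu.equation x hx t ht, iteratedDeriv_one]

end Boundary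

end TFBS

namespace TFBS

open Finset Filter Topology

/-! ### Linear interpolation in time -/

/-- The error of linear interpolation in time between `s` and `r`. -/
noncomputable def timeInterp (θ : ℝ) (v : ℝ → ℝ) (s r : ℝ) : ℝ :=
  θ * v s + (1 - θ) * v r - v (θ * s + (1 - θ) * r)

lemma convexComb_mem {θ s r : ℝ} (hθ : θ ∈ Set.Icc (0 : ℝ) 1) (hsr : s ≤ r) :
    θ * s + (1 - θ) * r ∈ Set.Icc s r := by
  constructor <;> nlinarith [hθ.1, hθ.2]

lemma TimeReg.abs_timeInterp_le {σ K T θ s r : ℝ} {v v1 v2 v3 : ℝ → ℝ}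
    (hv : TimeReg σ K T v v1 v2 v3) (hK : 0 ≤ K) (hσ : σ < 2) (hθ : θ ∈ Set.Icc (0 : ℝ) 1)
    (hs : 0 < s) (hsr : s < r) (hr : r ≤ T) :
    |timeInterp θ v s r| ≤ K * (s ^ (σ - 2) * (r - s) ^ 2) := by
  set g : ℝ → ℝ := fun y => v y - (v s + (y - s) * ((v r - v s) / (r - s))) with hg
  have hrs : 0 < r - s := sub_pos.2 hsr
  have hmem := convexComb_mem hθ hsr.le
  set y := θ * s + (1 - θ) * r with hy
  have key := abs_le_of_vanishing_endpoints (f := g) (f1 := fun y => v1 y - (v r - v s) / (r - s))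
    (f2 := v2) (a := s) (b := r) (m := K * s ^ (σ - 2))
    ((hv.c0.mono fun q hq => ⟨hs.trans_le hq.1, hq.2.trans hr⟩).sub (by fun_prop))
    (fun q hq => by
      refine (hv.d0 q ⟨hs.trans hq.1, hq.2.trans_le hr⟩).sub ?_
      have := (((hasDerivAt_id q).sub_const s).mul_const ((v r - v s) / (r - s))).const_add (v s)
      simpa using this)
    (fun q hq => (hv.d1 q ⟨hs.trans hq.1, hq.2.trans_le hr⟩).sub_const _)
    (by simp [hg]) (by simp only [hg]; field_simp; ring)
    (fun q hq => (hv.b2 q ⟨hs.trans hq.1, hq.2.le.trans hr⟩).trans (by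
      gcongr K * ?_
      exact Real.rpow_le_rpow_of_nonpos hs hq.1.le (by linarith)))
    hmem
  have hgy : g y = -timeInterp θ v s r := by
    simp only [hg, timeInterp, ← hy]
    rw [show y - s = (1 - θ) * (r - s) by rw [hy]; ring]
    field_simp
    ring
  rw [hgy, abs_neg] at key
  refine key.trans ?_
  have h1 : (y - s) * (r - y) ≤ (r - s) ^ 2 := by
    nlinarith [mul_le_mul (by linarith [hmem.2] : y - s ≤ r - s)
      (by linarith [hmem.1] : r - y ≤ r - s) (by linarith [hmem.2]) hrs.le]
  have h2 : 0 ≤ K * s ^ (σ - 2) := by positivity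
  have h3 : 0 ≤ (y - s) * (r - y) := mul_nonneg (by linarith [hmem.1]) (by linarith [hmem.2])
  nlinarith [mul_le_mul_of_nonneg_left h1 h2, mul_nonneg h2 h3]

/-- Linear interpolation is exact on affine functions, so the slope p may be subtracted. The bound
is uniform as s → 0, which serves the first cell. -/
lemma abs_timeInterp_le_of_linear_approx {θ s r p D : ℝ} {v : ℝ → ℝ} (hθ : θ ∈ Set.Icc (0 : ℝ) 1)
    (hs : 0 < s) (hsr : s < r)
    (h : ∀ y y', 0 < y' → y' ≤ y → y ≤ r → |v y - v y' - p * (y - y')| ≤ D) :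
    |timeInterp θ v s r| ≤ 2 * D := by
  have hmem := convexComb_mem hθ hsr.le
  have h1 := h r s hs hsr.le le_rfl
  have h2 := h _ s hs hmem.1 hmem.2
  have hD : 0 ≤ D := (abs_nonneg _).trans h1
  have e : timeInterp θ v s r = (1 - θ) * (v r - v s - p * (r - s))
      - (v (θ * s + (1 - θ) * r) - v s - p * (θ * s + (1 - θ) * r - s)) := by
    rw [timeInterp]; ring
  rw [e]
  have h3 : |(1 - θ) * (v r - v s - p * (r - s))| ≤ 1 * D := abs_mul_le_mul
    (by rw [abs_le]; constructor <;> linarith [hθ.1, hθ.2]) h1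
  refine (abs_sub _ _).trans ?_
  linarith

section

variable {α a b c σ K xl xr T : ℝ}

/-- Bounds of a grid function and its differences, of the kind satisfied by a smooth function with
derivatives bounded by `E`. -/
structure HasDifferenceBounds (xl xr E : ℝ) (w : ℝ → ℝ) : Prop where
  value : ∀ x ∈ Set.Icc xl xr, |w x| ≤ E
  central : ∀ x h, 0 < h → xl ≤ x - h → x + h ≤ xr → |w (x + h) - w (x - h)| ≤ 2 * E * h
  second : ∀ x h, 0 < h → xl ≤ x - h → x + h ≤ xr →
    |w (x + h) - 2 * w x + w (x - h)| ≤ 2 * E * h ^ 2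

lemma HasDifferenceBounds.mono {E E' : ℝ} {w : ℝ → ℝ} (hw : HasDifferenceBounds xl xr E w)
    (hE : E ≤ E') : HasDifferenceBounds xl xr E' w where
  value x hx := (hw.value x hx).trans hE
  central x h hh hl hr := (hw.central x h hh hl hr).trans (by gcongr)
  second x h hh hl hr := (hw.second x h hh hl hr).trans (by gcongr)

/-- The reason for working with differences rather than derivatives: these bounds pass to pointwise
limits, and at t = 0 no spatial derivatives are assumed. -/
lemma HasDifferenceBounds.of_tendsto {E : ℝ} {w : ℝ → ℝ} {W : ℝ → ℝ → ℝ}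
    (hW : ∀ x ∈ Set.Icc xl xr, Tendsto (fun s => W s x) (𝓝[>] 0) (𝓝 (w x)))
    (hb : ∀ᶠ s in 𝓝[>] 0, HasDifferenceBounds xl xr E (W s)) : HasDifferenceBounds xl xr E w where
  value x hx := le_of_tendsto (hW x hx).abs (by filter_upwards [hb] with s hs using hs.value x hx)
  central x h hh hl hr := le_of_tendsto ((hW (x + h) ⟨by linarith, hr⟩).sub
    (hW (x - h) ⟨hl, by linarith⟩)).abs (by
      filter_upwards [hb] with s hs using hs.central x h hh hl hr)
  second x h hh hl hr := le_of_tendsto (((hW (x + h) ⟨by linarith, hr⟩).sub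
    ((hW x ⟨by linarith, by linarith⟩).const_mul 2)).add (hW (x - h) ⟨hl, by linarith⟩)).abs (by
      filter_upwards [hb] with s hs using hs.second x h hh hl hr)

variable {f : ℝ → ℝ → ℝ} {φ : ℝ → ℝ} {u : ℝ → ℝ → ℝ}

/-- Interpolation in time commutes with differentiation in x, so the bounds for l = 0, 1, 2 become
bounds on values, central and second differences. -/
lemma hasDifferenceBounds_timeInterp (hx : xl < xr)
    (hu : IsSolution α a b c xl xr T f φ u) (hreg : HasRegularity σ K xl xr T u) {θ s r E : ℝ}
    (hθ : θ ∈ Set.Icc (0 : ℝ) 1) (hs : 0 < s) (hsr : s < r) (hr : r ≤ T)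
    (hE : ∀ l ≤ 2, ∀ x ∈ Set.Ioo xl xr,
      |timeInterp θ (fun s => iteratedDeriv l (fun y => u y s) x) s r| ≤ E) :
    HasDifferenceBounds xl xr E (fun x => timeInterp θ (u x) s r) := by
  have hmem := convexComb_mem hθ hsr.le
  set q := θ * s + (1 - θ) * r with hq
  have hsI : s ∈ Set.Ioc 0 T := ⟨hs, hsr.le.trans hr⟩
  have hrI : r ∈ Set.Ioc 0 T := ⟨hs.trans hsr, hr⟩
  have hqI : q ∈ Set.Ioc 0 T := ⟨hs.trans_le hmem.1, hmem.2.trans hr⟩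
  have hcont : ContinuousOn (fun x => timeInterp θ (u x) s r) (Set.Icc xl xr) :=
    (((hu.continuousOn_space (Set.Ioc_subset_Icc_self hsI)).const_mul θ).add
      ((hu.continuousOn_space (Set.Ioc_subset_Icc_self hrI)).const_mul (1 - θ))).sub
      (hu.continuousOn_space (Set.Ioc_subset_Icc_self hqI))
  have hd : ∀ l < 6, ∀ x ∈ Set.Ioo xl xr, HasDerivAt
      (fun x => timeInterp θ (fun s => iteratedDeriv l (fun y => u y s) x) s r)
      (timeInterp θ (fun s => iteratedDeriv (l + 1) (fun y => u y s) x) s r) x := by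
    intro l hl x hx
    exact (((hreg.hasDerivAt_space hsI hl hx).const_mul θ).add
      ((hreg.hasDerivAt_space hrI hl hx).const_mul (1 - θ))).sub (hreg.hasDerivAt_space hqI hl hx)
  have hd0 := hd 0 (by norm_num)
  have hE0 := hE 0 (by norm_num)
  simp only [iteratedDeriv_zero] at hd0 hE0
  have hEpos : 0 ≤ E := (abs_nonneg _).trans
    (hE0 ((xl + xr) / 2) ⟨by linarith, by linarith⟩)
  have hz : ∀ z, (∀ t ∈ Set.Ioc 0 T, u z t = 0) → |timeInterp θ (u z) s r| ≤ E := by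
    intro z hz
    rw [timeInterp, hz s hsI, hz r hrI, hz _ hqI]
    simpa using hEpos
  refine ⟨fun x hx => ?_, fun x h hh hl hr => ?_, fun x h hh hl hr => ?_⟩
  · rcases hx.1.eq_or_lt with h | h
    · exact hz x fun t ht => h ▸ (hu.boundary t ht).1
    rcases hx.2.eq_or_lt with h' | h'
    · exact hz x fun t ht => h' ▸ (hu.boundary t ht).2
    exact hE0 x ⟨h, h'⟩
  · exact abs_central_difference_le hh hl hr hcont hd0 (hE 1 (by norm_num))
  · exact abs_second_difference_le hh hl hr hcont hd0 (hd 1 (by norm_num)) (hE 2 (by norm_num))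

/-- The error of interpolation in time on the cells of a graded mesh. -/
lemma exists_timeInterp_bounds {Cγ : ℝ} (hα : α ∈ Set.Ioo (0 : ℝ) 1)
    (hσ : σ ∈ Set.Ioo (0 : ℝ) 1 ∪ Set.Ioo (1 : ℝ) 2) (hK : 0 ≤ K) (hx : xl < xr) (hT : 0 < T)
    (hCγ : 1 ≤ Cγ) : ∃ C, 0 ≤ C ∧ ∀ u f φ, IsSolution α a b c xl xr T f φ u →
      HasRegularity σ K xl xr T u → ∀ (N : ℕ) (t : ℕ → ℝ), IsTimeMesh T N t →
      IsComparable Cγ N t → ∀ n, 1 ≤ n → n ≤ N →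
      HasDifferenceBounds xl xr (C * ((step t n / t n) ^ 2 * t n ^ σ))
        (fun x => timeInterp (α / 2) (u x) (t (n - 1)) (t n)) := by
  have hσ2 : σ < 2 := by rcases hσ with h | h <;> linarith [h.2]
  have hK1 := timeRegConst_nonneg (σ := σ) hK hT
  have hθ : α / 2 ∈ Set.Icc (0 : ℝ) 1 := ⟨by linarith [hα.1], by linarith [hα.2]⟩
  obtain ⟨C, hC, hC1⟩ := exists_linear_approx hσ hK1 hT
  set K1 := timeRegConst σ K T with hK1def
  refine ⟨2 * C + K1 * Cγ ^ (2 - σ), by positivity, ?_⟩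
  intro u f φ hu hreg N t hmesh hcomp n hn1 hn
  have htn := hmesh.pos hn1 hn
  have htnT := hmesh.le_horizon hn
  have hlt := hmesh.increasing n hn1 hn
  rcases hn1.eq_or_lt with h1 | h1
  · subst h1
    rw [Nat.sub_self, step, Nat.sub_self, hmesh.start, sub_zero, div_self htn.ne', one_pow, one_mul]
    -- In the first cell the left node 0 is replaced by s > 0, and s tends to 0.
    refine HasDifferenceBounds.mono (E := 2 * (C * t 1 ^ σ)) ?_ ?_
    · refine HasDifferenceBounds.of_tendsto (W := fun s x => timeInterp (α / 2) (u x) s (t 1)) ?_ ?_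
      · intro x hxI
        have hc := hu.continuousOn_time hxI
        have hid : Tendsto (fun y : ℝ => y) (𝓝[>] 0) (𝓝 0) := tendsto_id.mono_left nhdsWithin_le_nhds
        have hev : ∀ᶠ s in 𝓝[>] (0 : ℝ), s ∈ Set.Ioc 0 (t 1) := Ioc_mem_nhdsGT htn
        have e1 : Tendsto (fun s => u x s) (𝓝[>] 0) (𝓝 (u x 0)) :=
          (hc 0 ⟨le_rfl, hT.le⟩).tendsto.comp (tendsto_nhdsWithin_iff.2 ⟨hid, by
            filter_upwards [hev] with s hs using ⟨hs.1.le, hs.2.trans htnT⟩⟩)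
        have e2 : Tendsto (fun s => u x (α / 2 * s + (1 - α / 2) * t 1)) (𝓝[>] 0)
            (𝓝 (u x (α / 2 * 0 + (1 - α / 2) * t 1))) := by
          have hm := convexComb_mem hθ htn.le
          refine (hc _ ⟨hm.1, hm.2.trans htnT⟩).tendsto.comp (tendsto_nhdsWithin_iff.2
            ⟨(hid.const_mul _).add_const _, ?_⟩)
          filter_upwards [hev] with s hs
          have hm' := convexComb_mem hθ hs.2
          exact ⟨hs.1.le.trans hm'.1, hm'.2.trans htnT⟩
        exact ((e1.const_mul _).add_const _).sub e2
      · filter_upwards [Ioo_mem_nhdsGT htn] with s hs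
        refine hasDifferenceBounds_timeInterp hx hu hreg hθ hs.1 hs.2 htnT fun l hl x hxI => ?_
        obtain ⟨p, -, hp⟩ := (hC1 _ _ _ _ (hreg.timeReg hK hσ2 hT hl hxI)).2 (t 1) ⟨htn, htnT⟩
        exact abs_timeInterp_le_of_linear_approx hθ hs.1 hs.2 hp
    · have : 0 ≤ K1 * Cγ ^ (2 - σ) * t 1 ^ σ := by positivity
      linarith
  · have hs : 0 < t (n - 1) := hmesh.pos (by omega) (by omega)
    refine HasDifferenceBounds.mono (E := K1 * (t (n - 1) ^ (σ - 2) * (t n - t (n - 1)) ^ 2)) ?_ ?_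
    · exact hasDifferenceBounds_timeInterp hx hu hreg hθ hs hlt htnT fun l hl x hxI =>
        (hreg.timeReg hK hσ2 hT hl hxI).abs_timeInterp_le hK1 hσ2 hθ hs hlt htnT
    · have hnode := hcomp.node_le (n - 1) (by omega) (by omega)
      rw [Nat.sub_add_cancel hn1] at hnode
      have hCγ0 : 0 < Cγ := by linarith
      have e1 : t (n - 1) ^ (σ - 2) ≤ Cγ ^ (2 - σ) * t n ^ (σ - 2) := by
        have h2 : t n / Cγ ≤ t (n - 1) := by rw [div_le_iff₀ hCγ0]; linarith
        have h3 := Real.rpow_le_rpow_of_nonpos (by positivity) h2 (by linarith : σ - 2 ≤ 0)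
        rw [Real.div_rpow htn.le hCγ0.le, div_eq_mul_inv, ← Real.rpow_neg hCγ0.le, neg_sub] at h3
        linarith
      have e2 : (step t n / t n) ^ 2 * t n ^ σ = t n ^ (σ - 2) * step t n ^ 2 := by
        rw [Real.rpow_sub htn, Real.rpow_two]
        field_simp
      rw [e2, ← step]
      have e3 : 0 ≤ C * (t n ^ (σ - 2) * step t n ^ 2) := by positivity
      calc K1 * (t (n - 1) ^ (σ - 2) * step t n ^ 2)
          ≤ K1 * (Cγ ^ (2 - σ) * t n ^ (σ - 2) * step t n ^ 2) := by gcongr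
        _ ≤ _ := by linarith

end

end TFBS

namespace TFBS

open Finset

/-! ### Consistency of the fully discrete scheme -/

lemma fastAlikhanov_sub (α : ℝ) (t : ℕ → ℝ) {Nq : ℕ} (s w : Fin Nq → ℝ) (v v' : ℕ → ℝ) {n : ℕ}
    (hn : 1 ≤ n) : fastAlikhanov α t s w (fun k => v k - v' k) n
      = fastAlikhanov α t s w v n - fastAlikhanov α t s w v' n := by
  rw [fastAlikhanov_eq_weight _ _ _ _ _ hn, fastAlikhanov_eq_weight _ _ _ _ _ hn,
    fastAlikhanov_eq_weight _ _ _ _ _ hn, ← sum_sub_distrib]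
  exact sum_congr rfl fun k _ => by ring

lemma fastAlikhanov_eq_zero {α : ℝ} {t : ℕ → ℝ} {Nq : ℕ} {s w : Fin Nq → ℝ} {v : ℕ → ℝ} {n : ℕ}
    (hn : 1 ≤ n) (hv : ∀ k ≤ n, v k = 0) : fastAlikhanov α t s w v n = 0 := by
  rw [fastAlikhanov_eq_weight _ _ _ _ _ hn]
  refine sum_eq_zero fun k hk => ?_
  rw [hv n le_rfl, hv k (mem_range.1 hk).le]
  ring

section Grid

variable {xl xr : ℝ} {M : ℕ}

lemma gridPoint_succ (i : ℕ) :
    gridPoint xl xr M (i + 1) = gridPoint xl xr M i + spaceStep xl xr M := by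
  rw [gridPoint, gridPoint]; push_cast; ring

lemma gridPoint_zero : gridPoint xl xr M 0 = xl := by simp [gridPoint]

lemma gridPoint_last (hM : 1 ≤ M) : gridPoint xl xr M M = xr := by
  have : (M : ℝ) ≠ 0 := by exact_mod_cast (by omega : M ≠ 0)
  rw [gridPoint, spaceStep]
  field_simp
  ring

lemma spaceStep_pos (hx : xl < xr) (hM : 1 ≤ M) : 0 < spaceStep xl xr M :=
  div_pos (by linarith) (by exact_mod_cast hM)

lemma spaceStep_le (hx : xl < xr) (hM : 1 ≤ M) : spaceStep xl xr M ≤ xr - xl :=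
  div_le_self (by linarith) (by exact_mod_cast hM)

lemma gridPoint_mem (hx : xl < xr) {i : ℕ} (hi : i ≤ M) (hM : 1 ≤ M) :
    gridPoint xl xr M i ∈ Set.Icc xl xr := by
  have h := spaceStep_pos hx hM
  refine ⟨by rw [gridPoint]; nlinarith [Nat.cast_nonneg (α := ℝ) i], ?_⟩
  have h1 := gridPoint_last (xl := xl) (xr := xr) hM
  have : (i : ℝ) ≤ M := by exact_mod_cast hi
  rw [gridPoint] at h1 ⊢
  nlinarith

lemma gridPoint_mem_Ioo (hx : xl < xr) {i : ℕ} (hi0 : 1 ≤ i) (hi : i < M) :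
    gridPoint xl xr M i ∈ Set.Ioo xl xr := by
  have h := spaceStep_pos hx (by omega : 1 ≤ M)
  have h0 : (1 : ℝ) ≤ i := by exact_mod_cast hi0
  refine ⟨by rw [gridPoint]; nlinarith, ?_⟩
  have h1 := gridPoint_last (xl := xl) (xr := xr) (by omega : 1 ≤ M)
  have : (i : ℝ) < M := by exact_mod_cast hi
  rw [gridPoint] at h1 ⊢
  nlinarith

lemma averageOp_gridPoint {a : ℝ} (b : ℝ) (ha : 0 < a) (hx : xl < xr) (hM : 1 ≤ M) (F : ℝ → ℝ)
    (i : ℕ) : averageOp a b (spaceStep xl xr M) (fun j => F (gridPoint xl xr M j)) (i + 1)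
      = averageStencil (b * spaceStep xl xr M / a) (spaceStep xl xr M) F
        (gridPoint xl xr M (i + 1)) := by
  rw [averageOp_succ b ha.ne' (spaceStep_pos hx hM).ne', averageStencil, ← gridPoint_succ,
    show gridPoint xl xr M (i + 1) - spaceStep xl xr M = gridPoint xl xr M i by
      rw [gridPoint_succ]; ring]

lemma fluxOp_gridPoint {a : ℝ} (b : ℝ) (ha : 0 < a) (hx : xl < xr) (hM : 1 ≤ M) (F : ℝ → ℝ)
    (i : ℕ) : fluxOp a b (spaceStep xl xr M) (fun j => F (gridPoint xl xr M j)) (i + 1)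
      = fluxStencil a (b * spaceStep xl xr M / a) (spaceStep xl xr M) F
        (gridPoint xl xr M (i + 1)) := by
  rw [fluxOp_succ b ha.ne' (spaceStep_pos hx hM).ne', fluxStencil, ← gridPoint_succ,
    show gridPoint xl xr M (i + 1) - spaceStep xl xr M = gridPoint xl xr M i by
      rw [gridPoint_succ]; ring]

end Grid

lemma abs_averageOp_le {a b h Q X : ℝ} (ha : 0 < a) (hh : 0 < h) (hQ : |b * h / a| ≤ Q)
    {v : ℕ → ℝ} {i : ℕ} (h0 : |v i| ≤ X) (h1 : |v (i + 1)| ≤ X) (h2 : |v (i + 2)| ≤ X) :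
    |averageOp a b h v (i + 1)| ≤ (1 + Q) * X := by
  rw [averageOp_succ b ha.ne' hh.ne']
  have hX : 0 ≤ X := (abs_nonneg _).trans h0
  have hQ0 : 0 ≤ Q := (abs_nonneg _).trans hQ
  have h3 : |v (i + 2) - v i| ≤ 2 * X := (abs_sub _ _).trans (by linarith)
  have h4 := abs_mul_le_mul hQ h3
  have h5 : 0 ≤ Q * X := by positivity
  rw [abs_le] at *
  constructor <;> linarith [h0.1, h0.2, h1.1, h1.2, h2.1, h2.2, h4.1, h4.2]

lemma HasDifferenceBounds.abs_fluxStencil_le {a b h Q E x xl xr : ℝ} {w : ℝ → ℝ}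
    (hw : HasDifferenceBounds xl xr E w) (ha : 0 < a) (hh : 0 < h)
    (hQ : |b * h / a| ≤ Q) (hl : xl ≤ x - h) (hr : x + h ≤ xr) :
    |fluxStencil a (b * h / a) h w x| ≤ (2 * a * (1 + Q ^ 2) + |b|) * E := by
  have h1 := hw.central x h hh hl hr
  have h2 := hw.second x h hh hl hr
  have hQ2 : (b * h / a) ^ 2 ≤ Q ^ 2 := by rw [← sq_abs]; gcongr
  have e : fluxStencil a (b * h / a) h w x
      = a * (1 + (b * h / a) ^ 2 / 12) * ((w (x + h) - 2 * w x + w (x - h)) / h ^ 2)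
        + b * ((w (x + h) - w (x - h)) / (2 * h)) := by
    rw [fluxStencil]
    field_simp
  have h3 : |(w (x + h) - 2 * w x + w (x - h)) / h ^ 2| ≤ 2 * E := by
    rw [abs_div, abs_of_pos (by positivity : 0 < h ^ 2), div_le_iff₀ (by positivity)]
    exact h2
  have h4 : |(w (x + h) - w (x - h)) / (2 * h)| ≤ E := by
    rw [abs_div, abs_of_pos (by positivity : 0 < 2 * h), div_le_iff₀ (by positivity)]
    linarith
  have h5 : |a * (1 + (b * h / a) ^ 2 / 12)| ≤ a * (1 + Q ^ 2) := by
    rw [abs_of_nonneg (by positivity)]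
    have := sq_nonneg Q
    gcongr a * (1 + ?_)
    linarith
  rw [e]
  refine (abs_add_le _ _).trans ?_
  linarith [abs_mul_le_mul h5 h3, abs_mul_le_mul (le_refl |b|) h4]

/-- Residual of the error equation. -/
lemma exists_consistency {α σ Cγ K a b c xl xr T : ℝ} (hα : α ∈ Set.Ioo (0 : ℝ) 1)
    (hσ : σ ∈ Set.Ioo (0 : ℝ) 1 ∪ Set.Ioo (1 : ℝ) 2) (hK : 0 ≤ K) (ha : 0 < a) (hc : 0 ≤ c)
    (hx : xl < xr) (hT : 0 < T) (hCγ : 1 ≤ Cγ) :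
    ∃ C, 0 ≤ C ∧ ∀ (u f : ℝ → ℝ → ℝ) (φ : ℝ → ℝ),
      (∀ t ∈ Set.Ioc 0 T, ContinuousOn (fun x => f x t) (Set.Icc xl xr)) →
      IsSolution α a b c xl xr T f φ u → HasRegularity σ K xl xr T u →
      ∀ (N M : ℕ) (t : ℕ → ℝ) (Nq : ℕ) (s w : Fin Nq → ℝ) (ε : ℝ),
      IsFastMesh α T ε N t s w → IsComparable Cγ N t →
      ∀ U : ℕ → ℕ → ℝ, IsSchemeSolution α a b c xl xr f φ N t s w M U →
      ∀ n, 1 ≤ n → n ≤ N → ∀ i, i + 1 < M →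
        |averageOp a b (spaceStep xl xr M) (fun j => fastAlikhanov α t s w
              (fun k => u (gridPoint xl xr M j) (t k) - U k j) n) (i + 1)
          - (fluxOp a b (spaceStep xl xr M) (fun j => offValue (α / 2)
              (fun k => u (gridPoint xl xr M j) (t k) - U k j) n) (i + 1)
            - c * averageOp a b (spaceStep xl xr M) (fun j => offValue (α / 2)
              (fun k => u (gridPoint xl xr M j) (t k) - U k j) n) (i + 1))|
        ≤ C * ((weight α t s w n n * localSize σ t n
            + ∑ k ∈ range n, (weight α t s w n (k + 1) - weight α t s w n k) * localSize σ t k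
            + ε) + (step t n / t n) ^ 2 * t n ^ σ + spaceStep xl xr M ^ 4) := by
  have hσ2 : σ < 2 := by rcases hσ with h | h <;> linarith [h.2]
  have hK1 := timeRegConst_nonneg (σ := σ) hK hT
  obtain ⟨C1, hC1, hC1'⟩ := exists_temporal_truncation (α := α) hσ hK1 hT hCγ
  obtain ⟨C2, hC2, hC2'⟩ := exists_timeInterp_bounds (α := α) (a := a) (b := b) (c := c) hα hσ hK hx
    hT hCγ
  set Q := |b| * (xr - xl) / a with hQdef
  have hxlr : 0 < xr - xl := by linarith
  have hQ0 : 0 ≤ Q := by positivity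
  set C3 := (a * (3 + 2 * Q + Q ^ 2) + |b| * (1 + Q) + b ^ 2 / a) * K with hC3
  have hC30 : 0 ≤ C3 := by positivity
  set C4 := c * ((1 + Q) * C2) + (2 * a * (1 + Q ^ 2) + |b|) * C2 with hC4
  have hC40 : 0 ≤ C4 := by positivity
  refine ⟨(1 + Q) * C1 + C4 + C3, by positivity, ?_⟩
  intro u f φ hf hu hreg N M t Nq s w ε hmesh hcomp U hU n hn1 hn i hi
  have hM : 1 ≤ M := by omega
  set h := spaceStep xl xr M with hh
  have hpos : 0 < h := spaceStep_pos hx hM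
  have hQ : |b * h / a| ≤ Q := by
    rw [abs_div, abs_mul, abs_of_pos ha, abs_of_pos hpos, hQdef]
    have := spaceStep_le (xl := xl) (xr := xr) hx hM
    gcongr
  set x := gridPoint xl xr M with hxdef
  set r := offTime (α / 2) t n with hr
  have hoff : r = α / 2 * t (n - 1) + (1 - α / 2) * t n := rfl
  have hrT : r ∈ Set.Ioc 0 T :=
    ⟨(hmesh.mesh.nonneg (by omega)).trans_lt (hmesh.offTime_gt hn1 hn),
      (hmesh.offTime_lt hn1 hn).le.trans (hmesh.mesh.le_horizon hn)⟩
  have htI : ∀ k ≤ N, t k ∈ Set.Icc 0 T := fun k hk =>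
    ⟨hmesh.mesh.nonneg hk, hmesh.mesh.le_horizon hk⟩
  set E1 := weight α t s w n n * localSize σ t n
    + ∑ k ∈ range n, (weight α t s w n (k + 1) - weight α t s w n k) * localSize σ t k + ε with hE1
  set E2 := (step t n / t n) ^ 2 * t n ^ σ with hE2
  have htn := hmesh.mesh.pos hn1 hn
  have hE20 : 0 ≤ E2 := by positivity
  have hloc : ∀ k ≤ n, 0 ≤ localSize σ t k := by
    intro k hk
    rcases Nat.eq_zero_or_pos k with rfl | hk0
    · rw [localSize, hmesh.mesh.start, div_zero]; simp
    · have h1 := hmesh.mesh.pos hk0 (hk.trans hn)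
      have h2 := hmesh.mesh.step_pos hk0 (hk.trans hn)
      rw [localSize]; positivity
  have hE10 : 0 ≤ E1 := by
    have h1 : 0 ≤ weight α t s w n n :=
      (hmesh.localCoeff_nonneg hn1 hn).trans (hmesh.localCoeff_le_weight hn1 hn)
    have h2 : 0 ≤ ∑ k ∈ range n,
        (weight α t s w n (k + 1) - weight α t s w n k) * localSize σ t k :=
      sum_nonneg fun k hk => mul_nonneg (hmesh.weight_mono (mem_range.1 hk) hn)
        (hloc k (mem_range.1 hk).le)
    have := mul_nonneg h1 (hloc n le_rfl)
    linarith [hmesh.tol_pos]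
  -- temporal truncation at all grid points
  have htime : ∀ j ≤ M, |fastAlikhanov α t s w (fun k => u (x j) (t k)) n
      - caputo α (u (x j)) r| ≤ C1 * E1 := by
    have hzero : ∀ z, (∀ q ∈ Set.Icc 0 T, u z q = 0) →
        |fastAlikhanov α t s w (fun k => u z (t k)) n - caputo α (u z) r| ≤ C1 * E1 := by
      intro z hz
      rw [fastAlikhanov_eq_zero hn1 fun k hk => hz _ (htI k (hk.trans hn)),
        caputo_eq_zero hrT.1.le fun q hq => hz q ⟨hq.1.le, hq.2.le.trans hrT.2⟩, sub_zero, abs_zero]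
      positivity
    intro j hj
    rcases Nat.eq_zero_or_pos j with rfl | hj0
    · rw [hxdef, gridPoint_zero]
      exact hzero xl fun q hq => hu.eq_zero_left hx hT hq
    rcases hj.eq_or_lt with rfl | hjM
    · rw [hxdef, gridPoint_last hM]
      exact hzero xr fun q hq => hu.eq_zero_right hx hT hq
    have hxj := gridPoint_mem_Ioo (xl := xl) (xr := xr) hx hj0 hjM
    have hreg' := hreg.timeReg hK hσ2 hT (l := 0) (by norm_num) hxj
    simp only [iteratedDeriv_zero] at hreg'
    exact hC1' N t Nq s w ε hmesh hcomp (u (x j)) _ _ _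
      (hu.continuousOn_time (gridPoint_mem hx hj hM)) hreg' n hn1 hn
  have hinterp := hC2' u f φ hu hreg N t hmesh.mesh hcomp n hn1 hn
  rw [← hE2] at hinterp
  set W : ℝ → ℝ := fun y => timeInterp (α / 2) (u y) (t (n - 1)) (t n) with hW
  have hxi : x (i + 1) - h = x i := by rw [hxdef, gridPoint_succ]; ring
  have hxi' : x (i + 1) + h = x (i + 2) := (gridPoint_succ (i + 1)).symm
  have hl : xl ≤ x (i + 1) - h := by
    rw [hxi]; exact (gridPoint_mem hx (by omega) hM).1
  have hr' : x (i + 1) + h ≤ xr := by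
    rw [hxi']; exact (gridPoint_mem hx (by omega) hM).2
  -- The function averaged here is the Caputo derivative plus c u - f: it equals a u_xx + b u_x
  -- inside and, unlike the latter, is known to be continuous up to the boundary.
  have hspace := compact_truncation (a := a) (b := b) (G := fun y => caputo α (u y) r + c * u y r - f y r)
    (D := fun m => iteratedDeriv m fun y => u y r) ha hpos hK hQ hl hr'
    (((continuousOn_caputo hα hσ hK hx hT hf hu hreg hrT).add
      ((hu.continuousOn_space (Set.Ioc_subset_Icc_self hrT)).const_mul c)).sub (hf r hrT))
    (by rw [iteratedDeriv_zero]; exact hu.continuousOn_space (Set.Ioc_subset_Icc_self hrT))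
    (fun y hy => by rw [hu.equation y hy r hrT, iteratedDeriv_one]; ring)
    (fun m hm y hy => hreg.hasDerivAt_space hrT hm hy)
    (fun m h3 h6 y hy => hreg.bound_space y hy r hrT m h3 h6)
  rw [← averageOp_gridPoint b ha hx hM, ← fluxOp_gridPoint b ha hx hM, iteratedDeriv_zero,
    ← hC3] at hspace
  have hflux := hinterp.abs_fluxStencil_le ha hpos hQ hl hr'
  rw [← fluxOp_gridPoint b ha hx hM] at hflux
  have havW : |averageOp a b h (fun j => W (x j)) (i + 1)| ≤ (1 + Q) * (C2 * E2) :=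
    abs_averageOp_le ha hpos hQ (hinterp.value _ (gridPoint_mem hx (by omega) hM))
      (hinterp.value _ (gridPoint_mem hx (by omega) hM))
      (hinterp.value _ (gridPoint_mem hx (by omega) hM))
  have havT : |averageOp a b h (fun j => fastAlikhanov α t s w (fun k => u (x j) (t k)) n
      - caputo α (u (x j)) r) (i + 1)| ≤ (1 + Q) * (C1 * E1) :=
    abs_averageOp_le ha hpos hQ (htime i (by omega)) (htime (i + 1) (by omega))
      (htime (i + 2) (by omega))
  have hscheme := hU.scheme n hn1 hn (i + 1) (by omega) (by omega)
  change averageOp a b h (fun j => fastAlikhanov α t s w (fun k => U k j) n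
      + c * offValue (α / 2) (fun k => U k j) n - f (x j) r) (i + 1)
    = fluxOp a b h (fun j => offValue (α / 2) (fun k => U k j) n) (i + 1) at hscheme
  -- The residual splits into temporal truncation, interpolation at the off-set time (in the
  -- reaction and flux terms) and spatial truncation at the off-set time.
  have key : averageOp a b h (fun j => fastAlikhanov α t s w
        (fun k => u (x j) (t k) - U k j) n) (i + 1)
      - (fluxOp a b h (fun j => offValue (α / 2) (fun k => u (x j) (t k) - U k j) n) (i + 1)
        - c * averageOp a b h (fun j => offValue (α / 2)
          (fun k => u (x j) (t k) - U k j) n) (i + 1))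
      = averageOp a b h (fun j => fastAlikhanov α t s w (fun k => u (x j) (t k)) n
          - caputo α (u (x j)) r) (i + 1)
        + c * averageOp a b h (fun j => W (x j)) (i + 1)
        + (averageOp a b h (fun j => caputo α (u (x j)) r + c * u (x j) r - f (x j) r) (i + 1)
          - fluxOp a b h (fun j => u (x j) r) (i + 1))
        - fluxOp a b h (fun j => W (x j)) (i + 1) := by
    simp only [fastAlikhanov_sub α t s w _ _ hn1, hW, timeInterp, ← hoff, offValue] at hscheme ⊢
    simp only [averageOp_succ b ha.ne' hpos.ne', fluxOp_succ b ha.ne' hpos.ne'] at hscheme ⊢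
    linear_combination -hscheme
  rw [key]
  have hcW : |c * averageOp a b h (fun j => W (x j)) (i + 1)| ≤ c * ((1 + Q) * (C2 * E2)) :=
    abs_mul_le_mul (abs_of_nonneg hc).le havW
  have htri : ∀ p q r s : ℝ, |p + q + r - s| ≤ |p| + |q| + |r| + |s| := fun p q r s =>
    (abs_sub _ _).trans (by linarith [abs_add_three p q r])
  refine (htri _ _ _ _).trans ?_
  have hh4 : 0 ≤ h ^ 4 := by positivity
  have hs1 := add_le_add (add_le_add (add_le_add havT hcW) hspace) hflux
  refine hs1.trans ?_
  have e : (1 + Q) * (C1 * E1) + c * ((1 + Q) * (C2 * E2)) + C3 * h ^ 4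
      + (2 * a * (1 + Q ^ 2) + |b|) * (C2 * E2) = (1 + Q) * C1 * E1 + C4 * E2 + C3 * h ^ 4 := by
    rw [hC4]; ring
  rw [e]
  have p1 : 0 ≤ (1 + Q) * C1 := by positivity
  have f1 := mul_nonneg p1 hE20
  have f2 := mul_nonneg p1 hh4
  have f3 := mul_nonneg hC40 hE10
  have f4 := mul_nonneg hC40 hh4
  have f5 := mul_nonneg hC30 hE10
  have f6 := mul_nonneg hC30 hE20
  linarith

end TFBS

namespace TFBS

open Finset

/-! ### The error estimate -/

lemma averageOp_congr {a b h : ℝ} {v v' : ℕ → ℝ} {i : ℕ} (h0 : v i = v' i)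
    (h1 : v (i + 1) = v' (i + 1)) (h2 : v (i + 2) = v' (i + 2)) :
    averageOp a b h v (i + 1) = averageOp a b h v' (i + 1) := by
  simp only [averageOp, secondDiff, centralDiff, Nat.add_sub_cancel, h0, h1, h2]

lemma fluxOp_congr {a b h : ℝ} {v v' : ℕ → ℝ} {i : ℕ} (h0 : v i = v' i)
    (h1 : v (i + 1) = v' (i + 1)) (h2 : v (i + 2) = v' (i + 2)) :
    fluxOp a b h v (i + 1) = fluxOp a b h v' (i + 1) := by
  simp only [fluxOp, secondDiff, centralDiff, Nat.add_sub_cancel, h0, h1, h2]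

lemma discreteNorm_eq (xl xr : ℝ) (M : ℕ) (v : ℕ → ℝ) : discreteNorm xl xr M v
    = Real.sqrt (spaceStep xl xr M * ∑ i ∈ range (M - 1), v (i + 1) ^ 2) := by
  rw [discreteNorm, range_eq_Ico, sum_Ico_add' (fun i => v i ^ 2) 0 (M - 1) 1]
  congr 3

lemma sqrt_sum_sq_le {R : ℕ → ℝ} {m : ℕ} {B : ℝ} (hB : 0 ≤ B) (hR : ∀ i < m, |R i| ≤ B) :
    Real.sqrt (∑ i ∈ range m, R i ^ 2) ≤ Real.sqrt m * B := by
  rw [← Real.sqrt_sq hB, ← Real.sqrt_mul (Nat.cast_nonneg m)]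
  refine Real.sqrt_le_sqrt ?_
  calc ∑ i ∈ range m, R i ^ 2 ≤ ∑ i ∈ range m, B ^ 2 := sum_le_sum fun i hi => by
        rw [← sq_abs]
        have := hR i (mem_range.1 hi)
        gcongr
    _ = m * B ^ 2 := by rw [sum_const, card_range, nsmul_eq_mul]

/-- The error equation, mapped by J into a Hilbert space, is a dissipative evolution driven by the
discrete derivative; barrier stability applies there, with the residual as data. -/
theorem exists_error_bound {α σ γ Cγ K a b c xl xr T : ℝ} (hα : α ∈ Set.Ioo (0 : ℝ) 1)
    (hσ : σ ∈ Set.Ioo (0 : ℝ) 1 ∪ Set.Ioo (1 : ℝ) 2) (hγ : 0 < γ) (hCγ : 0 < Cγ) (hK : 0 ≤ K)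
    (ha : 0 < a) (hc : 0 ≤ c) (hx : xl < xr) (hT : 0 < T) :
    ∃ C, 0 ≤ C ∧ ∀ (u f : ℝ → ℝ → ℝ) (φ : ℝ → ℝ),
      (∀ t ∈ Set.Ioc 0 T, ContinuousOn (fun x => f x t) (Set.Icc xl xr)) →
      IsSolution α a b c xl xr T f φ u → HasRegularity σ K xl xr T u →
      ∀ (N M : ℕ) (t : ℕ → ℝ) (Nq : ℕ) (s w : Fin Nq → ℝ) (ε : ℝ), 1 ≤ N → 1 ≤ M →
      IsFastMesh α T ε N t s w → MeshM2 γ Cγ N t →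
      ∀ U : ℕ → ℕ → ℝ, IsSchemeSolution α a b c xl xr f φ N t s w M U →
      ∀ n ≤ N, discreteNorm xl xr M (fun i => u (gridPoint xl xr M i) (t n) - U n i)
        ≤ C * (maxStep N t ^ min (γ * σ) 2 + spaceStep xl xr M ^ 4 + ε) := by
  have hσ0 : 0 < σ := by rcases hσ with h | h <;> linarith [h.1]
  obtain ⟨μ, hμ0, hμ⟩ := exists_uniform_isSpaceStable b ha hc hx
  obtain ⟨Cc, hCc, hcons⟩ := exists_consistency (b := b) hα hσ hK ha hc hx hT
    (by nlinarith : 1 ≤ 1 + Cγ + Cγ ^ 2)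
  obtain ⟨Cb, hCb, hbar⟩ := exists_barrier hα hγ hCγ hσ0 hT
  -- A bound, in terms of α alone, for the factor 3 per exceptional step.
  set B := (3 : ℝ) ^ ((1 - α) ^ (-(1 / α))) with hB
  have hB0 : 0 ≤ B := by positivity
  refine ⟨μ * (4 * B * (Cb * (μ * Cc))) * Real.sqrt (xr - xl), by positivity, ?_⟩
  intro u f φ hf hu hreg N M t Nq s w ε hN hM hmesh hM2 U hU n hn
  have hτ := maxStep_pos hCγ hN hmesh.mesh hM2
  set X := maxStep N t ^ min (γ * σ) 2 + spaceStep xl xr M ^ 4 + ε with hX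
  have hh := spaceStep_pos (xl := xl) (xr := xr) hx hM
  have hX0 : 0 ≤ X := by
    have := hmesh.tol_pos
    positivity
  rcases hM.eq_or_lt with hM1 | hM1
  · rw [discreteNorm_eq, ← hM1]
    simp only [Nat.sub_self, range_zero, sum_empty, mul_zero, Real.sqrt_zero]
    have : 0 ≤ Real.sqrt (xr - xl) := Real.sqrt_nonneg _
    positivity
  obtain ⟨F, i1, i2, J, hJ1, hJ2⟩ := hμ M hM1
  rw [Nat.sub_add_cancel hM] at hJ1 hJ2
  set x := gridPoint xl xr M with hxdef
  set h := spaceStep xl xr M with hhdef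
  have htI : ∀ k ≤ N, t k ∈ Set.Icc 0 T := fun k hk =>
    ⟨hmesh.mesh.nonneg hk, hmesh.mesh.le_horizon hk⟩
  -- J acts on whole sequences, so the error is cut off beyond M; otherwise its initial value would
  -- not be the zero sequence.
  let e : ℕ → ℕ → ℝ := fun k j => if j ≤ M then u (x j) (t k) - U k j else 0
  have he : ∀ k j, j ≤ M → e k j = u (x j) (t k) - U k j := fun k j hj => if_pos hj
  have he_left : ∀ k ≤ N, e k 0 = 0 := by
    intro k hk
    rw [he k 0 (by omega), hxdef, gridPoint_zero, hu.eq_zero_left hx hT (htI k hk),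
      (hU.boundary k hk).1, sub_zero]
  have he_right : ∀ k ≤ N, e k M = 0 := by
    intro k hk
    rw [he k M le_rfl, hxdef, gridPoint_last hM, hu.eq_zero_right hx hT (htI k hk),
      (hU.boundary k hk).2, sub_zero]
  have he_init : e 0 = 0 := by
    ext j
    rcases Nat.eq_zero_or_pos j with rfl | hj0
    · exact he_left 0 (by omega)
    rcases lt_trichotomy j M with hj | rfl | hj
    · rw [he 0 j hj.le, hmesh.mesh.start, hu.initial _ (gridPoint_mem_Ioo hx hj0 hj),
        hU.initial j hj0 (by omega), sub_self]
      rfl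
    · exact he_right 0 (by omega)
    · exact if_neg (by omega)
  let d : ℕ → ℕ → ℝ := fun n k => weight α t s w n (k + 1) - weight α t s w n k
  let De : ℕ → ℕ → ℝ := fun n j => fastAlikhanov α t s w (fun k => e k j) n
  let oe : ℕ → ℕ → ℝ := fun n j => offValue (α / 2) (fun k => e k j) n
  have hJD : ∀ n, 1 ≤ n → ∑ k ∈ range n, d n k • (J (e n) - J (e k)) = J (De n) := by
    intro n hn
    have : De n = ∑ k ∈ range n, d n k • (e n - e k) := by
      ext j
      simp only [De, fastAlikhanov_eq_weight _ _ _ _ _ hn, Finset.sum_apply, Pi.smul_apply,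
        Pi.sub_apply, smul_eq_mul, d]
    rw [this, map_sum]
    exact sum_congr rfl fun k _ => by rw [map_smul, map_sub]
  have hJo : ∀ n, (α / 2) • J (e (n - 1)) + (1 - α / 2) • J (e n) = J (oe n) := by
    intro n
    have : oe n = (α / 2) • e (n - 1) + (1 - α / 2) • e n := by
      ext j
      simp only [oe, offValue, Pi.add_apply, Pi.smul_apply, smul_eq_mul]
    rw [this, map_add, map_smul, map_smul]
  have hdsum : ∀ n m, ∑ k ∈ range m, d n k = weight α t s w n m := by
    intro n m
    rw [sum_range_sub (weight α t s w n) m, IsFastMesh.weight_zero, sub_zero]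
  -- The root of the number of interior points passes from a pointwise residual bound to the ℓ²
  -- norm; it cancels against √h in `hscale`.
  set A := μ * (Real.sqrt (M - 1 : ℕ) * Cc) with hA
  have hA0 : 0 ≤ A := by positivity
  obtain ⟨Ψ, hΨ0, hΨ1, hΨ⟩ := hbar N t Nq s w ε hN hmesh hM2 (h ^ 4) A (by positivity) hA0
  obtain ⟨bad, hcard, hgood⟩ := hmesh.exists_bad
  have hd : ∀ n, 1 ≤ n → n ≤ N → ∀ k < n, 0 ≤ d n k := fun n _ hn k hk => hmesh.weight_mono hk hn
  have hE : ∀ n, 1 ≤ n → n ≤ N → ∀ i < M - 1,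
      |averageOp a b h (De n) (i + 1)
        - (fluxOp a b h (oe n) (i + 1) - c * averageOp a b h (oe n) (i + 1))|
      ≤ Cc * ((weight α t s w n n * localSize σ t n
        + ∑ k ∈ range n, (weight α t s w n (k + 1) - weight α t s w n k) * localSize σ t k
        + ε) + (step t n / t n) ^ 2 * t n ^ σ + h ^ 4) := by
    intro n hn1 hn i hi
    have key := hcons u f φ hf hu hreg N M t Nq s w ε hmesh
      (isComparable_of_meshM2 hCγ hmesh.mesh hM2) U hU n hn1 hn i (by omega)
    have hej : ∀ j ≤ M, (fun k => e k j) = fun k => u (x j) (t k) - U k j := fun j hj =>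
      funext fun k => he k j hj
    have h1 : ∀ j ≤ M, De n j = fastAlikhanov α t s w (fun k => u (x j) (t k) - U k j) n :=
      fun j hj => by simp only [De, hej j hj]
    have h2 : ∀ j ≤ M, oe n j = offValue (α / 2) (fun k => u (x j) (t k) - U k j) n :=
      fun j hj => by simp only [oe, hej j hj]
    rw [averageOp_congr (v := De n)
      (v' := fun j => fastAlikhanov α t s w (fun k => u (x j) (t k) - U k j) n)
       (h1 i (by omega)) (h1 (i + 1) (by omega)) (h1 (i + 2) (by omega)),
      averageOp_congr (v := oe n)
      (v' := fun j => offValue (α / 2) (fun k => u (x j) (t k) - U k j) n)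
       (h2 i (by omega)) (h2 (i + 1) (by omega)) (h2 (i + 2) (by omega)),
      fluxOp_congr (v := oe n)
      (v' := fun j => offValue (α / 2) (fun k => u (x j) (t k) - U k j) n)
       (h2 i (by omega)) (h2 (i + 1) (by omega)) (h2 (i + 2) (by omega))]
    exact key
  have hr : ∀ n, 1 ≤ n → n ≤ N → 0 ≤ Cc * ((weight α t s w n n * localSize σ t n
        + ∑ k ∈ range n, (weight α t s w n (k + 1) - weight α t s w n k) * localSize σ t k
        + ε) + (step t n / t n) ^ 2 * t n ^ σ + h ^ 4) := fun n hn1 hn =>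
    (abs_nonneg _).trans (hE n hn1 hn 0 (by omega))
  have hzero : ∀ j, (∀ k ≤ N, e k j = 0) → ∀ n, 1 ≤ n → n ≤ N → De n j = 0 ∧ oe n j = 0 := by
    intro j hj n hn1 hn
    refine ⟨fastAlikhanov_eq_zero hn1 fun k hk => hj k (hk.trans hn), ?_⟩
    simp only [oe, offValue, hj n hn, hj (n - 1) (by omega)]
    ring
  have hmain := norm_le_of_barrier (y := fun n => J (e n)) (d := d) (Ψ := Ψ) (N := N)
    (lam := Cb * A * X) (θ := α / 2) hd
    (fun n hn1 hn => by
      rw [hdsum]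
      have h1 := hmesh.weight_one_ge hn1 hn
      have h2 := fracKernel_pos hα.2 (hmesh.mesh.pos hn1 hn)
      have h3 : weight α t s w n 1 ≤ weight α t s w n n := by
        obtain ⟨m, rfl⟩ : ∃ m, n = m + 1 := ⟨n - 1, by omega⟩
        rw [← hdsum, ← hdsum]
        exact sum_le_sum_of_subset_of_nonneg (range_subset_range.2 (by omega))
          fun k hk _ => hd _ hn1 hn k (mem_range.1 hk)
      linarith)
    hΨ0 hΨ1 (by linarith [hα.1]) (by linarith [hα.2]) (by simp only [he_init, map_zero])
    (fun n hn1 hn => by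
      rw [hJD n hn1, hJo n]
      have z0 := hzero 0 he_left n hn1 hn
      have zM := hzero M he_right n hn1 hn
      refine (hJ2 (oe n) (De n) (fun i => averageOp a b h (De n) (i + 1)
        - (fluxOp a b h (oe n) (i + 1) - c * averageOp a b h (oe n) (i + 1)))
        z0.2 zM.2 z0.1 zM.1 (fun i _ => by ring)).trans ?_
      refine mul_le_mul_of_nonneg_right (le_trans ?_ (hΨ n hn1 hn)) (norm_nonneg _)
      have h1 := sqrt_sum_sq_le (hr n hn1 hn) (hE n hn1 hn)
      refine (mul_le_mul_of_nonneg_left h1 hμ0).trans (le_of_eq ?_)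
      rw [hA]
      ring)
    (fun n hn1 hn => le_trans (by
      have h1 := mul_nonneg (mul_nonneg hμ0 (Real.sqrt_nonneg (M - 1 : ℕ))) (hr n hn1 hn)
      refine h1.trans (le_of_eq ?_)
      rw [hA]
      ring) (hΨ n hn1 hn))
    bad
    (fun n hn1 hn hnb => by
      rw [hdsum]
      exact hmesh.energy_condition hn1 hn (hgood n hn1 hn hnb)) n hn
  have hpow : (3 : ℝ) ^ bad.card ≤ B := by
    rw [← Real.rpow_natCast, hB]
    exact Real.rpow_le_rpow_of_exponent_le (by norm_num) hcard
  have hy : ‖J (e n)‖ ≤ 4 * B * (Cb * A * X) := hmain.trans (by gcongr)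
  have hnorm := (hJ1 (e n) (he_left n hn) (he_right n hn)).trans (mul_le_mul_of_nonneg_left hy hμ0)
  have hsum : ∑ i ∈ range (M - 1), (u (x (i + 1)) (t n) - U n (i + 1)) ^ 2
      = ∑ i ∈ range (M - 1), e n (i + 1) ^ 2 := sum_congr rfl fun i hi => by
    have := mem_range.1 hi
    rw [he n (i + 1) (by omega)]
  rw [discreteNorm_eq, hsum, Real.sqrt_mul hh.le]
  have hscale : Real.sqrt h * Real.sqrt (M - 1 : ℕ) ≤ Real.sqrt (xr - xl) := by
    rw [← Real.sqrt_mul hh.le]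
    refine Real.sqrt_le_sqrt ?_
    have h1 := gridPoint_last (xl := xl) (xr := xr) hM
    rw [gridPoint] at h1
    have h2 : ((M - 1 : ℕ) : ℝ) ≤ M := by exact_mod_cast Nat.sub_le M 1
    nlinarith
  calc Real.sqrt h * Real.sqrt (∑ i ∈ range (M - 1), e n (i + 1) ^ 2)
      ≤ Real.sqrt h * (μ * (4 * B * (Cb * A * X))) := by gcongr
    _ = μ * (4 * B * (Cb * (μ * Cc))) * X * (Real.sqrt h * Real.sqrt (M - 1 : ℕ)) := by
        rw [hA]; ring
    _ ≤ μ * (4 * B * (Cb * (μ * Cc))) * X * Real.sqrt (xr - xl) := by gcongr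
    _ = _ := by ring

end TFBS


theorem theorem3p2
    (α σ γ Cγ K a b c xl xr T : ℝ)
    (hα : α ∈ Set.Ioo (0 : ℝ) 1)
    (hσ : σ ∈ Set.Ioo (0 : ℝ) 1 ∪ Set.Ioo (1 : ℝ) 2)
    (hγ : 0 < γ) (hCγ : 0 < Cγ)
    (ha : 0 < a) (hc : 0 ≤ c) (hx : xl < xr) (hT : 0 < T) :
    ∃ C : ℝ, 0 < C ∧
      ∀ (u f : ℝ → ℝ → ℝ) (φ : ℝ → ℝ),
        (∀ t ∈ Set.Ioc 0 T, ContinuousOn (fun x => f x t) (Set.Icc xl xr)) →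
        IsSolution α a b c xl xr T f φ u →
        HasRegularity σ K xl xr T u →
      ∀ (N M : ℕ) (t : ℕ → ℝ), 1 ≤ N → 1 ≤ M →
        IsTimeMesh T N t → MeshM1 N t → MeshM2 γ Cγ N t →
      ∀ (ε Δt : ℝ) (Nq : ℕ) (s w : Fin Nq → ℝ),
        0 < ε →
        ε ≤ min (7 / 11 * fracKernel (1 - α) T) (α / 2 / (1 - α) * fracKernel (1 - α) T) →
        0 < Δt →
        (∀ k, 2 ≤ k → k ≤ N → Δt ≤ (1 - α / 2) * step t k) →
        IsSOE α ε Δt T s w →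
      ∀ U : ℕ → ℕ → ℝ,
        IsSchemeSolution α a b c xl xr f φ N t s w M U →
      ∀ n, 1 ≤ n → n ≤ N →
        discreteNorm xl xr M (fun i => u (gridPoint xl xr M i) (t n) - U n i)
            ≤ C * (maxStep N t ^ min (γ * σ) 2 + spaceStep xl xr M ^ 4 + ε) ∧
        (ε ≤ maxStep N t ^ min (γ * σ) 2 + spaceStep xl xr M ^ 4 →
          discreteNorm xl xr M (fun i => u (gridPoint xl xr M i) (t n) - U n i)
            ≤ C * (maxStep N t ^ min (γ * σ) 2 + spaceStep xl xr M ^ 4)) := by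
  -- K is an arbitrary real number; the bounds remain valid with |K|.
  obtain ⟨C, hC, hbound⟩ := exists_error_bound (b := b) hα hσ hγ hCγ (abs_nonneg K) ha hc hx hT
  -- The factor 2 serves the case ε ≤ X, and 1 is added for strict positivity.
  refine ⟨2 * C + 1, by positivity, ?_⟩
  intro u f φ hf hu hreg N M t hN hM hmesh hM1 hM2 ε Δt Nq s w hε hεle _ hΔle hsoe U hU n _ hn
  have hfast : IsFastMesh α T ε N t s w :=
    ⟨hα, hT, hmesh, hM1, hε, hεle.trans (min_le_left _ _), hεle.trans (min_le_right _ _),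
      hsoe.node_pos, hsoe.weight_pos, fun k hk hkN r hr hrT =>
        hsoe.approx r ⟨(hΔle k hk hkN).trans hr, hrT⟩⟩
  have key := hbound u f φ hf hu (hreg.mono (le_abs_self K)) N M t Nq s w ε hN hM hfast hM2 U hU n hn
  have hτ := maxStep_pos hCγ hN hmesh hM2
  have hpos : 0 < maxStep N t ^ min (γ * σ) 2 + spaceStep xl xr M ^ 4 := by
    have := spaceStep_pos (xl := xl) (xr := xr) hx hM
    positivity
  set X := maxStep N t ^ min (γ * σ) 2 + spaceStep xl xr M ^ 4 with hX
  refine ⟨key.trans (by gcongr; linarith), fun hεX => key.trans ?_⟩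
  calc C * (X + ε) ≤ C * (X + X) := by gcongr
    _ ≤ (2 * C + 1) * X := by linarith
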